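/- Let $\Bbbk$ be a field, $n\ge 1$, $\mathbf a=(a_1,\dots,a_n)$ and $\mathbf b=(b_1,\dots,b_n)$ vectors of positive integers, and let $A=\Bbbk[x_{i,j} : 1\le i\le n,\ 0\le j\le a_i]$ with the $\mathbb Z^n$-grading $\deg x_{i,j}=\mathbf e_i$. Let $I\subseteq A$ be a multigraded ideal and $Z=\operatorname{Spec}(A/I)\subseteq\prod_{i=1}^n\mathbb A^{a_i+1}$. Let $N=\sum_i\binom{a_i+b_i}{a_i}-1$, let $S=\Bbbk[z_{i,\alpha} : 1\le i\le n,\ \alpha\in\mathbb N^{a_i+1},\ |\alpha|=b_i]$ with all variables of degree $1$, and let the correspondence scroll $C(Z;\mathbf b)\subseteq\mathbb P^N=\operatorname{Proj} S$ be the closed subscheme defined by the homogeneous ideal $$K=\ker\bigl(S\to A/I,\quad z_{i,\alpha}\mapsto x_i^\alpha=x_{i,0}^{\alpha_0}\cdots x_{i,a_i}^{\alpha_{a_i}}\bigr).$$ 1. $C(Z;\mathbf b)$ is empty if and only if $\dim Z\le 0$ (where $\dim\emptyset=-\infty$); otherwise $\dim C(Z;\mathbf b)=\dim Z-1$. 2.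 Let $H_{A/I}(t_1,\dots,t_n)=\dim_\Bbbk (A/I)_{(t_1,\dots,t_n)}$ be the multigraded Hilbert function of $A/I$. The Hilbert function $H_{C(Z;\mathbf b)}(s)=\dim_\Bbbk (S/K)_s$ of $C(Z;\mathbf b)$ satisfies, for every integer $s\ge 0$, $$H_{C(Z;\mathbf b)}(s)=\sum_{t\in\mathbb N^n,\ \sum_i t_i=s}H_{A/I}(b_1t_1,\dots,b_nt_n).$$ 3. Suppose moreover that $I$ has no primary component whose radical contains one of the ideals $(x_{i,0},\dots,x_{i,a_i})$, so that $I$ is the ideal of a closed subscheme of $\mathbb P^{\mathbf a}=\prod_{i=1}^n\mathbb P^{a_i}$, also denoted $Z$. If this subscheme has dimension $d\ge 0$ and its class, that is, the class of the sum of its irreducible components, each counted with the length of the local ring of $Z$ at its generic point, is $$c(Z)=\sum_{\alpha\in\mathbb Z^n,\ 0\le\alpha_i\le a_i} r_\alpha\,\zeta^{\mathbf a-\alpha}\in\operatorname{Chow}(\mathbb P^{\mathbf a})=\mathbb Z[\zeta_1,\dots,\zeta_n]/(\zeta_1^{a_1+1},\dots,\zeta_n^{a_n+1}),$$ with $r_\alpha\in\mathbb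 Z$ and $\zeta_i$ the class of the preimage of a hyperplane of $\mathbb P^{a_i}$, then $$\deg C(Z;\mathbf b)=\sum_{|\alpha|=d}r_\alpha\prod_{i=1}^n b_i^{\alpha_i}.$$ Here $\deg C(Z;\mathbf b)$ is $m!$ times the leading coefficient of the Hilbert polynomial of $C(Z;\mathbf b)$, which has degree $m=\dim C(Z;\mathbf b)$. -/

import Mathlib

noncomputable section

namespace CorrScroll

open MvPolynomial

attribute [local instance] MvPolynomial.gradedAlgebra MvPolynomial.weightedGradedAlgebra

/-! ### Hilbert functions -/

/-- The Hilbert function of the quotient `k[σ] / J`, where the variable `v` has degree `w v`: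
at `m` it is the `k`-dimension of the degree `m` part of the quotient, that is, of the image
of the space of forms of degree `m`. -/
def hilbertFunction {k σ M : Type*} [Field k] [AddCommMonoid M] (w : σ → M)
    (J : Ideal (MvPolynomial σ k)) (m : M) : ℕ :=
  Module.finrank k
    ((weightedHomogeneousSubmodule k w m).map (Ideal.Quotient.mkₐ k J).toLinearMap)

/-! ### Closed subschemes of projective space -/

/-- The underlying topological space of the closed subscheme of the projective space
`Proj k[σ]` (all variables in degree one) that is defined by the ideal `J`. -/
def projLocus {k σ : Type*} [Field k] (J : Ideal (MvPolynomial σ k)) :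
    Set (ProjectiveSpectrum (homogeneousSubmodule σ k)) :=
  ProjectiveSpectrum.zeroLocus (homogeneousSubmodule σ k) (J : Set (MvPolynomial σ k))

/-- `D` is the degree of the nonempty closed subscheme of `Proj k[σ]` defined by `J`: the
scheme has dimension `m`, its Hilbert polynomial `P` has degree `m`, and `D` is `m !` times
the leading coefficient of `P`. -/
def HasDegree {k σ : Type*} [Field k] (J : Ideal (MvPolynomial σ k)) (D : ℤ) : Prop :=
  ∃ (m : ℕ) (P : Polynomial ℚ),
    topologicalKrullDim (projLocus J) = (m : WithBot ℕ∞) ∧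
    (∀ᶠ s : ℕ in Filter.atTop,
      (hilbertFunction (fun _ : σ => (1 : ℕ)) J s : ℚ) = P.eval (s : ℚ)) ∧
    P.natDegree = m ∧
    (D : ℚ) = (m.factorial : ℚ) * P.leadingCoeff

/-! ### The Cox ring of a product of projective spaces -/

/-- The polynomial ring in the variables `x_{i,j}`, `i < n`, `0 ≤ j ≤ a i`. -/
abbrev CoxRing (k : Type*) [Field k] {n : ℕ} (a : Fin n → ℕ) : Type _ :=
  MvPolynomial (Σ i : Fin n, Fin (a i + 1)) k

/-- The multidegree of `x_{i,j}` is the `i`-th unit vector. -/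
def multiDeg {n : ℕ} (a : Fin n → ℕ) : (Σ i : Fin n, Fin (a i + 1)) → (Fin n → ℕ) :=
  fun v => Pi.single v.1 1

variable {k : Type*} [Field k] {n : ℕ}

/-- Multigraded (i.e. multihomogeneous) ideals of the Cox ring. -/
def IsMultigraded {a : Fin n → ℕ} (I : Ideal (CoxRing k a)) : Prop :=
  I.IsHomogeneous (weightedHomogeneousSubmodule k (multiDeg a))

/-- The ideal `(x_{i,0}, …, x_{i,a_i})`. -/
def irrelevant (k : Type*) [Field k] (a : Fin n → ℕ) (i : Fin n) : Ideal (CoxRing k a) :=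
  Ideal.span (Set.range fun j : Fin (a i + 1) => (X ⟨i, j⟩ : CoxRing k a))

/-- `I` has no primary component whose radical contains one of the irrelevant ideals
`(x_{i,0}, …, x_{i,a_i})`; the radicals of the primary components are the associated primes.
The multigraded ideals with this property correspond bijectively to the closed subschemes
of `∏ ℙ^{a_i}`. -/
def NoIrrelevantComponent {a : Fin n → ℕ} (I : Ideal (CoxRing k a)) : Prop :=
  ∀ p ∈ associatedPrimes (CoxRing k a) (CoxRing k a ⧸ I), ∀ i, ¬ irrelevant k a i ≤ p

/-! ### Points, cycles and rational equivalence on a product of projective spaces -/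

/-- The points of the scheme `∏ ℙ^{a_i}` (equivalently, its closed subvarieties): the
multigraded primes that contain none of the irrelevant ideals. As a subtype of the prime
spectrum of the Cox ring it carries the Zariski topology. -/
abbrev MultiProj (k : Type*) [Field k] (a : Fin n → ℕ) : Type _ :=
  {p : PrimeSpectrum (CoxRing k a) //
    IsMultigraded p.asIdeal ∧ ∀ i, ¬ irrelevant k a i ≤ p.asIdeal}

/-- The underlying topological space of the closed subscheme of `∏ ℙ^{a_i}` defined
by `I`. -/
def multiProjLocus {a : Fin n → ℕ} (I : Ideal (CoxRing k a)) : Set (MultiProj k a) :=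
  {p | I ≤ p.1.asIdeal}

/-- Algebraic cycles (of all dimensions) on `∏ ℙ^{a_i}`. -/
abbrev Cycles (k : Type*) [Field k] (a : Fin n → ℕ) : Type _ := MultiProj k a →₀ ℤ

open Classical in
/-- The multiplicity of the subvariety `p` in the scheme defined by `I`: if `p` is an
irreducible component, the length of the localization of `A / I` at `p`, otherwise `0`.

Since `p` contains no irrelevant ideal, each `i` has some `x_{i,j} ∉ p`, and so this
is also the length of the local ring of the scheme at `p`, the multidegree zero part of
the localization at multihomogeneous elements. -/
def componentMultiplicity {a : Fin n → ℕ} (I : Ideal (CoxRing k a)) (p : MultiProj k a) : ℕ :=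
  if p.1.asIdeal ∈ I.minimalPrimes then
    (Module.length (Localization.AtPrime p.1.asIdeal)
      (LocalizedModule p.1.asIdeal.primeCompl (CoxRing k a ⧸ I))).toNat
  else 0

/-- The fundamental cycle of the closed subscheme of `∏ ℙ^{a_i}` defined by `I`: the sum of
its irreducible components, each with its multiplicity. -/
def fundamentalCycle {a : Fin n → ℕ} (I : Ideal (CoxRing k a)) : Cycles k a :=
  Finsupp.ofSupportFinite (fun p => (componentMultiplicity I p : ℤ)) (by
    have hfin : I.minimalPrimes.Finite := I.finite_minimalPrimes_of_isNoetherianRing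
    refine (hfin.preimage (f := fun p : MultiProj k a => p.1.asIdeal) ?_).subset ?_
    · intro p _ q _ h
      exact Subtype.ext (PrimeSpectrum.ext h)
    · intro p hp
      by_contra hcon
      apply hp
      have : p.1.asIdeal ∉ I.minimalPrimes := hcon
      simp [componentMultiplicity, this])

/-- The subgroup of cycles rationally equivalent to zero, generated by the divisors of the
nonzero rational functions on the subvarieties `W` of `∏ ℙ^{a_i}`. Such a function is a
quotient `g / h` of two multihomogeneous forms of the same multidegree that do not vanish
identically on `W`, and its divisor is the cycle of `W ∩ {g = 0}` minus the cycle of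
`W ∩ {h = 0}`. -/
def rationallyTrivial (k : Type*) [Field k] (a : Fin n → ℕ) : AddSubgroup (Cycles k a) :=
  AddSubgroup.closure
    {c | ∃ (W : MultiProj k a) (e : Fin n → ℕ) (g h : CoxRing k a),
      IsWeightedHomogeneous (multiDeg a) g e ∧ IsWeightedHomogeneous (multiDeg a) h e ∧
      g ∉ W.1.asIdeal ∧ h ∉ W.1.asIdeal ∧
      c = fundamentalCycle (W.1.asIdeal ⊔ Ideal.span {g}) -
        fundamentalCycle (W.1.asIdeal ⊔ Ideal.span {h})}

/-- The (total) Chow group of `∏ ℙ^{a_i}`. -/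
abbrev Chow (k : Type*) [Field k] (a : Fin n → ℕ) : Type _ :=
  Cycles k a ⧸ rationallyTrivial k a

/-- The class in the Chow group of the closed subscheme defined by `I`. -/
def chowClass {a : Fin n → ℕ} (I : Ideal (CoxRing k a)) : Chow k a :=
  QuotientAddGroup.mk (fundamentalCycle I)

/-- The monomial `ζ^{a - α}` in the Chow group, where `ζ_i` is the class of the preimage of
a hyperplane of `ℙ^{a_i}`: the class of the (transversal) intersection, over all `i`, of the
`a_i - α_i` coordinate hyperplanes `x_{i,j} = 0`, `α_i < j ≤ a_i`. This is a product of
linear subspaces `ℙ^{α_i} ⊆ ℙ^{a_i}`. -/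
def zetaPow (k : Type*) [Field k] (a : Fin n → ℕ) (α : (i : Fin n) → Fin (a i + 1)) :
    Chow k a :=
  chowClass (Ideal.span
    {f : CoxRing k a | ∃ (i : Fin n) (j : Fin (a i + 1)), α i < j ∧ f = X ⟨i, j⟩})

/-! ### Correspondence scrolls -/

/-- The indices `(i, α)` of the variables `z_{i,α}`: `α` runs through the exponent vectors of
the monomials of degree `b i` in `x_{i,0}, …, x_{i,a_i}`. -/
abbrev ScrollVar (a b : Fin n → ℕ) : Type :=
  Σ i : Fin n, {α : Fin (a i + 1) → ℕ // ∑ j, α j = b i}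

/-- The map `k[z_{i,α}] → A / I`, `z_{i,α} ↦ x_i^α`. -/
def scrollMap {a : Fin n → ℕ} (b : Fin n → ℕ) (I : Ideal (CoxRing k a)) :
    MvPolynomial (ScrollVar a b) k →ₐ[k] CoxRing k a ⧸ I :=
  aeval fun v => Ideal.Quotient.mk I (∏ j, (X ⟨v.1, j⟩ : CoxRing k a) ^ v.2.1 j)

/-- The homogeneous ideal that defines the correspondence scroll `C(Z; b)` in the projective
space with coordinates `z_{i,α}`, where `Z` is defined by `I`. -/
def scrollIdeal {a : Fin n → ℕ} (b : Fin n → ℕ) (I : Ideal (CoxRing k a)) :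
    Ideal (MvPolynomial (ScrollVar a b) k) :=
  RingHom.ker (scrollMap b I)

end CorrScroll

end

namespace CorrScroll
open MvPolynomial
section CommAlg

/-! ### Dimension theory of finitely generated algebras -/

/-! The ring `S/K` is the subring of `A/I` made of the multidegrees `(b_i t_i)`, because a monomial
of such a multidegree is a product of `t_i` monomials of degree `b_i` in each block
(`exists_scrollLift_eq_monomial`). This gives the Hilbert function. As `x_{i,j}^{b_i}` lies in the
subring, `A/I` is integral over it, so the Krull dimensions agree (`ringKrullDim_scrollIdeal`), and
passing to Proj lowers the dimension by one (`topologicalKrullDim_projLocus_add_one`).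

For the degree, let `m + 1 = d + n` be the Krull dimension of `A/I`. The coefficient of `s^m` in the
Hilbert polynomial of the scroll is the limit of `s^{-m} ∑_{|t|=s} H(b t)`. Taking this limit for
multigraded primes and extending linearly defines a homomorphism `cycleDegree` on cycles.
Multigraded prime filtrations show that it computes the leading term for any multigraded ideal whose
relevant components are small enough, provided the sum runs over `t ≥ c` only: this discards the
factors supported on irrelevant ideals (`exists_forall_tendsto_diagSumFrom`). If `g` and `h` have
the same multidegree and lie outside `W`, then `W + (g)` and `W + (h)` have the same Hilbert
function, so `cycleDegree` vanishes on rational equivalence (`rationallyTrivial_le_ker_cycleDegree`)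
and descends to the Chow group.

It remains to evaluate it on products of linear subspaces, where `H(b t) = ∏ binom(b_i t_i + α_i,
α_i)` grows like `∏ b_i^{α_i}` times the same product at `t`; the limit is `∏ b_i^{α_i} / m!`
(`tendsto_diagSum_coordIdeal`). When `I` has no irrelevant component, the discarded multidegrees
contribute only lower order (`tendsto_diagSum_of_noIrrelevantComponent`).

Two tools support all of this: the exact sequence `0 → A/(J:f)(-e) → A/J → A/(J+f) → 0`, which
drives `HomIdeal.induction`, and the fact that a hypersurface section of a variety has every
component of dimension exactly one less. Together they identify dimensions with degrees of Hilbert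
polynomials. -/

theorem ringKrullDim_eq_of_isIntegral {R S : Type*} [CommRing R] [CommRing S] [Algebra R S]
    [Algebra.IsIntegral R S] (hinj : Function.Injective (algebraMap R S)) :
    ringKrullDim S = ringKrullDim R := by
  apply le_antisymm
  · refine Order.krullDim_le_of_strictMono (PrimeSpectrum.comap (algebraMap R S)) ?_
    intro p q hpq
    exact Ideal.IsIntegral.comap_lt_comap (I := p.asIdeal) (J := q.asIdeal) hpq
  · refine iSup_le fun l => ?_
    obtain ⟨Q, -, hQ, hQl⟩ := Ideal.exists_ideal_over_prime_of_isIntegral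
      (R := R) (S := S) l.head.asIdeal ⊥ (by
        intro x hx
        rw [Ideal.mem_comap, Ideal.mem_bot, map_eq_zero_iff _ hinj] at hx
        simp [hx])
    have : Q.LiesOver (RelSeries.head l).asIdeal := ⟨hQl.symm⟩
    obtain ⟨L, hL, -, -⟩ := Ideal.exists_ltSeries_of_hasGoingUp (S := S) l Q
    rw [← hL]
    exact Order.LTSeries.length_le_krullDim L

/-- Over a Jacobson ring a maximal ideal of `R[X]` contracts to a maximal ideal of `R`, and its
height is one more than that of the contraction; induct on the number of variables. -/
theorem height_eq_of_isMaximal_mvPolynomial {k : Type*} [Field k] (s : ℕ)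
    (M : Ideal (MvPolynomial (Fin s) k)) [hM : M.IsMaximal] : M.height = s := by
  induction s with
  | zero =>
    apply le_antisymm _ bot_le
    have h := Ideal.height_le_ringKrullDim_of_ne_top hM.ne_top
    rw [MvPolynomial.ringKrullDim_of_isNoetherianRing, ringKrullDim_eq_zero_of_field] at h
    simpa using h
  | succ s ih =>
    set e := (finSuccEquiv k s).toRingEquiv
    set M' : Ideal (Polynomial (MvPolynomial (Fin s) k)) := M.comap e.symm with hM'
    have : M'.IsMaximal := Ideal.comap_isMaximal_of_equiv e.symm
    have hmax := Polynomial.isMaximal_comap_C_of_isJacobsonRing M'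
    have hlo : M'.LiesOver (M'.comap Polynomial.C) := ⟨rfl⟩
    have h1 := Polynomial.height_eq_height_add_one (M'.comap Polynomial.C) M'
    rw [ih (M'.comap Polynomial.C)] at h1
    rw [← RingEquiv.height_comap e.symm, ← hM', h1]
    push_cast; rfl

theorem le_ringKrullDim_quotient_span_singleton {k : Type*} [Field k] {s : ℕ}
    {f : MvPolynomial (Fin s) k} (hf : Ideal.span {f} ≠ ⊤) :
    (s : WithBot ℕ∞) ≤ ringKrullDim (MvPolynomial (Fin s) k ⧸ Ideal.span {f}) + 1 := by
  obtain ⟨M, hM, hfM⟩ := Ideal.exists_le_maximal _ hf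
  have h := Ideal.height_le_ringKrullDim_quotient_add_one (r := f) (p := M)
    (hfM (Ideal.mem_span_singleton_self f))
  rwa [height_eq_of_isMaximal_mvPolynomial] at h

/-- Over the fraction field `c` is a unit and `X` is prime, so only powers of `X` divide. -/
theorem monic_eq_X_pow_of_dvd {F : Type*} [CommRing F] [IsDomain F] {c : F} (hc : c ≠ 0) {r : ℕ}
    {M : Polynomial F} (hM : M.Monic) (h : M ∣ Polynomial.C c * Polynomial.X ^ r) :
    ∃ j, M = Polynomial.X ^ j := by
  let K := FractionRing F
  have hinj : Function.Injective (algebraMap F K) := IsFractionRing.injective F K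
  have h2 : M.map (algebraMap F K) ∣ Polynomial.X ^ r := by
    have h3 := Polynomial.map_dvd (algebraMap F K) h
    rw [Polynomial.map_mul, Polynomial.map_C, Polynomial.map_pow, Polynomial.map_X] at h3
    rwa [IsUnit.dvd_mul_left] at h3
    rw [Polynomial.isUnit_C, isUnit_iff_ne_zero]
    exact (map_ne_zero_iff _ hinj).2 hc
  obtain ⟨j, -, hj⟩ := (dvd_prime_pow Polynomial.prime_X r).1 h2
  refine ⟨j, Polynomial.map_injective _ hinj ?_⟩
  rw [Polynomial.map_pow, Polynomial.map_X]
  exact Polynomial.eq_of_monic_of_associated (hM.map _) (Polynomial.monic_X_pow j) hj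

/-- Going down for principal primes in an integral extension of a normal domain. -/
theorem exists_le_prime_comap_eq_span {P B : Type*} [CommRing P] [CommRing B] [IsDomain P]
    [IsDomain B] [IsIntegrallyClosed P] [Algebra P B] [Algebra.IsIntegral P B]
    (hinj : Function.Injective (algebraMap P B)) {ϖ : P} (hp : Prime ϖ) (q : Ideal B) [q.IsPrime]
    (hq : algebraMap P B ϖ ∈ q) :
    ∃ q' : Ideal B, q'.IsPrime ∧ q' ≤ q ∧ q'.comap (algebraMap P B) = Ideal.span {ϖ} := by
  have : FaithfulSMul P B := (faithfulSMul_iff_algebraMap_injective P B).2 hinj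
  have hpr : (Ideal.span {ϖ} : Ideal P).IsPrime := (Ideal.span_singleton_prime hp.ne_zero).2 hp
  -- A prime containing `ϖ` and disjoint from `T` lies inside `q` and contracts to exactly `(ϖ)`, so
  -- it suffices that `ϖB` misses `T`.
  let T : Submonoid B := q.primeCompl ⊔ (Ideal.span {ϖ} : Ideal P).primeCompl.map (algebraMap P B)
  have hdisj : Disjoint ((Ideal.span {algebraMap P B ϖ} : Ideal B) : Set B) (T : Set B) := by
    rw [Set.disjoint_left]
    rintro x hx hxT
    obtain ⟨s, hs, _, ⟨y, hy, rfl⟩, rfl⟩ := Submonoid.mem_sup.1 hxT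
    obtain ⟨b, hb⟩ := Ideal.mem_span_singleton'.1 hx
    have hb' := Algebra.IsIntegral.isIntegral (R := P) b
    set Q := minpoly P b
    have hQ0 : Polynomial.aeval b Q = 0 := minpoly.aeval P b
    -- From `s y = ϖ b` and an integral equation `Q(b) = 0` of degree `d`, the polynomial `∑ Q_i
    -- ϖ^{d-i} y^i X^i` takes the value `ϖ^d Q(b) = 0` at `s`.
    let G : Polynomial P := ∑ i ∈ Finset.range (Q.natDegree + 1),
      Polynomial.C (Q.coeff i * ϖ ^ (Q.natDegree - i) * y ^ i) * Polynomial.X ^ i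
    have hG0 : Polynomial.aeval s G = 0 := by
      have : Polynomial.aeval s G = (algebraMap P B ϖ) ^ Q.natDegree * Polynomial.aeval b Q := by
        rw [Polynomial.aeval_eq_sum_range (p := Q), Finset.mul_sum, map_sum]
        refine Finset.sum_congr rfl fun i hi => ?_
        have hi' : i ≤ Q.natDegree := Nat.lt_succ_iff.1 (Finset.mem_range.1 hi)
        have e1 : (algebraMap P B ϖ) ^ Q.natDegree * b ^ i
            = (algebraMap P B ϖ) ^ (Q.natDegree - i) * (s * algebraMap P B y) ^ i := by
          rw [← hb, mul_pow, ← Nat.sub_add_cancel hi', pow_add]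
          simp only [Nat.add_sub_cancel_right]
          ring
        rw [Algebra.smul_def, mul_left_comm, e1]
        simp only [map_mul, Polynomial.aeval_C, map_pow, Polynomial.aeval_X]
        ring
      rw [this, hQ0, mul_zero]
    have hdvd := minpoly.isIntegrallyClosed_dvd (Algebra.IsIntegral.isIntegral (R := P) s) hG0
    let φ := Ideal.Quotient.mk (Ideal.span {ϖ} : Ideal P)
    have hφ : φ ϖ = 0 := Ideal.Quotient.eq_zero_iff_mem.2 (Ideal.mem_span_singleton_self ϖ)
    -- Modulo `ϖ` only the top term `y^d X^d` survives. The minimal polynomial of `s` divides `G`,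
    -- so it reduces to a power of `X`; this puts a power of `s` into `ϖB ⊆ q`, against `s ∉ q`.
    have hGφ : G.map φ = Polynomial.C (φ y ^ Q.natDegree) * Polynomial.X ^ Q.natDegree := by
      rw [Polynomial.map_sum, Finset.sum_eq_single Q.natDegree]
      · have : Q.coeff Q.natDegree = 1 := minpoly.monic hb'
        simp [this]
      · intro i hi hne
        have : i < Q.natDegree := lt_of_le_of_ne (Nat.lt_succ_iff.1 (Finset.mem_range.1 hi)) hne
        have h0 : Q.natDegree - i ≠ 0 := by omega
        simp [hφ, h0]
      · intro h; simp at h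
    have hdvd' := Polynomial.map_dvd φ hdvd
    rw [hGφ] at hdvd'
    obtain ⟨j, hj⟩ := monic_eq_X_pow_of_dvd (pow_ne_zero _ (fun h =>
      hy (Ideal.Quotient.eq_zero_iff_mem.1 h)))
      ((minpoly.monic (Algebra.IsIntegral.isIntegral (R := P) s)).map φ) hdvd'
    have hker : minpoly P s - Polynomial.X ^ j ∈
        Ideal.map (Polynomial.C) (Ideal.span {ϖ} : Ideal P) := by
      have : (minpoly P s - Polynomial.X ^ j).map φ = 0 := by
        rw [Polynomial.map_sub, hj]; simp
      rw [Ideal.mem_map_C_iff]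
      intro n
      have h2 := congrArg (fun p => Polynomial.coeff p n) this
      simp only [Polynomial.coeff_map, Polynomial.coeff_zero] at h2
      exact Ideal.Quotient.eq_zero_iff_mem.1 h2
    rw [Ideal.map_span, Set.image_singleton, Ideal.mem_span_singleton'] at hker
    obtain ⟨h, hh⟩ := hker
    have h3 := congrArg (Polynomial.aeval s) hh
    simp only [map_mul, Polynomial.aeval_C, map_sub, minpoly.aeval, map_pow, Polynomial.aeval_X,
      zero_sub] at h3
    have : s ^ j ∈ q := by
      rw [← neg_neg (s ^ j), ← h3]
      exact q.neg_mem (q.mul_mem_left _ hq)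
    exact hs (Ideal.IsPrime.mem_of_pow_mem inferInstance j this)
  obtain ⟨q', hq'p, hle, hd⟩ := Ideal.exists_le_prime_disjoint _ _ hdisj
  refine ⟨q', hq'p, ?_, ?_⟩
  · intro x hx
    by_contra hxq
    exact Set.disjoint_left.1 hd hx (Submonoid.mem_sup_left hxq)
  · apply le_antisymm
    · intro x hx
      by_contra hxq
      exact Set.disjoint_left.1 hd hx (Submonoid.mem_sup_right ⟨x, hxq, rfl⟩)
    · rw [Ideal.span_singleton_le_iff_mem]
      exact hle (Ideal.mem_span_singleton_self _)

/-- Noether normalization makes `B` integral over a polynomial ring `P`, where a hypersurface has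
codimension one. Going down shows that `q` contracts to a principal prime `(ϖ)` of `P`, and
integrality gives `dim B/q = dim P/(ϖ)`. -/
theorem ringKrullDim_quotient_add_one_of_mem_minimalPrimes_span {k B : Type*} [Field k]
    [CommRing B] [IsDomain B] [Algebra k B] [Algebra.FiniteType k B] {g : B} (hg : g ≠ 0)
    {q : Ideal B} (hq : q ∈ (Ideal.span {g}).minimalPrimes) :
    ringKrullDim (B ⧸ q) + 1 = ringKrullDim B := by
  have hqp : q.IsPrime := hq.1.1
  have hgq : g ∈ q := hq.1.2 (Ideal.mem_span_singleton_self g)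
  apply le_antisymm
  · exact ringKrullDim_succ_le_of_surjective (Ideal.Quotient.mk q) Ideal.Quotient.mk_surjective
      (mem_nonZeroDivisors_of_ne_zero hg) (Ideal.Quotient.eq_zero_iff_mem.2 hgq)
  have : IsNoetherianRing B := Algebra.FiniteType.isNoetherianRing k B
  obtain ⟨s, φ, hφ, hint⟩ := exists_integral_inj_algHom_of_fg k B
  let : Algebra (MvPolynomial (Fin s) k) B := φ.toRingHom.toAlgebra
  have : Algebra.IsIntegral (MvPolynomial (Fin s) k) B := ⟨hint⟩
  have hinj : Function.Injective (algebraMap (MvPolynomial (Fin s) k) B) := hφ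
  rw [ringKrullDim_eq_of_isIntegral hinj, MvPolynomial.ringKrullDim_of_isNoetherianRing,
    ringKrullDim_eq_zero_of_field, Nat.card_fin, zero_add]
  set p := q.comap (algebraMap (MvPolynomial (Fin s) k) B) with hp
  have hpp : p.IsPrime := Ideal.IsPrime.comap _
  have hp0 : p ≠ ⊥ := Ideal.comap_ne_bot_of_integral_mem hg hgq (Algebra.IsIntegral.isIntegral g)
  obtain ⟨ϖ, hϖp, hϖ⟩ := hpp.exists_mem_prime_of_ne_bot hp0
  obtain ⟨q', hq'p, hq'q, hq'⟩ := exists_le_prime_comap_eq_span hinj hϖ q hϖp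
  -- By Krull's principal ideal theorem `q` has height at most one, so a strictly smaller `q'` would
  -- be zero and could not lie over `(ϖ)`.
  have hqq : q' = q := by
    by_contra hne
    have hlt : q' < q := lt_of_le_of_ne hq'q hne
    have h1 := Ideal.height_le_one_of_isPrincipal_of_mem_minimalPrimes _ q hq
    have h2 := (Ideal.height_le_iff (n := 1)).1 (by exact_mod_cast h1) q' hq'p hlt
    have h3 : q'.height = 0 := by
      have : q'.height < 1 := by exact_mod_cast h2
      simpa [Order.lt_one_iff] using this
    rw [Ideal.height_eq_zero_iff_eq_bot] at h3
    rw [h3, Ideal.comap_bot_of_injective _ hinj] at hq'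
    exact hϖ.ne_zero (Ideal.span_singleton_eq_bot.1 hq'.symm)
  rw [hqq] at hq'
  have hdim : ringKrullDim (B ⧸ q) =
      ringKrullDim (MvPolynomial (Fin s) k ⧸ p) := by
    have : q.LiesOver p := ⟨rfl⟩
    exact ringKrullDim_eq_of_isIntegral (Ideal.algebraMap_quotient_injective)
  rw [hdim, hp, hq']
  refine le_ringKrullDim_quotient_span_singleton ?_
  rw [← hq']
  exact hpp.ne_top

/-- The dimension of the quotient by a prime drops by exactly one in a component of a
hypersurface section. -/
theorem ringKrullDim_quotient_add_one_of_mem_minimalPrimes {k R : Type*} [Field k] [CommRing R]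
    [Algebra k R] [Algebra.FiniteType k R] {W : Ideal R} [W.IsPrime] {g : R} (hg : g ∉ W)
    {q : Ideal R} (hq : q ∈ (W ⊔ Ideal.span {g}).minimalPrimes) :
    ringKrullDim (R ⧸ q) + 1 = ringKrullDim (R ⧸ W) := by
  have hWq : W ≤ q := le_sup_left.trans hq.1.2
  have hq' : q.map (Ideal.Quotient.mk W) ∈
      (Ideal.span {Ideal.Quotient.mk W g}).minimalPrimes := by
    have h := Ideal.minimalPrimes_map_of_surjective (f := Ideal.Quotient.mk W)
      Ideal.Quotient.mk_surjective (W ⊔ Ideal.span {g})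
    have e : (W ⊔ Ideal.span {g}).map (Ideal.Quotient.mk W)
        = Ideal.span {Ideal.Quotient.mk W g} := by
      rw [Ideal.map_sup, Ideal.map_quotient_self, bot_sup_eq, Ideal.map_span, Set.image_singleton]
    rw [← e, h]
    refine ⟨q, ?_, rfl⟩
    rwa [Ideal.mk_ker, sup_eq_left.2 (le_sup_left)]
  rw [← ringKrullDim_quotient_add_one_of_mem_minimalPrimes_span (k := k) (B := R ⧸ W)
    (fun h => hg (Ideal.Quotient.eq_zero_iff_mem.1 h)) hq']
  rw [ringKrullDim_eq_of_ringEquiv (DoubleQuot.quotQuotEquivQuotOfLE hWq)]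

end CommAlg
end CorrScroll

namespace CorrScroll
open MvPolynomial
section HomogeneousIdeals

/-! ### Homogeneous ideals for a weighted grading -/

variable {k σ M : Type*} [Field k]

/-- All components of the elements of `J` with respect to the weight `w` belong to `J`. -/
def HomIdeal [AddCommMonoid M] (w : σ → M) (J : Ideal (MvPolynomial σ k)) : Prop :=
  ∀ f ∈ J, ∀ m, weightedHomogeneousComponent w m f ∈ J

section AddCommMonoid

variable [AddCommMonoid M] {w : σ → M}

theorem sum_image_weightedHomogeneousComponent [DecidableEq M] (w : σ → M)
    (f : MvPolynomial σ k) :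
    ∑ m ∈ f.support.image (Finsupp.weight w), weightedHomogeneousComponent w m f = f := by
  conv_rhs => rw [← sum_weightedHomogeneousComponent w f]
  rw [finsum_eq_sum_of_support_subset]
  intro m hm
  by_contra h
  exact hm (weightedHomogeneousComponent_eq_zero_of_notMem w f m (by simpa using h))

theorem isHomogeneous_iff_homIdeal [DecidableEq M] {J : Ideal (MvPolynomial σ k)} :
    letI := weightedGradedAlgebra k w
    J.IsHomogeneous (weightedHomogeneousSubmodule k w) ↔ HomIdeal w J := by
  let := weightedGradedAlgebra k w
  constructor
  · intro h f hf m
    exact weightedHomogeneousComponent_mem_of_mem k w h hf m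
  · intro h m f hf
    have := h f hf m
    rwa [← weightedDecomposition.decompose'_apply] at this

theorem HomIdeal.iInf {ι : Sort*} {J : ι → Ideal (MvPolynomial σ k)} (h : ∀ i, HomIdeal w (J i)) :
    HomIdeal w (⨅ i, J i) := by
  intro f hf m
  rw [Ideal.mem_iInf] at hf ⊢
  exact fun i => h i f (hf i) m

theorem HomIdeal.sup {J₁ J₂ : Ideal (MvPolynomial σ k)} (h₁ : HomIdeal w J₁)
    (h₂ : HomIdeal w J₂) : HomIdeal w (J₁ ⊔ J₂) := by
  intro f hf m
  obtain ⟨a, ha, b, hb, rfl⟩ := Submodule.mem_sup.1 hf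
  rw [map_add]
  exact add_mem (Ideal.mem_sup_left (h₁ a ha m)) (Ideal.mem_sup_right (h₂ b hb m))

variable [IsCancelAdd M]

theorem weightedHomogeneousComponent_add_mul {f : MvPolynomial σ k} {e : M}
    (hf : IsWeightedHomogeneous w f e) (m : M) (z : MvPolynomial σ k) :
    weightedHomogeneousComponent w (m + e) (f * z) =
      f * weightedHomogeneousComponent w m z := by
  classical
  induction z using MvPolynomial.induction_on' with
  | monomial d c =>
    have hz := isWeightedHomogeneous_monomial w d c rfl
    rw [weightedHomogeneousComponent_of_mem (hf.mul hz), weightedHomogeneousComponent_of_mem hz,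
      add_comm e, add_left_inj]
    split_ifs <;> simp
  | add p q hp hq => rw [mul_add, map_add, map_add, hp, hq, mul_add]

omit [IsCancelAdd M] in
theorem weightedHomogeneousComponent_mul_eq_zero {f : MvPolynomial σ k} {e : M}
    (hf : IsWeightedHomogeneous w f e) {m : M} (hm : ¬ ∃ m', m = m' + e) (z : MvPolynomial σ k) :
    weightedHomogeneousComponent w m (f * z) = 0 := by
  classical
  induction z using MvPolynomial.induction_on' with
  | monomial d c =>
    have hz := isWeightedHomogeneous_monomial w d c rfl
    rw [weightedHomogeneousComponent_of_mem (hf.mul hz), if_neg]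
    rintro rfl
    exact hm ⟨_, add_comm _ _⟩
  | add p q hp hq => rw [mul_add, map_add, hp, hq, add_zero]

theorem HomIdeal.span_of_isWeightedHomogeneous {s : Set (MvPolynomial σ k)}
    (hs : ∀ f ∈ s, ∃ e, IsWeightedHomogeneous w f e) : HomIdeal w (Ideal.span s) := by
  intro f hf m
  induction hf using Submodule.span_induction with
  | mem x hx =>
    classical
    obtain ⟨e, he⟩ := hs x hx
    rw [weightedHomogeneousComponent_of_mem he]
    split_ifs
    · exact Ideal.subset_span hx
    · exact zero_mem _
  | zero => rw [map_zero]; exact zero_mem _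
  | add x y _ _ hx hy => rw [map_add]; exact add_mem hx hy
  | smul a x hx ih =>
    -- The hypothesis covers `x` only; a second induction with the multiplier left free is needed
    -- for `a * x`.
    clear ih
    rw [smul_eq_mul, mul_comm]
    induction hx using Submodule.span_induction generalizing a with
    | mem x hx =>
      obtain ⟨e, he⟩ := hs x hx
      by_cases hm : ∃ m', m = m' + e
      · obtain ⟨m', rfl⟩ := hm
        rw [weightedHomogeneousComponent_add_mul he]
        exact Ideal.mul_mem_right _ _ (Ideal.subset_span hx)
      · rw [weightedHomogeneousComponent_mul_eq_zero he hm]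
        exact zero_mem _
    | zero => rw [zero_mul, map_zero]; exact zero_mem _
    | add x y _ _ hx hy => rw [add_mul, map_add]; exact add_mem (hx a) (hy a)
    | smul b x _ hx =>
      rw [smul_eq_mul, mul_comm b, mul_assoc]
      exact hx _

theorem HomIdeal.sup_span_singleton {J : Ideal (MvPolynomial σ k)} (hJ : HomIdeal w J)
    {f : MvPolynomial σ k} {e : M} (hf : IsWeightedHomogeneous w f e) :
    HomIdeal w (J ⊔ Ideal.span {f}) :=
  hJ.sup (HomIdeal.span_of_isWeightedHomogeneous (by rintro g rfl; exact ⟨e, hf⟩))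

end AddCommMonoid

/-- The ideal quotient `J : f`. -/
def colonElem {R : Type*} [CommRing R] (J : Ideal R) (f : R) : Ideal R :=
  Submodule.comap (LinearMap.mulLeft R f) J

theorem mem_colonElem {R : Type*} [CommRing R] {J : Ideal R} {f z : R} :
    z ∈ colonElem J f ↔ f * z ∈ J := Iff.rfl

theorem le_colonElem {R : Type*} [CommRing R] (J : Ideal R) (f : R) : J ≤ colonElem J f :=
  fun _ hz => J.mul_mem_left f hz

theorem colonElem_eq_self {R : Type*} [CommRing R] {p : Ideal R} [hp : p.IsPrime] {f : R}
    (hf : f ∉ p) : colonElem p f = p :=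
  le_antisymm (fun _ hz => (hp.mem_or_mem hz).resolve_left hf) (le_colonElem p f)

theorem HomIdeal.colonElem [AddCommMonoid M] [IsCancelAdd M] {w : σ → M}
    {J : Ideal (MvPolynomial σ k)} (hJ : HomIdeal w J)
    {f : MvPolynomial σ k} {e : M} (hf : IsWeightedHomogeneous w f e) :
    HomIdeal w (colonElem J f) := by
  intro z hz m
  rw [mem_colonElem, ← weightedHomogeneousComponent_add_mul hf]
  exact hJ _ hz _

/-- Homogeneous ideals for the weight `w` are prime once this holds for homogeneous elements. -/
def PrimeTest (k : Type*) [Field k] [AddCommMonoid M] (w : σ → M) : Prop :=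
  ∀ J : Ideal (MvPolynomial σ k), HomIdeal w J → J ≠ ⊤ →
    (∀ f g d e, IsWeightedHomogeneous w f d → IsWeightedHomogeneous w g e →
      f * g ∈ J → f ∈ J ∨ g ∈ J) → J.IsPrime

theorem primeTest_of_linearOrder [AddCommMonoid M] [LinearOrder M] [IsOrderedCancelAddMonoid M]
    (w : σ → M) : PrimeTest k w := by
  intro J hJ hne h
  let := weightedGradedAlgebra k w
  refine Ideal.IsHomogeneous.isPrime_of_homogeneous_mem_or_mem
    (𝒜 := weightedHomogeneousSubmodule k w) (isHomogeneous_iff_homIdeal.2 hJ) hne ?_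
  rintro f g ⟨d, hd⟩ ⟨e, he⟩ hfg
  exact h f g d e hd he hfg

theorem weight_comp {L : Type*} [AddCommMonoid M] [AddCommMonoid L] (φ : M →+ L) (w : σ → M)
    (d : σ →₀ ℕ) : Finsupp.weight (φ ∘ w) d = φ (Finsupp.weight w d) := by
  simp only [Finsupp.weight_apply, Finsupp.sum, map_sum, map_nsmul, Function.comp]

theorem weightedHomogeneousComponent_comp {L : Type*} [AddCommMonoid M] [AddCommMonoid L]
    [DecidableEq M] [DecidableEq L] (φ : M →+ L) (w : σ → M) (l : L) (f : MvPolynomial σ k) :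
    weightedHomogeneousComponent (φ ∘ w) l f =
      ∑ m ∈ (f.support.image (Finsupp.weight w)).filter (φ · = l),
        weightedHomogeneousComponent w m f := by
  ext d
  rw [coeff_weightedHomogeneousComponent, coeff_sum, weight_comp]
  simp only [coeff_weightedHomogeneousComponent]
  rw [Finset.sum_ite_eq]
  by_cases hd : coeff d f = 0
  · simp [hd]
  · have : Finsupp.weight w d ∈ f.support.image (Finsupp.weight w) :=
      Finset.mem_image_of_mem _ (mem_support_iff.2 hd)
    simp [this]

theorem HomIdeal.comp {L : Type*} [AddCommMonoid M] [AddCommMonoid L] (φ : M →+ L) {w : σ → M}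
    {J : Ideal (MvPolynomial σ k)} (hJ : HomIdeal w J) : HomIdeal (φ ∘ w) J := by
  classical
  intro f hf l
  rw [weightedHomogeneousComponent_comp]
  exact J.sum_mem fun m _ => hJ f hf m

/-- An injective relabelling of degrees does not change which elements are homogeneous. -/
theorem PrimeTest.of_comp {L : Type*} [AddCommMonoid M] [AddCommMonoid L] {φ : M →+ L}
    (hφ : Function.Injective φ) {w : σ → M} (h : PrimeTest k (φ ∘ w)) : PrimeTest k w := by
  intro J hJ hne hJp
  refine h J (hJ.comp φ) hne fun f g d e hf hg hfg => ?_
  have key : ∀ f : MvPolynomial σ k, ∀ d, IsWeightedHomogeneous (φ ∘ w) f d →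
      ∃ d', IsWeightedHomogeneous w f d' := by
    intro f d hf
    by_cases h0 : f = 0
    · exact ⟨0, h0 ▸ isWeightedHomogeneous_zero k w 0⟩
    · obtain ⟨c, hc⟩ := MvPolynomial.exists_coeff_ne_zero h0
      refine ⟨Finsupp.weight w c, fun c' hc' => hφ ?_⟩
      rw [← weight_comp, ← weight_comp, hf hc, hf hc']
  obtain ⟨d', hd⟩ := key f d hf
  obtain ⟨e', he⟩ := key g e hg
  exact hJp f g d' e' hd he hfg

theorem primeTest_nat (w : σ → ℕ) : PrimeTest k w := primeTest_of_linearOrder w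

/-- The pointwise order on `ℕ^n` is not linear, so the grading is relabelled by the
lexicographically ordered copy of the same monoid. -/
theorem primeTest_pi {n : ℕ} (w : σ → (Fin n → ℕ)) : PrimeTest k w :=
  PrimeTest.of_comp (L := Lex (Fin n → ℕ))
    (φ := { toFun := toLex, map_zero' := rfl, map_add' := fun _ _ => rfl })
    (fun _ _ h => h) (primeTest_of_linearOrder _)

/-- Noetherian induction on homogeneous ideals: a property of homogeneous primes that can be
deduced for `J` from `J + (f)` and `J : f` holds for all homogeneous ideals. -/
theorem HomIdeal.induction [AddCommMonoid M] [IsCancelAdd M] [Finite σ] {w : σ → M}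
    (hw : PrimeTest k w) {C : Ideal (MvPolynomial σ k) → Prop} (top : C ⊤)
    (prime : ∀ p, p.IsPrime → HomIdeal w p → (∀ J, p < J → HomIdeal w J → C J) → C p)
    (step : ∀ J f e, HomIdeal w J → IsWeightedHomogeneous w f e →
      C (J ⊔ Ideal.span {f}) → C (CorrScroll.colonElem J f) → C J)
    (J : Ideal (MvPolynomial σ k)) (hJ : HomIdeal w J) : C J := by
  induction J using WellFoundedGT.induction with
  | ind J ih =>
    by_cases hne : J = ⊤
    · exact hne ▸ top
    by_cases h : ∀ f g d e, IsWeightedHomogeneous w f d → IsWeightedHomogeneous w g e →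
      f * g ∈ J → f ∈ J ∨ g ∈ J
    · exact prime J (hw J hJ hne h) hJ ih
    push Not at h
    obtain ⟨f, g, d, e, hf, hg, hfg, hfJ, hgJ⟩ := h
    -- Both ideals are strictly larger than `J`: the first contains `f`, the second contains `g`.
    refine step J f d hJ hf (ih _ ?_ (hJ.sup_span_singleton hf)) (ih _ ?_ (hJ.colonElem hf))
    · refine lt_of_le_of_ne le_sup_left fun h => hfJ ?_
      rw [h]
      exact Ideal.mem_sup_right (Ideal.mem_span_singleton_self f)
    · refine lt_of_le_of_ne (le_colonElem J f) fun h => hgJ ?_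
      rw [h]
      exact hfg

/-- The zero locus of `J` is covered by those of `J + (f)` and `J : f`, so its dimension can be
bounded on the two ends of the exact sequence. -/
theorem le_of_isPrime_of_le {R : Type*} [CommRing R] {J p : Ideal R} [hp : p.IsPrime] (hJ : J ≤ p)
    (f : R) : J ⊔ Ideal.span {f} ≤ p ∨ colonElem J f ≤ p := by
  by_cases hf : f ∈ p
  · exact Or.inl (sup_le hJ ((Ideal.span_singleton_le_iff_mem p).2 hf))
  · exact Or.inr fun z hz => (hp.mem_or_mem (hJ hz)).resolve_left hf

end HomogeneousIdeals

section HilbertFunction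

/-! ### Exact sequences and Hilbert functions -/

variable {k σ M : Type*} [Field k] [AddCommMonoid M] {w : σ → M}

/-- The degree `m` part of the ideal `J`. -/
noncomputable def degreePart (w : σ → M) (J : Ideal (MvPolynomial σ k)) (m : M) :
    Submodule k (MvPolynomial σ k) :=
  J.restrictScalars k ⊓ weightedHomogeneousSubmodule k w m

theorem degreePart_mono {J J' : Ideal (MvPolynomial σ k)} (h : J ≤ J') (m : M) :
    degreePart w J m ≤ degreePart w J' m := fun _ hf => ⟨h hf.1, hf.2⟩

variable (hfin : ∀ m, FiniteDimensional k (weightedHomogeneousSubmodule k w m))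

include hfin

theorem hilbertFunction_add_finrank (J : Ideal (MvPolynomial σ k)) (m : M) :
    hilbertFunction w J m + Module.finrank k (degreePart w J m) =
      Module.finrank k (weightedHomogeneousSubmodule k w m) := by
  have := hfin m
  have h := LinearMap.finrank_range_add_finrank_ker
    ((Ideal.Quotient.mkₐ k J).toLinearMap.domRestrict (weightedHomogeneousSubmodule k w m))
  rw [LinearMap.range_domRestrict] at h
  rw [← h, hilbertFunction]
  congr 1
  rw [LinearMap.ker_domRestrict, ← Submodule.finrank_map_subtype_eq,
    Submodule.map_comap_subtype, degreePart, inf_comm]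
  have hk : J.restrictScalars k = (Ideal.Quotient.mkₐ k J).toLinearMap.ker := by
    ext x
    simp [Ideal.Quotient.eq_zero_iff_mem]
  rw [hk]

theorem hilbertFunction_eq_of_degreePart_eq {J J' : Ideal (MvPolynomial σ k)} {m : M}
    (h : degreePart w J m = degreePart w J' m) :
    hilbertFunction w J m = hilbertFunction w J' m := by
  have h1 := hilbertFunction_add_finrank hfin J m
  have h2 := hilbertFunction_add_finrank hfin J' m
  rw [h] at h1
  omega

theorem hilbertFunction_eq_zero_iff {J : Ideal (MvPolynomial σ k)} {m : M} :
    hilbertFunction w J m = 0 ↔ ∀ f, IsWeightedHomogeneous w f m → f ∈ J := by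
  have := hfin m
  rw [hilbertFunction, Submodule.finrank_eq_zero, ← le_bot_iff, Submodule.map_le_iff_le_comap]
  refine ⟨fun h f hf => ?_, fun h f hf => ?_⟩
  · have := h hf
    simpa [Ideal.Quotient.eq_zero_iff_mem] using this
  · simpa [Ideal.Quotient.eq_zero_iff_mem] using h f hf

theorem hilbertFunction_top (m : M) :
    hilbertFunction w (⊤ : Ideal (MvPolynomial σ k)) m = 0 :=
  (hilbertFunction_eq_zero_iff hfin).2 fun _ _ => trivial

theorem hilbertFunction_sup_span_of_not_exists {J : Ideal (MvPolynomial σ k)} (hJ : HomIdeal w J)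
    {f : MvPolynomial σ k} {e : M} (hf : IsWeightedHomogeneous w f e) {m : M}
    (hm : ¬ ∃ m', m = m' + e) :
    hilbertFunction w (J ⊔ Ideal.span {f}) m = hilbertFunction w J m := by
  refine hilbertFunction_eq_of_degreePart_eq hfin (le_antisymm ?_ (degreePart_mono le_sup_left m))
  rintro x ⟨hx, hxm⟩
  refine ⟨?_, hxm⟩
  obtain ⟨y, hy, z, hz, rfl⟩ := Submodule.mem_sup.1 hx
  obtain ⟨z', rfl⟩ := Ideal.mem_span_singleton'.1 hz
  have h1 := IsWeightedHomogeneous.weightedHomogeneousComponent_same hxm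
  rw [map_add, mul_comm z', weightedHomogeneousComponent_mul_eq_zero hf hm, add_zero] at h1
  rw [mul_comm z', ← h1]
  exact hJ y hy m

/-- The exact sequence `0 → A/(J:f)(-e) → A/J → A/(J+f) → 0` in degree `m + e`. It is obtained by
counting inside the polynomial ring `A`: `(J+(f))_{m+e} = J_{m+e} + f A_m`, and these two spaces
meet in `f (J:f)_m`. -/
theorem hilbertFunction_add [IsCancelAdd M] {J : Ideal (MvPolynomial σ k)} (hJ : HomIdeal w J)
    {f : MvPolynomial σ k} {e : M} (hf : IsWeightedHomogeneous w f e) (m : M) :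
    hilbertFunction w J (m + e) =
      hilbertFunction w (J ⊔ Ideal.span {f}) (m + e) + hilbertFunction w (colonElem J f) m := by
  -- The dimension count needs multiplication by `f` to be injective on polynomials.
  by_cases h0 : f = 0
  · have : colonElem J f = ⊤ := by
      rw [eq_top_iff]; intro z _; rw [mem_colonElem, h0, zero_mul]; exact J.zero_mem
    rw [this, hilbertFunction_top hfin, h0]
    simp
  have hinj : Function.Injective (LinearMap.mulLeft k f) := mul_right_injective₀ h0
  have := hfin m
  have := hfin (m + e)
  have h1 : degreePart w (J ⊔ Ideal.span {f}) (m + e) =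
      degreePart w J (m + e) ⊔ (weightedHomogeneousSubmodule k w m).map (LinearMap.mulLeft k f) := by
    apply le_antisymm
    · rintro x ⟨hx, hxm⟩
      obtain ⟨y, hy, z, hz, rfl⟩ := Submodule.mem_sup.1 hx
      obtain ⟨z', rfl⟩ := Ideal.mem_span_singleton'.1 hz
      have h1 := IsWeightedHomogeneous.weightedHomogeneousComponent_same hxm
      rw [map_add, mul_comm z', weightedHomogeneousComponent_add_mul hf] at h1
      rw [mul_comm z', ← h1]
      refine Submodule.add_mem_sup ⟨hJ y hy _, weightedHomogeneousComponent_isWeightedHomogeneous _ _⟩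
        ⟨_, weightedHomogeneousComponent_isWeightedHomogeneous _ _, rfl⟩
    · refine sup_le (degreePart_mono le_sup_left _) ?_
      rintro _ ⟨z, hz, rfl⟩
      refine ⟨Ideal.mem_sup_right (Ideal.mul_mem_right _ _ (Ideal.mem_span_singleton_self f)), ?_⟩
      rw [add_comm]
      exact hf.mul hz
  have h2 : degreePart w J (m + e) ⊓
      (weightedHomogeneousSubmodule k w m).map (LinearMap.mulLeft k f) =
        (degreePart w (colonElem J f) m).map (LinearMap.mulLeft k f) := by
    apply le_antisymm
    · rintro _ ⟨⟨hx, hxm⟩, z, hz, rfl⟩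
      exact ⟨z, ⟨hx, hz⟩, rfl⟩
    · rintro _ ⟨z, ⟨hz, hzm⟩, rfl⟩
      refine ⟨⟨hz, ?_⟩, z, hzm, rfl⟩
      rw [add_comm]
      exact hf.mul hzm
  have : FiniteDimensional k (degreePart w J (m + e)) :=
    Submodule.finiteDimensional_of_le inf_le_right
  have h3 := Submodule.finrank_sup_add_finrank_inf_eq (degreePart w J (m + e))
    ((weightedHomogeneousSubmodule k w m).map (LinearMap.mulLeft k f))
  rw [← h1, h2, ← (Submodule.equivMapOfInjective _ hinj _).finrank_eq,
    ← (Submodule.equivMapOfInjective _ hinj _).finrank_eq] at h3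
  have e1 := hilbertFunction_add_finrank hfin J (m + e)
  have e2 := hilbertFunction_add_finrank hfin (J ⊔ Ideal.span {f}) (m + e)
  have e3 := hilbertFunction_add_finrank hfin (colonElem J f) m
  omega

/-- A graded piece for the coarser weight `φ ∘ w` is the direct sum of the pieces over the fibre of
`φ`; homogeneity of `J` makes the sum direct in the quotient. -/
theorem hilbertFunction_comp {L : Type*} [AddCommMonoid L] (φ : M →+ L) {T : Finset M} {l : L}
    (hT : ∀ m, m ∈ T ↔ φ m = l) {J : Ideal (MvPolynomial σ k)} (hJ : HomIdeal w J) :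
    hilbertFunction (φ ∘ w) J l = ∑ m ∈ T, hilbertFunction w J m := by
  classical
  let V : T → Submodule k (MvPolynomial σ k ⧸ J) := fun m =>
    (weightedHomogeneousSubmodule k w m).map (Ideal.Quotient.mkₐ k J).toLinearMap
  have := hfin
  let Φ : (Π m : T, V m) →ₗ[k] MvPolynomial σ k ⧸ J :=
    ∑ m : T, (V m).subtype ∘ₗ LinearMap.proj m
  have hΦ : ∀ v, Φ v = ∑ m : T, (v m : MvPolynomial σ k ⧸ J) := fun v => by
    simp [Φ, LinearMap.sum_apply]
  have hinj : Function.Injective Φ := by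
    rw [injective_iff_map_eq_zero]
    intro v hv
    rw [hΦ] at hv
    choose f hf hfv using fun m => (v m).2
    have hs : ∑ m : T, f m ∈ J := by
      rw [← Ideal.Quotient.eq_zero_iff_mem, map_sum, ← hv]
      exact Finset.sum_congr rfl fun m _ => hfv m
    funext m
    apply Subtype.ext
    rw [← hfv m]
    have h := hJ _ hs (m : M)
    rw [map_sum, Finset.sum_eq_single m, weightedHomogeneousComponent_eq_self (hf m)] at h
    · exact Ideal.Quotient.eq_zero_iff_mem.2 h
    · intro m' _ hne
      exact IsWeightedHomogeneous.weightedHomogeneousComponent_ne _ (hf m')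
        fun h => hne (Subtype.ext h.symm)
    · simp
  have hrange : LinearMap.range Φ =
      (weightedHomogeneousSubmodule k (φ ∘ w) l).map (Ideal.Quotient.mkₐ k J).toLinearMap := by
    apply le_antisymm
    · rintro _ ⟨v, rfl⟩
      rw [hΦ]
      refine Submodule.sum_mem _ fun m _ => ?_
      obtain ⟨f, hf, hfv⟩ := (v m).2
      refine ⟨f, fun d hd => ?_, hfv⟩
      rw [weight_comp, hf hd, (hT _).1 m.2]
    · rintro _ ⟨f, hf, rfl⟩
      refine ⟨fun m => ⟨Ideal.Quotient.mk J (weightedHomogeneousComponent w m f),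
        _, weightedHomogeneousComponent_isWeightedHomogeneous _ _, rfl⟩, ?_⟩
      rw [hΦ]
      have h1 := weightedHomogeneousComponent_comp φ w l f
      rw [weightedHomogeneousComponent_eq_self hf] at h1
      change _ = Ideal.Quotient.mk J f
      refine (Finset.sum_coe_sort T
        (fun m => Ideal.Quotient.mk J (weightedHomogeneousComponent w m f))).trans ?_
      conv_rhs => rw [h1, map_sum]
      symm
      apply Finset.sum_subset
      · intro m hm
        exact (hT m).2 (Finset.mem_filter.1 hm).2
      · intro m hm hm'
        rw [weightedHomogeneousComponent_eq_zero_of_notMem, map_zero]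
        intro hmem
        exact hm' (Finset.mem_filter.2 ⟨hmem, (hT m).1 hm⟩)
  have : ∀ m : T, FiniteDimensional k (V m) := fun m => inferInstance
  rw [hilbertFunction, ← hrange, LinearMap.finrank_range_of_inj hinj,
    Module.finrank_pi_fintype, ← Finset.sum_coe_sort T]
  rfl

end HilbertFunction
end CorrScroll

namespace CorrScroll
open MvPolynomial

section LocalLength

/-! ### Lengths of localizations -/

variable {R : Type*} [CommRing R]

/-- The length of the localization of `R / J` at the prime `p`. -/
noncomputable def localLength (p : Ideal R) [p.IsPrime] (J : Ideal R) : ℕ∞ :=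
  Module.length (Localization.AtPrime p) (LocalizedModule p.primeCompl (R ⧸ J))

/-- The same exact sequence, localized at `p`; length is additive. Lengths and Hilbert functions
thus obey one recursion. -/
theorem localLength_add (p : Ideal R) [p.IsPrime] (J : Ideal R) (f : R) :
    localLength p J = localLength p (J ⊔ Ideal.span {f}) + localLength p (colonElem J f) := by
  let F : (R ⧸ colonElem J f) →ₗ[R] (R ⧸ J) :=
    Submodule.mapQ (colonElem J f) J (LinearMap.mulLeft R f) le_rfl
  let G : (R ⧸ J) →ₗ[R] (R ⧸ (J ⊔ Ideal.span {f})) := Submodule.factor le_sup_left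
  have hF : Function.Injective F := by
    rw [injective_iff_map_eq_zero]
    intro x hx
    obtain ⟨x, rfl⟩ := Submodule.Quotient.mk_surjective _ x
    exact (Submodule.Quotient.mk_eq_zero _).2 ((Submodule.Quotient.mk_eq_zero J).1 hx)
  have hG : Function.Surjective G := Submodule.factor_surjective le_sup_left
  have hFG : Function.Exact F G := by
    intro y
    obtain ⟨y, rfl⟩ := Submodule.Quotient.mk_surjective _ y
    constructor
    · intro hy
      have hy' : y ∈ J ⊔ Ideal.span {f} := (Submodule.Quotient.mk_eq_zero _).1 hy
      obtain ⟨a, ha, b, hb, rfl⟩ := Submodule.mem_sup.1 hy'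
      obtain ⟨c, rfl⟩ := Ideal.mem_span_singleton'.1 hb
      refine ⟨Submodule.Quotient.mk c, ?_⟩
      refine (Submodule.Quotient.eq J).2 ?_
      have : LinearMap.mulLeft R f c - (a + c * f) = -a := by simp [mul_comm]
      rw [this]
      exact J.neg_mem ha
    · rintro ⟨c, hc⟩
      obtain ⟨c, rfl⟩ := Submodule.Quotient.mk_surjective _ c
      rw [← hc]
      exact (Submodule.Quotient.mk_eq_zero _).2
        (Ideal.mem_sup_right (Ideal.mul_mem_right _ _ (Ideal.mem_span_singleton_self f)))
  rw [add_comm]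
  exact Module.length_eq_add_of_exact (LocalizedModule.map p.primeCompl F)
    (LocalizedModule.map p.primeCompl G) (LocalizedModule.map_injective _ _ hF)
    (LocalizedModule.map_surjective _ _ hG) (LocalizedModule.map_exact _ _ _ hFG)

theorem localLength_top (p : Ideal R) [p.IsPrime] : localLength p ⊤ = 0 := by
  have : Subsingleton (R ⧸ (⊤ : Ideal R)) := Ideal.Quotient.subsingleton_iff.2 rfl
  exact Module.length_eq_zero

theorem localLength_eq_zero {p : Ideal R} [p.IsPrime] {J : Ideal R} (h : ¬ J ≤ p) :
    localLength p J = 0 := by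
  obtain ⟨x, hxJ, hxp⟩ := SetLike.not_le_iff_exists.1 h
  have : Subsingleton (LocalizedModule p.primeCompl (R ⧸ J)) := by
    rw [LocalizedModule.subsingleton_iff]
    intro m
    obtain ⟨m, rfl⟩ := Ideal.Quotient.mk_surjective m
    exact ⟨x, hxp, Ideal.Quotient.eq_zero_iff_mem.2 (J.mul_mem_right m hxJ)⟩
  exact Module.length_eq_zero

theorem localLength_ne_zero {p : Ideal R} [p.IsPrime] {J : Ideal R} (h : J ≤ p) :
    localLength p J ≠ 0 := by
  rw [localLength, ne_eq, Module.length_eq_zero_iff, LocalizedModule.subsingleton_iff]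
  intro H
  obtain ⟨r, hr, hr1⟩ := H (Ideal.Quotient.mk J 1)
  apply hr
  have h2 : Ideal.Quotient.mk J (r * 1) = 0 := hr1
  rw [mul_one] at h2
  exact h (Ideal.Quotient.eq_zero_iff_mem.1 h2)

theorem localLength_self (p : Ideal R) [hp : p.IsPrime] : localLength p p = 1 := by
  rw [localLength, Module.length_eq_one_iff, isSimpleModule_iff_toSpanSingleton_surjective]
  constructor
  · by_contra h
    rw [not_nontrivial_iff_subsingleton] at h
    exact localLength_ne_zero (le_refl p) (Module.length_eq_zero)
  · intro x hx y
    induction x using LocalizedModule.induction_on with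
    | h r s =>
    induction y using LocalizedModule.induction_on with
    | h a t =>
    obtain ⟨r, rfl⟩ := Ideal.Quotient.mk_surjective r
    obtain ⟨a, rfl⟩ := Ideal.Quotient.mk_surjective a
    have hr : r ∉ p := by
      intro hr
      apply hx
      rw [Ideal.Quotient.eq_zero_iff_mem.2 hr, LocalizedModule.zero_mk]
    refine ⟨Localization.mk (a * s) (⟨r, hr⟩ * t), ?_⟩
    rw [LinearMap.toSpanSingleton_apply, LocalizedModule.mk_smul_mk, LocalizedModule.mk_eq]
    refine ⟨1, ?_⟩
    rw [one_smul, one_smul]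
    simp only [Submonoid.smul_def, ← Ideal.Quotient.mk_eq_mk, ← Submodule.Quotient.mk_smul,
      smul_eq_mul, Submonoid.coe_mul]
    congr 1
    ring

end LocalLength

section PrimeFiltration

/-! ### Prime filtrations -/

variable {k σ M : Type*} [Field k] [AddCommMonoid M] {w : σ → M}

open Classical in
/-- The function `H` shifted by `u`, extended by zero. -/
noncomputable def shiftFun (H : M → ℕ) (u m : M) : ℕ :=
  if h : ∃ m', m = m' + u then H h.choose else 0

theorem shiftFun_add [IsCancelAdd M] (H : M → ℕ) (u m : M) : shiftFun H u (m + u) = H m := by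
  have h : ∃ m', m + u = m' + u := ⟨m, rfl⟩
  rw [shiftFun, dif_pos h, add_right_cancel h.choose_spec.symm]

theorem shiftFun_eq_zero (H : M → ℕ) {u m : M} (h : ¬ ∃ m', m = m' + u) :
    shiftFun H u m = 0 := by
  rw [shiftFun, dif_neg h]

theorem shiftFun_zero [IsCancelAdd M] (H : M → ℕ) (m : M) : shiftFun H 0 m = H m := by
  simpa using shiftFun_add H 0 m

theorem shiftFun_shiftFun [IsCancelAdd M] (H : M → ℕ) (u e m : M) :
    shiftFun (shiftFun H u) e m = shiftFun H (u + e) m := by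
  by_cases h : ∃ m', m = m' + e
  · obtain ⟨m, rfl⟩ := h
    rw [shiftFun_add]
    by_cases h : ∃ m', m = m' + u
    · obtain ⟨m, rfl⟩ := h
      rw [add_assoc, shiftFun_add, shiftFun_add]
    · rw [shiftFun_eq_zero _ h, shiftFun_eq_zero]
      rintro ⟨m', hm'⟩
      rw [← add_assoc, add_left_inj] at hm'
      exact h ⟨m', hm'⟩
  · rw [shiftFun_eq_zero _ h, shiftFun_eq_zero]
    rintro ⟨m', rfl⟩
    exact h ⟨m' + u, (add_assoc _ _ _).symm⟩

theorem shiftFun_list_sum [IsCancelAdd M] {ι : Type*} (L : List ι) (g : ι → M → ℕ) (u m : M) :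
    shiftFun (fun m => (L.map fun x => g x m).sum) u m =
      (L.map fun x => shiftFun (g x) u m).sum := by
  by_cases h : ∃ m', m = m' + u
  · obtain ⟨m, rfl⟩ := h
    simp only [shiftFun_add]
  · simp [shiftFun_eq_zero _ h]

theorem hilbertFunction_eq_add_shiftFun [IsCancelAdd M]
    (hfin : ∀ m, FiniteDimensional k (weightedHomogeneousSubmodule k w m))
    {J : Ideal (MvPolynomial σ k)} (hJ : HomIdeal w J)
    {f : MvPolynomial σ k} {e : M} (hf : IsWeightedHomogeneous w f e) (m : M) :
    hilbertFunction w J m = hilbertFunction w (J ⊔ Ideal.span {f}) m +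
      shiftFun (hilbertFunction w (colonElem J f)) e m := by
  by_cases h : ∃ m', m = m' + e
  · obtain ⟨m, rfl⟩ := h
    rw [shiftFun_add, hilbertFunction_add hfin hJ hf]
  · rw [shiftFun_eq_zero _ h, hilbertFunction_sup_span_of_not_exists hfin hJ hf h, add_zero]

/-- The list `L` consists of the primes and shifts of the factors of a homogeneous prime
filtration of `k[σ] / J`, as far as Hilbert functions and local lengths are concerned. -/
structure IsPrimeFiltration (w : σ → M) (J : Ideal (MvPolynomial σ k))
    (L : List (Ideal (MvPolynomial σ k) × M)) : Prop where
  isPrime : ∀ x ∈ L, x.1.IsPrime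
  homIdeal : ∀ x ∈ L, HomIdeal w x.1
  le : ∀ x ∈ L, J ≤ x.1
  hilbertFunction_eq : ∀ m, hilbertFunction w J m =
    (L.map fun x => shiftFun (hilbertFunction w x.1) x.2 m).sum
  localLength_eq : ∀ (p : Ideal (MvPolynomial σ k)) [p.IsPrime],
    localLength p J = (L.map fun x => localLength p x.1).sum

/-- The factors of `A/(J+f)`, followed by those of `A/(J:f)` shifted by the degree of `f`, are the
factors of `A/J`. -/
theorem exists_isPrimeFiltration [IsCancelAdd M] [Finite σ] (hw : PrimeTest k w)
    (hfin : ∀ m, FiniteDimensional k (weightedHomogeneousSubmodule k w m))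
    {J : Ideal (MvPolynomial σ k)} (hJ : HomIdeal w J) : ∃ L, IsPrimeFiltration w J L := by
  refine HomIdeal.induction hw (C := fun J => ∃ L, IsPrimeFiltration w J L) ?_ ?_ ?_ J hJ
  · refine ⟨[], by simp, by simp, by simp, fun m => ?_, fun p _ => ?_⟩
    · simpa using hilbertFunction_top hfin m
    · simpa using localLength_top p
  · intro p hp hpw _
    refine ⟨[(p, 0)], by simpa, by simpa, by simp, fun m => ?_, fun p _ => ?_⟩
    · simp [shiftFun_zero]
    · simp
  · rintro J f e hJ hf ⟨L₁, h₁⟩ ⟨L₂, h₂⟩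
    refine ⟨L₁ ++ L₂.map fun x => (x.1, x.2 + e), ?_, ?_, ?_, fun m => ?_, fun p hp => ?_⟩
    · intro x hx
      rcases List.mem_append.1 hx with hx | hx
      · exact h₁.isPrime x hx
      · obtain ⟨y, hy, rfl⟩ := List.mem_map.1 hx
        exact h₂.isPrime y hy
    · intro x hx
      rcases List.mem_append.1 hx with hx | hx
      · exact h₁.homIdeal x hx
      · obtain ⟨y, hy, rfl⟩ := List.mem_map.1 hx
        exact h₂.homIdeal y hy
    · intro x hx
      rcases List.mem_append.1 hx with hx | hx
      · exact le_sup_left.trans (h₁.le x hx)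
      · obtain ⟨y, hy, rfl⟩ := List.mem_map.1 hx
        exact (le_colonElem J f).trans (h₂.le y hy)
    · rw [hilbertFunction_eq_add_shiftFun hfin hJ hf, h₁.hilbertFunction_eq,
        funext h₂.hilbertFunction_eq, shiftFun_list_sum, List.map_append, List.sum_append,
        List.map_map]
      congr 3
      funext x
      exact shiftFun_shiftFun _ _ _ _
    · rw [localLength_add p J f, h₁.localLength_eq, h₂.localLength_eq, List.map_append,
        List.sum_append, List.map_map]
      rfl

/-- The local length at `q` is nonzero, so some factor has its prime inside `q`; minimality makes it
equal to `q`. -/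
theorem IsPrimeFiltration.exists_mem_of_mem_minimalPrimes {J : Ideal (MvPolynomial σ k)}
    {L : List (Ideal (MvPolynomial σ k) × M)} (hL : IsPrimeFiltration w J L)
    {q : Ideal (MvPolynomial σ k)} (hq : q ∈ J.minimalPrimes) : ∃ x ∈ L, x.1 = q := by
  have hqp : q.IsPrime := hq.1.1
  have h := localLength_ne_zero hq.1.2
  rw [hL.localLength_eq q] at h
  by_contra! hne
  apply h
  apply List.sum_eq_zero
  intro l hl
  obtain ⟨x, hx, rfl⟩ := List.mem_map.1 hl
  refine localLength_eq_zero fun hle => hne x hx ?_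
  exact le_antisymm hle (hq.2 ⟨hL.isPrime x hx, hL.le x hx⟩ hle)

/-- Minimal primes occur in every homogeneous prime filtration, and the primes there are homogeneous
by construction. -/
theorem HomIdeal.of_mem_minimalPrimes [IsCancelAdd M] [Finite σ] (hw : PrimeTest k w)
    (hfin : ∀ m, FiniteDimensional k (weightedHomogeneousSubmodule k w m))
    {J : Ideal (MvPolynomial σ k)} (hJ : HomIdeal w J) {q : Ideal (MvPolynomial σ k)}
    (hq : q ∈ J.minimalPrimes) : HomIdeal w q := by
  obtain ⟨L, hL⟩ := exists_isPrimeFiltration hw hfin hJ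
  obtain ⟨x, hx, rfl⟩ := hL.exists_mem_of_mem_minimalPrimes hq
  exact hL.homIdeal x hx

/-- At a minimal prime `q` a factor `A/q` has length one and every other factor localizes to zero.
This links the multiplicities in the fundamental cycle to Hilbert functions. -/
theorem IsPrimeFiltration.localLength_eq_count [DecidableEq (Ideal (MvPolynomial σ k))]
    {J : Ideal (MvPolynomial σ k)} {L : List (Ideal (MvPolynomial σ k) × M)}
    (hL : IsPrimeFiltration w J L) {q : Ideal (MvPolynomial σ k)} [q.IsPrime]
    (hq : q ∈ J.minimalPrimes) :
    localLength q J = ((L.countP fun x => x.1 = q : ℕ) : ℕ∞) := by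
  have key : ∀ L' : List (Ideal (MvPolynomial σ k) × M), (∀ x ∈ L', x ∈ L) →
      (L'.map fun x => localLength q x.1).sum = ((L'.countP fun x => x.1 = q : ℕ) : ℕ∞) := by
    intro L' hL'
    induction L' with
    | nil => simp
    | cons x L' ih =>
      rw [List.map_cons, List.sum_cons, ih fun y hy => hL' y (List.mem_cons_of_mem _ hy),
        List.countP_cons]
      have hx := hL' x List.mem_cons_self
      by_cases h : x.1 = q
      · have : localLength q x.1 = 1 := by rw [h]; exact localLength_self q
        rw [this]
        simp [h, add_comm]
      · rw [localLength_eq_zero fun hle =>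
          h (le_antisymm hle (hq.2 ⟨hL.isPrime x hx, hL.le x hx⟩ hle))]
        simp [h]
  rw [hL.localLength_eq q, key L fun _ h => h]

end PrimeFiltration
end CorrScroll

namespace CorrScroll
open MvPolynomial Filter Topology

section Growth

/-! ### Growth of polynomials on the natural numbers -/

theorem tendsto_eval_div_pow {P : Polynomial ℚ} {m : ℕ} (h : P.degree < (m + 1 : ℕ)) :
    Tendsto (fun s : ℕ => P.eval (s : ℚ) / (s : ℚ) ^ m) atTop (𝓝 (P.coeff m)) := by
  have hcast : Tendsto (fun s : ℕ => (s : ℚ)) atTop atTop := tendsto_natCast_atTop_atTop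
  have hle : P.degree ≤ m := by
    rw [Polynomial.degree_lt_iff_coeff_zero] at h
    rw [Polynomial.degree_le_iff_coeff_zero]
    intro n hn
    exact h n (by exact_mod_cast hn)
  have hX : (Polynomial.X ^ m : Polynomial ℚ).degree = m := Polynomial.degree_X_pow m
  rcases hle.eq_or_lt with h1 | h1
  · have h2 := (Polynomial.div_tendsto_atTop_leadingCoeff_div_of_degree_eq P (Polynomial.X ^ m)
      (h1.trans hX.symm)).comp hcast
    rw [Polynomial.leadingCoeff_X_pow, div_one, Polynomial.leadingCoeff,
      Polynomial.natDegree_eq_of_degree_eq_some h1] at h2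
    simpa [Function.comp_def] using h2
  · have h2 := (Polynomial.div_tendsto_atTop_zero_of_degree_lt P (Polynomial.X ^ m)
      (h1.trans_eq hX.symm)).comp hcast
    rw [Polynomial.coeff_eq_zero_of_degree_lt h1]
    simpa [Function.comp_def] using h2

theorem eventually_eval_natCast_ne_zero {P : Polynomial ℚ} (hP : P ≠ 0) :
    ∀ᶠ s : ℕ in atTop, P.eval (s : ℚ) ≠ 0 := by
  have h : {s : ℕ | P.eval (s : ℚ) = 0}.Finite := by
    refine (P.roots.toFinset.finite_toSet.preimage (f := fun s : ℕ => (s : ℚ))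
      Nat.cast_injective.injOn).subset ?_
    intro s hs
    simpa [hP] using hs
  have := h.compl_mem_cofinite
  rwa [Nat.cofinite_eq_atTop] at this

theorem degree_le_of_eventually_le {P Q : Polynomial ℚ}
    (h0 : ∀ᶠ s : ℕ in atTop, 0 ≤ P.eval (s : ℚ))
    (h : ∀ᶠ s : ℕ in atTop, P.eval (s : ℚ) ≤ Q.eval (s : ℚ)) : P.degree ≤ Q.degree := by
  by_contra! hlt
  have hP : P ≠ 0 := by rintro rfl; simp at hlt
  have ht := (Polynomial.div_tendsto_atTop_zero_of_degree_lt Q P hlt).comp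
    (tendsto_natCast_atTop_atTop (R := ℚ))
  have h1 : ∀ᶠ s : ℕ in atTop, 1 ≤ Q.eval (s : ℚ) / P.eval (s : ℚ) := by
    filter_upwards [h0, h, eventually_eval_natCast_ne_zero hP] with s a b c
    rw [le_div_iff₀ (lt_of_le_of_ne a (Ne.symm c)), one_mul]
    exact b
  have := ge_of_tendsto ht h1
  norm_num at this

theorem degree_lt_of_eventually_le_pow {P : Polynomial ℚ} {C : ℚ} {m : ℕ}
    (h0 : ∀ᶠ s : ℕ in atTop, 0 ≤ P.eval (s : ℚ))
    (h : ∀ᶠ s : ℕ in atTop, P.eval (s : ℚ) ≤ C * (s : ℚ) ^ m) : P.degree < (m + 1 : ℕ) := by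
  refine (degree_le_of_eventually_le (Q := Polynomial.C C * Polynomial.X ^ m) h0 ?_).trans_lt ?_
  · simpa using h
  · refine (Polynomial.degree_C_mul_X_pow_le m C).trans_lt ?_
    exact_mod_cast Nat.lt_succ_self m

/-- Leading terms cannot cancel between polynomials that are eventually nonnegative. -/
theorem degree_add_lt_iff {P Q : Polynomial ℚ} (hP : ∀ᶠ s : ℕ in atTop, 0 ≤ P.eval (s : ℚ))
    (hQ : ∀ᶠ s : ℕ in atTop, 0 ≤ Q.eval (s : ℚ)) (m : ℕ) :
    (P + Q).degree < m ↔ P.degree < m ∧ Q.degree < m := by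
  refine ⟨fun h => ⟨lt_of_le_of_lt ?_ h, lt_of_le_of_lt ?_ h⟩, fun h => ?_⟩
  · refine degree_le_of_eventually_le hP ?_
    filter_upwards [hQ] with s hs
    rw [Polynomial.eval_add]; linarith
  · refine degree_le_of_eventually_le hQ ?_
    filter_upwards [hP] with s hs
    rw [Polynomial.eval_add]; linarith
  · exact (Polynomial.degree_add_le P Q).trans_lt (max_lt h.1 h.2)

/-- Bernoulli polynomials are discrete antiderivatives of monomials; the Taylor shift by one turns
their forward difference into a backward one. -/
theorem exists_eval_sub_eval_sub_one (P₁ : Polynomial ℚ) :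
    ∃ P : Polynomial ℚ, ∀ x, P.eval x - P.eval (x - 1) = P₁.eval x := by
  induction P₁ using Polynomial.induction_on' with
  | add p q hp hq =>
    obtain ⟨P, hP⟩ := hp
    obtain ⟨Q, hQ⟩ := hq
    refine ⟨P + Q, fun x => ?_⟩
    rw [Polynomial.eval_add, Polynomial.eval_add, Polynomial.eval_add, ← hP, ← hQ]
    ring
  | monomial n c =>
    refine ⟨Polynomial.C (c / (n + 1)) * Polynomial.taylor 1 (Polynomial.bernoulli (n + 1)),
      fun x => ?_⟩
    have h := Polynomial.bernoulli_eval_one_add (n + 1) x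
    simp only [Polynomial.eval_mul, Polynomial.eval_C, Polynomial.taylor_eval,
      Polynomial.eval_monomial, sub_add_cancel]
    rw [add_comm x 1, h]
    have : (n : ℚ) + 1 ≠ 0 := by positivity
    push_cast
    field_simp
    simp [mul_assoc]

/-- A backward difference lowers the degree by exactly one, since for `deg P = d > 0` its
coefficient at `d - 1` is `d` times the leading coefficient. With the zero polynomial in degree `⊥`,
the case `m = 0` says that `P` is constant. -/
theorem degree_lt_iff_of_eval_sub_eval_sub_one {P P₁ : Polynomial ℚ}
    (h : ∀ x, P.eval x - P.eval (x - 1) = P₁.eval x) (m : ℕ) :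
    P₁.degree < m ↔ P.degree < (m + 1 : ℕ) := by
  have hP₁ : P₁ = P - Polynomial.taylor (-1) P := by
    refine Polynomial.funext fun x => ?_
    rw [← h, Polynomial.eval_sub, Polynomial.taylor_eval, sub_eq_add_neg x]
  constructor
  · intro h1
    by_contra! hlt
    have hP0 : P ≠ 0 := by
      rintro rfl
      simp at hlt
    set d := P.natDegree with hd
    have hmd : m + 1 ≤ d := by
      rw [Polynomial.degree_eq_natDegree hP0] at hlt
      exact_mod_cast hlt
    -- The coefficient of the shifted polynomial at `d - 1` is the Hasse derivative of order `d - 1`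
    -- at `-1`; that derivative has degree at most one, so two terms suffice.
    have hc : P₁.coeff (d - 1) = d * P.leadingCoeff := by
      rw [hP₁, Polynomial.coeff_sub, Polynomial.taylor_coeff,
        Polynomial.eval_eq_sum_range' (n := 2), Finset.sum_range_succ, Finset.sum_range_one,
        Polynomial.hasseDeriv_coeff, Polynomial.hasseDeriv_coeff]
      · have e1 : 1 + (d - 1) = d := by omega
        rw [e1, zero_add, Nat.choose_self, Nat.choose_symm_of_eq_add (b := 1) (by omega),
          Nat.choose_one_right, Polynomial.leadingCoeff]
        push_cast
        ring
      · have := Polynomial.natDegree_hasseDeriv_le P (d - 1)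
        omega
    have hz : P₁.coeff (d - 1) = 0 :=
      Polynomial.coeff_eq_zero_of_degree_lt (h1.trans_le (by exact_mod_cast (by omega)))
    rw [hz] at hc
    have : (d : ℚ) ≠ 0 := by
      have : d ≠ 0 := by omega
      exact_mod_cast this
    exact mul_ne_zero this (Polynomial.leadingCoeff_ne_zero.2 hP0) hc.symm
  · intro h1
    by_cases hP0 : P = 0
    · rw [hP₁, hP0]; simp
    have h2 : P₁.degree < P.degree := by
      rw [hP₁]
      refine Polynomial.degree_sub_lt_left (Polynomial.degree_taylor P _).symm hP0 ?_
      rw [Polynomial.leadingCoeff, Polynomial.leadingCoeff, Polynomial.natDegree_taylor]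
      rw [Polynomial.coeff_taylor_natDegree]
      rfl
    rw [Polynomial.degree_eq_natDegree hP0] at h1 h2
    refine h2.trans_le ?_
    have : P.natDegree < m + 1 := by exact_mod_cast h1
    exact_mod_cast (by omega : P.natDegree ≤ m)

end Growth

section QuotDim

/-! ### Dimensions of quotients of polynomial rings -/

theorem ringKrullDim_quotient_le_of_le {R : Type*} [CommRing R] {J J' : Ideal R} (h : J ≤ J') :
    ringKrullDim (R ⧸ J') ≤ ringKrullDim (R ⧸ J) :=
  ringKrullDim_le_of_surjective (Ideal.Quotient.factor h) (Ideal.Quotient.factor_surjective h)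

theorem ringKrullDim_quotient_le_iff {R : Type*} [CommRing R] {J : Ideal R} {d : WithBot ℕ∞} :
    ringKrullDim (R ⧸ J) ≤ d ↔
      ∀ p : Ideal R, p.IsPrime → J ≤ p → ringKrullDim (R ⧸ p) ≤ d := by
  refine ⟨fun h p _ hJ => (ringKrullDim_quotient_le_of_le hJ).trans h, fun h => ?_⟩
  rw [ringKrullDim_quotient]
  refine iSup_le fun l => ?_
  have h1 := h l.head.1.asIdeal l.head.1.2 l.head.2
  rw [ringKrullDim_quotient] at h1
  let l' : LTSeries (PrimeSpectrum.zeroLocus (l.head.1.asIdeal : Set R)) :=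
    { length := l.length
      toFun := fun i => ⟨(l i).1, fun x hx => by
        have : l.head ≤ l i := l.head_le i
        exact this hx⟩
      step := fun i => l.step i }
  exact (Order.LTSeries.length_le_krullDim l').trans h1

theorem ringKrullDim_quotient_le_iff_minimalPrimes {R : Type*} [CommRing R] {J : Ideal R}
    {d : WithBot ℕ∞} : ringKrullDim (R ⧸ J) ≤ d ↔
      ∀ p ∈ J.minimalPrimes, ringKrullDim (R ⧸ p) ≤ d := by
  rw [ringKrullDim_quotient_le_iff]
  refine ⟨fun h p hp => h p hp.1.1 hp.1.2, fun h p hp hJ => ?_⟩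
  obtain ⟨q, hq, hqp⟩ := Ideal.exists_minimalPrimes_le hJ
  exact (ringKrullDim_quotient_le_of_le hqp).trans (h q hq)

/-- The Krull dimension of `R / p`, as a natural number. -/
noncomputable def quotDim {R : Type*} [CommRing R] (p : Ideal R) : ℕ :=
  ((ringKrullDim (R ⧸ p)).unbotD 0).toNat

variable {k σ : Type*} [Field k] [Finite σ]

theorem ringKrullDim_eq_quotDim {p : Ideal (MvPolynomial σ k)} (hp : p ≠ ⊤) :
    ringKrullDim (MvPolynomial σ k ⧸ p) = (quotDim p : ℕ) := by
  have : Nontrivial (MvPolynomial σ k ⧸ p) := Ideal.Quotient.nontrivial_iff.2 hp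
  have h1 := ringKrullDim_nonneg_of_nontrivial (R := MvPolynomial σ k ⧸ p)
  have h2 := ringKrullDim_quotient_le p
  rw [MvPolynomial.ringKrullDim_of_isNoetherianRing, ringKrullDim_eq_zero_of_field, zero_add] at h2
  rw [quotDim]
  generalize ringKrullDim (MvPolynomial σ k ⧸ p) = x at h1 h2
  induction x using WithBot.recBotCoe with
  | bot => simp at h1
  | coe x =>
    induction x using ENat.recTopCoe with
    | top =>
      have : (⊤ : ℕ∞) ≤ (Nat.card σ : ℕ∞) := WithBot.coe_le_coe.1 h2
      exact absurd this (by simp)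
    | coe x => rfl

theorem quotDim_le_iff {p : Ideal (MvPolynomial σ k)} (hp : p ≠ ⊤) {d : ℕ} :
    quotDim p ≤ d ↔ ringKrullDim (MvPolynomial σ k ⧸ p) ≤ d := by
  rw [ringKrullDim_eq_quotDim hp]
  norm_cast

theorem quotDim_add_one_of_mem_minimalPrimes {W q : Ideal (MvPolynomial σ k)} [hW : W.IsPrime]
    {g : MvPolynomial σ k} (hg : g ∉ W) (hq : q ∈ (W ⊔ Ideal.span {g}).minimalPrimes) :
    quotDim q + 1 = quotDim W := by
  have h := ringKrullDim_quotient_add_one_of_mem_minimalPrimes (k := k) hg hq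
  rw [ringKrullDim_eq_quotDim hW.ne_top, ringKrullDim_eq_quotDim hq.1.1.ne_top] at h
  exact_mod_cast h

/-- Pick `g` in `q` but not in `p`: a minimal prime of `p + (g)` below `q` already has quotient
dimension one less than `p`. -/
theorem quotDim_lt_of_lt {p q : Ideal (MvPolynomial σ k)} [hp : p.IsPrime] [hq : q.IsPrime]
    (h : p < q) : quotDim q < quotDim p := by
  obtain ⟨g, hgq, hgp⟩ := SetLike.exists_of_lt h
  obtain ⟨r, hr, hrq⟩ := Ideal.exists_minimalPrimes_le
    (sup_le h.le ((Ideal.span_singleton_le_iff_mem q).2 hgq))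
  have h1 := quotDim_add_one_of_mem_minimalPrimes hgp hr
  have h2 : quotDim q ≤ quotDim r := by
    rw [quotDim_le_iff hq.ne_top, ← ringKrullDim_eq_quotDim hr.1.1.ne_top]
    exact ringKrullDim_quotient_le_of_le hrq
  omega

end QuotDim

section HilbertPolynomial

/-! ### The Hilbert polynomial of a standard graded algebra -/

variable {k σ : Type*} [Field k]

theorem finiteDimensional_weightedHomogeneousSubmodule_one [Finite σ] (m : ℕ) :
    FiniteDimensional k (weightedHomogeneousSubmodule k (fun _ : σ => (1 : ℕ)) m) :=
  Module.Finite.iff_fg.2 (weightedHomogeneousSubmodule_fg k _ (fun _ => one_ne_zero) m)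

theorem HomIdeal.coeff_zero_eq_zero {M : Type*} [AddCommMonoid M]
    {w : σ → M} (hw : ∀ d : σ →₀ ℕ, Finsupp.weight w d = 0 → d = 0)
    {J : Ideal (MvPolynomial σ k)} (hJ : HomIdeal w J) (hne : J ≠ ⊤) {f : MvPolynomial σ k}
    (hf : f ∈ J) : coeff 0 f = 0 := by
  classical
  by_contra h0
  apply hne
  rw [Ideal.eq_top_iff_one]
  have h1 : weightedHomogeneousComponent w 0 f = C (coeff 0 f) := by
    ext d
    rw [coeff_weightedHomogeneousComponent, coeff_C]
    by_cases hd : d = 0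
    · simp [hd]
    · rw [if_neg (fun h => hd (hw d h)), if_neg (Ne.symm hd)]
  have h2 := J.mul_mem_left (C (coeff 0 f)⁻¹) (h1 ▸ hJ f hf 0)
  rwa [← C_mul, inv_mul_cancel₀ h0, C_1] at h2

/-- Both summands lie in the ideal of polynomials without constant term. -/
theorem HomIdeal.sup_span_singleton_ne_top {M : Type*} [AddCommMonoid M]
    {w : σ → M} (hw : ∀ d : σ →₀ ℕ, Finsupp.weight w d = 0 → d = 0)
    {J : Ideal (MvPolynomial σ k)} (hJ : HomIdeal w J) (hne : J ≠ ⊤) {f : MvPolynomial σ k}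
    (hf : constantCoeff f = 0) : J ⊔ Ideal.span {f} ≠ ⊤ := by
  intro h
  have h1 : J ⊔ Ideal.span {f} ≤ RingHom.ker (constantCoeff (σ := σ) (R := k)) :=
    sup_le (fun f hf => hJ.coeff_zero_eq_zero hw hne hf) ((Ideal.span_singleton_le_iff_mem _).2 hf)
  rw [h] at h1
  have := h1 (Submodule.mem_top (x := 1))
  simp at this

theorem weight_one_eq_zero (d : σ →₀ ℕ) (h : Finsupp.weight (fun _ : σ => (1 : ℕ)) d = 0) :
    d = 0 := by
  rw [Finsupp.weight_apply, Finsupp.sum] at h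
  ext i
  by_contra hi
  have := (Finset.sum_eq_zero_iff.1 h) i (Finsupp.mem_support_iff.2 hi)
  simp at this
  exact hi this

/-- `P` is the Hilbert polynomial of `k[σ] / J`, and its degree is one less than the dimension. -/
def IsHilbertPoly (J : Ideal (MvPolynomial σ k)) (P : Polynomial ℚ) : Prop :=
  (∀ᶠ s : ℕ in atTop, (hilbertFunction (fun _ : σ => (1 : ℕ)) J s : ℚ) = P.eval (s : ℚ)) ∧
    ∀ m : ℕ, ringKrullDim (MvPolynomial σ k ⧸ J) ≤ m ↔ P.degree < m

theorem IsHilbertPoly.eventually_nonneg {J : Ideal (MvPolynomial σ k)} {P : Polynomial ℚ}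
    (h : IsHilbertPoly J P) : ∀ᶠ s : ℕ in atTop, 0 ≤ P.eval (s : ℚ) := by
  filter_upwards [h.1] with s hs
  rw [← hs]
  positivity

theorem mem_of_forall_X_mem {p : Ideal (MvPolynomial σ k)} (hX : ∀ v, X v ∈ p)
    {f : MvPolynomial σ k} (hf : coeff 0 f = 0) : f ∈ p := by
  rw [f.as_sum]
  refine p.sum_mem fun d hd => ?_
  have hd0 : d ≠ 0 := by
    rintro rfl
    exact (mem_support_iff.1 hd) hf
  obtain ⟨v, hv⟩ := Finsupp.support_nonempty_iff.2 hd0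
  rw [monomial_eq]
  refine p.mul_mem_left _ ?_
  rw [Finsupp.prod]
  refine p.mem_of_dvd (Finset.dvd_prod_of_mem _ hv) ?_
  exact p.pow_mem_of_mem (hX v) _ (Nat.pos_of_ne_zero (Finsupp.mem_support_iff.1 hv))

theorem ringKrullDim_quotient_nonpos_of_forall_X_mem {p : Ideal (MvPolynomial σ k)}
    (hX : ∀ v, X v ∈ p) : ringKrullDim (MvPolynomial σ k ⧸ p) ≤ 0 := by
  rw [← ringKrullDim_eq_zero_of_field k]
  refine ringKrullDim_le_of_surjective ((Ideal.Quotient.mk p).comp C) fun x => ?_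
  obtain ⟨f, rfl⟩ := Ideal.Quotient.mk_surjective x
  refine ⟨coeff 0 f, ?_⟩
  rw [RingHom.comp_apply, Ideal.Quotient.eq]
  exact mem_of_forall_X_mem hX (by simp)

/-- For a prime `p` missing a variable, the Hilbert function of `p + (X_v)` is the difference of
that of `p`, and cutting by `X_v` drops the dimension by one just as differencing drops the degree
by one. The exact sequence extends the result to all homogeneous ideals. -/
theorem exists_isHilbertPoly [Finite σ] {J : Ideal (MvPolynomial σ k)}
    (hJ : HomIdeal (fun _ : σ => (1 : ℕ)) J) : ∃ P, IsHilbertPoly J P := by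
  have hfin := finiteDimensional_weightedHomogeneousSubmodule_one (k := k) (σ := σ)
  refine HomIdeal.induction (primeTest_nat _) (C := fun J => ∃ P, IsHilbertPoly J P) ?_ ?_ ?_ J hJ
  · refine ⟨0, ?_, fun m => ?_⟩
    · simp [hilbertFunction_top hfin]
    · have : Subsingleton (MvPolynomial σ k ⧸ (⊤ : Ideal (MvPolynomial σ k))) :=
        Ideal.Quotient.subsingleton_iff.2 rfl
      rw [ringKrullDim_eq_bot_of_subsingleton]
      simp
  · intro p hp hpw ih
    by_cases hX : ∀ v, X v ∈ p
    -- The quotient is the ground field: its Hilbert function vanishes in positive degrees, and the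
    -- degree `⊥` of the zero polynomial matches dimension zero.
    · refine ⟨0, ?_, fun m => ?_⟩
      · filter_upwards [eventually_ge_atTop 1] with s hs
        rw [(hilbertFunction_eq_zero_iff hfin).2]
        · simp
        · intro f hf
          refine mem_of_forall_X_mem hX ?_
          by_contra h0
          have := hf h0
          simp at this
          omega
      · refine iff_of_true
          ((ringKrullDim_quotient_nonpos_of_forall_X_mem hX).trans (by exact_mod_cast m.zero_le)) ?_
        simp
    push Not at hX
    obtain ⟨v, hv⟩ := hX
    have hXh : IsWeightedHomogeneous (fun _ : σ => (1 : ℕ)) (X v : MvPolynomial σ k) 1 :=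
      isWeightedHomogeneous_X k _ v
    obtain ⟨P₁, hP₁⟩ := ih (p ⊔ Ideal.span {X v})
      (lt_of_le_of_ne le_sup_left fun h => hv (by
        rw [h]; exact Ideal.mem_sup_right (Ideal.mem_span_singleton_self _)))
      (hpw.sup_span_singleton hXh)
    have hne := hpw.sup_span_singleton_ne_top weight_one_eq_zero hp.ne_top
      (constantCoeff_X (R := k) v)
    obtain ⟨Q, hQ⟩ := exists_eval_sub_eval_sub_one P₁
    obtain ⟨N, hN⟩ := eventually_atTop.1 hP₁.1
    set H := hilbertFunction (fun _ : σ => (1 : ℕ)) p with hH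
    have hconst : ∀ s, N ≤ s → (H s : ℚ) - Q.eval (s : ℚ) = H N - Q.eval (N : ℚ) := by
      intro s hs
      induction s, hs using Nat.le_induction with
      | base => rfl
      | succ s hs ihs =>
        rw [← ihs]
        have h1 := hilbertFunction_add hfin hpw hXh s
        rw [colonElem_eq_self hv] at h1
        have h2 := hN (s + 1) (by omega)
        have h3 := hQ (s + 1 : ℕ)
        push_cast at h2 h3
        rw [add_sub_cancel_right] at h3
        have h4 : (H (s + 1) : ℚ) = hilbertFunction (fun _ : σ => (1 : ℕ))
          (p ⊔ Ideal.span {X v}) (s + 1) + H s := by exact_mod_cast h1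
        push_cast
        linarith
    -- An antiderivative is unique up to a constant, here fixed by the value at `N`.
    set P := Q + Polynomial.C (H N - Q.eval (N : ℚ)) with hPdef
    have hPe : ∀ᶠ s : ℕ in atTop, (H s : ℚ) = P.eval (s : ℚ) := by
      filter_upwards [eventually_ge_atTop N] with s hs
      have := hconst s hs
      rw [hPdef, Polynomial.eval_add, Polynomial.eval_C]
      linarith
    have hPd : ∀ x, P.eval x - P.eval (x - 1) = P₁.eval x := by
      intro x
      rw [← hQ x, hPdef]
      simp
    refine ⟨P, hPe, fun m => ?_⟩
    obtain ⟨q, hq⟩ := Ideal.nonempty_minimalPrimes hne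
    cases m with
    | zero =>
      refine iff_of_false ?_ ?_
      · intro h
        have h1 := quotDim_add_one_of_mem_minimalPrimes hv hq
        have h2 := (quotDim_le_iff hp.ne_top).2 h
        omega
      · intro h
        have hP0 : P = 0 := by
          rw [← Polynomial.degree_eq_bot]
          simpa using h
        obtain ⟨s, hs⟩ := hPe.exists
        rw [hP0, Polynomial.eval_zero] at hs
        have hs' : H s = 0 := by exact_mod_cast hs
        have := (hilbertFunction_eq_zero_iff hfin).1 hs' (X v ^ s) (by
          simpa using hXh.pow s)
        exact hv (hp.mem_of_pow_mem _ this)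
    | succ m =>
      rw [← degree_lt_iff_of_eval_sub_eval_sub_one hPd, ← hP₁.2,
        ringKrullDim_quotient_le_iff_minimalPrimes (J := p ⊔ Ideal.span {X v}),
        ← quotDim_le_iff hp.ne_top]
      constructor
      · intro h r hr
        have h1 := quotDim_add_one_of_mem_minimalPrimes hv hr
        exact (quotDim_le_iff hr.1.1.ne_top).1 (by omega)
      · intro h
        have h1 := quotDim_add_one_of_mem_minimalPrimes hv hq
        have h2 := (quotDim_le_iff hq.1.1.ne_top).2 (h q hq)
        omega
  · rintro J f e hJ hf ⟨P₁, h₁⟩ ⟨P₂, h₂⟩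
    have hnn : ∀ᶠ s : ℕ in atTop, 0 ≤ (Polynomial.taylor (-e : ℚ) P₂).eval (s : ℚ) := by
      obtain ⟨N, hN⟩ := eventually_atTop.1 h₂.eventually_nonneg
      filter_upwards [eventually_ge_atTop (N + e)] with s hs
      have := hN (s - e) (by omega)
      rwa [Nat.cast_sub (by omega), sub_eq_add_neg, ← Polynomial.taylor_eval] at this
    refine ⟨P₁ + Polynomial.taylor (-e : ℚ) P₂, ?_, fun m => ?_⟩
    · obtain ⟨N, hN⟩ := eventually_atTop.1 h₂.1
      filter_upwards [h₁.1, eventually_ge_atTop (N + e)] with s hs1 hs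
      obtain ⟨s, rfl⟩ : ∃ t, s = t + e := ⟨s - e, by omega⟩
      rw [hilbertFunction_add hfin hJ hf, Nat.cast_add, hs1, hN s (by omega),
        Polynomial.eval_add, Polynomial.taylor_eval]
      push_cast
      ring_nf
    -- The degree of the sum is the larger of the two degrees, and the dimension of `A/J` is the
    -- larger of the two dimensions.
    · rw [degree_add_lt_iff h₁.eventually_nonneg hnn, Polynomial.degree_taylor, ← h₁.2, ← h₂.2]
      refine ⟨fun h => ⟨(ringKrullDim_quotient_le_of_le le_sup_left).trans h,
        (ringKrullDim_quotient_le_of_le (le_colonElem J f)).trans h⟩, fun h => ?_⟩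
      rw [ringKrullDim_quotient_le_iff]
      intro p hp hJp
      rcases le_of_isPrime_of_le hJp f with h' | h'
      · exact (ringKrullDim_quotient_le_of_le h').trans h.1
      · exact (ringKrullDim_quotient_le_of_le h').trans h.2

end HilbertPolynomial
end CorrScroll

namespace CorrScroll
open MvPolynomial Filter Topology

section TopologicalDimension

/-! ### Krull dimensions of spaces of primes -/

/-- Such a `D` is a rank function: strict monotonicity gives height at most `D`, and descending one
unit at a time gives equality. -/
theorem krullDim_le_iff_of_strictMono {X : Type*} [Preorder X] {D : X → ℕ} (hD : StrictMono D)
    (hex : ∀ x, 0 < D x → ∃ y < x, D y + 1 = D x) (m : ℕ) :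
    Order.krullDim X ≤ m ↔ ∀ x, D x ≤ m := by
  have key : ∀ d : ℕ, ∀ x, D x = d → Order.height x = d := by
    intro d
    induction d using Nat.strong_induction_on with
    | _ d ih =>
      intro x hx
      apply le_antisymm
      · rw [Order.height_le_coe_iff]
        intro y hy
        have hlt : D y < d := hx ▸ hD hy
        rw [ih (D y) hlt y rfl]
        exact_mod_cast hlt
      · rcases Nat.eq_zero_or_pos d with rfl | hd
        · simp
        · obtain ⟨y, hy, hyx⟩ := hex x (hx ▸ hd)
          have h1 := Order.height_add_one_le hy
          rw [ih (D y) (by omega) y rfl] at h1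
          refine le_trans ?_ h1
          exact_mod_cast (by omega : d ≤ D y + 1)
  rw [Order.krullDim_eq_iSup_height, iSup_le_iff]
  refine forall_congr' fun x => ?_
  rw [key _ x rfl]
  norm_cast

/-- The space is sober, so its irreducible closed sets correspond to points ordered by
specialization, which is reverse inclusion of the ideals `φ x`. A rank function on points then
computes the dimension. This treats Proj and the product of projective spaces together. -/
theorem topologicalKrullDim_le_iff {X R : Type*} [TopologicalSpace X] [CommRing R]
    (φ : X → Ideal R) (hφ : ∀ x, (φ x).IsPrime) (hinj : Function.Injective φ)
    (hclosed : ∀ Z : Set X, IsClosed Z ↔ ∃ s : Set R, Z = {x | s ⊆ φ x})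
    (hgen : ∀ Z : Set X, Z.Nonempty → (⨅ x : Z, φ x).IsPrime → ∃ y, φ y = ⨅ x : Z, φ x)
    {D : X → ℕ} (hD : ∀ x y, φ x < φ y → D y < D x)
    (hex : ∀ x, 0 < D x → ∃ y, φ x < φ y ∧ D y + 1 = D x) (m : ℕ) :
    topologicalKrullDim X ≤ m ↔ ∀ x, D x ≤ m := by
  have hspec : ∀ x y : X, x ⤳ y ↔ φ x ≤ φ y := by
    intro x y
    rw [specializes_iff_forall_closed]
    constructor
    · intro h
      exact h {z | (φ x : Set R) ⊆ φ z} ((hclosed _).2 ⟨_, rfl⟩) (le_refl (φ x))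
    · intro h Z hZ hx
      obtain ⟨s, rfl⟩ := (hclosed Z).1 hZ
      exact Set.Subset.trans hx h
  have hT0 : T0Space X := ⟨fun x y h => hinj (le_antisymm ((hspec x y).1 h.specializes)
    ((hspec y x).1 h.symm.specializes))⟩
  -- The ideal of an irreducible closed set, the intersection of the primes of its points, is prime;
  -- `hgen` turns it into a generic point.
  have hQS : QuasiSober X := by
    refine ⟨fun {S} hS hSc => ?_⟩
    have hpr : (⨅ x : S, φ x).IsPrime := by
      obtain ⟨x₀, hx₀⟩ := hS.nonempty
      refine ⟨fun h => (hφ x₀).ne_top ?_, fun {f g} hfg => ?_⟩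
      · rw [eq_top_iff, ← h]
        exact iInf_le (fun x : S => φ x) ⟨x₀, hx₀⟩
      · have h1 : S ⊆ {x | ({f} : Set R) ⊆ φ x} ∪ {x | ({g} : Set R) ⊆ φ x} := by
          intro x hx
          rw [Ideal.mem_iInf] at hfg
          rcases (hφ x).mem_or_mem (hfg ⟨x, hx⟩) with h | h
          · exact Or.inl (by simpa using h)
          · exact Or.inr (by simpa using h)
        rcases isPreirreducible_iff_isClosed_union_isClosed.1 hS.isPreirreducible _ _
          ((hclosed _).2 ⟨{f}, rfl⟩) ((hclosed _).2 ⟨{g}, rfl⟩) h1 with h | h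
        · left
          rw [Ideal.mem_iInf]
          exact fun x => h x.2 rfl
        · right
          rw [Ideal.mem_iInf]
          exact fun x => h x.2 rfl
    obtain ⟨y, hy⟩ := hgen S hS.nonempty hpr
    refine ⟨y, ?_⟩
    rw [isGenericPoint_iff_specializes]
    intro z
    rw [hspec, hy]
    obtain ⟨s, hs⟩ := (hclosed S).1 hSc
    constructor
    · intro h
      rw [hs]
      intro f hf
      refine h ((Ideal.mem_iInf).2 fun x => ?_)
      exact hs.subset x.2 hf
    · intro h
      exact iInf_le (fun x : S => φ x) ⟨z, h⟩
  let _ := specializationOrder (X := X)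
  have hle : ∀ x y : X, x ≤ y ↔ φ y ≤ φ x := fun x y => hspec y x
  have hlt : ∀ x y : X, x < y ↔ φ y < φ x := fun x y => by
    rw [lt_iff_le_not_ge, lt_iff_le_not_ge, hle, hle]
  rw [topologicalKrullDim, Order.krullDim_eq_of_orderIso irreducibleSetEquivPoints]
  refine krullDim_le_iff_of_strictMono (fun x y h => hD y x ((hlt x y).1 h)) (fun x hx => ?_) m
  obtain ⟨y, hy, hyx⟩ := hex x hx
  exact ⟨y, (hlt _ _).2 hy, hyx⟩

/-- The rank of a point is the dimension of its affine cone minus `n`, the dimension of the cone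
over a closed point: `1` for Proj, the number of factors for a product. -/
theorem topologicalKrullDim_le_iff_quotDim {k σ X : Type*} [Field k] [Finite σ]
    [TopologicalSpace X]
    (φ : X → Ideal (MvPolynomial σ k)) (hφ : ∀ x, (φ x).IsPrime) (hinj : Function.Injective φ)
    (hclosed : ∀ Z : Set X, IsClosed Z ↔ ∃ s : Set (MvPolynomial σ k), Z = {x | s ⊆ φ x})
    (hgen : ∀ Z : Set X, Z.Nonempty → (⨅ x : Z, φ x).IsPrime → ∃ y, φ y = ⨅ x : Z, φ x)
    {n : ℕ} (hn : ∀ x, n ≤ quotDim (φ x))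
    (hex : ∀ x, n < quotDim (φ x) → ∃ y, φ x < φ y ∧ quotDim (φ y) + 1 = quotDim (φ x)) (m : ℕ) :
    topologicalKrullDim X ≤ m ↔ ∀ x, quotDim (φ x) ≤ m + n := by
  rw [topologicalKrullDim_le_iff φ hφ hinj hclosed hgen (D := fun x => quotDim (φ x) - n)]
  · exact forall_congr' fun x => by omega
  · intro x y h
    have := hφ x
    have := hφ y
    have h1 := quotDim_lt_of_lt h
    have := hn y
    omega
  · intro x hx
    obtain ⟨y, hy, hyx⟩ := hex x (by omega)
    have := hn y
    exact ⟨y, hy, by omega⟩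

end TopologicalDimension

section Proj

/-! ### The dimension of a projective scheme -/

variable {k σ : Type*} [Field k]

attribute [local instance] MvPolynomial.gradedAlgebra

theorem coe_decompose_homogeneousSubmodule (f : MvPolynomial σ k) (m : ℕ) :
    (DirectSum.decompose (homogeneousSubmodule σ k) f m : MvPolynomial σ k) =
      homogeneousComponent m f :=
  decomposition.decompose'_apply _ _

theorem isHomogeneous_iff_homIdeal_one {J : Ideal (MvPolynomial σ k)} :
    J.IsHomogeneous (homogeneousSubmodule σ k) ↔ HomIdeal (fun _ : σ => (1 : ℕ)) J := by
  constructor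
  · intro h f hf m
    have := h m hf
    rwa [coe_decompose_homogeneousSubmodule] at this
  · intro h m f hf
    rw [coe_decompose_homogeneousSubmodule]
    exact h f hf m

theorem irrelevant_le_iff {p : HomogeneousIdeal (homogeneousSubmodule σ k)} :
    HomogeneousIdeal.irrelevant (homogeneousSubmodule σ k) ≤ p ↔
      ∀ v, (X v : MvPolynomial σ k) ∈ p.toIdeal := by
  have hmem : ∀ f : MvPolynomial σ k,
      f ∈ HomogeneousIdeal.irrelevant (homogeneousSubmodule σ k) ↔ coeff 0 f = 0 := by
    intro f
    rw [HomogeneousIdeal.mem_irrelevant_iff, GradedRing.proj_apply,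
      coe_decompose_homogeneousSubmodule, homogeneousComponent_zero]
    exact map_eq_zero_iff _ (C_injective σ k)
  constructor
  · intro h v
    exact h ((hmem _).2 (by simp))
  · intro h f hf
    exact mem_of_forall_X_mem h ((hmem f).1 hf)

theorem exists_X_notMem (x : ProjectiveSpectrum (homogeneousSubmodule σ k)) :
    ∃ v, (X v : MvPolynomial σ k) ∉ x.asHomogeneousIdeal.toIdeal := by
  have := x.not_irrelevant_le
  rw [irrelevant_le_iff] at this
  push Not at this
  exact this

theorem homIdeal_asHomogeneousIdeal (x : ProjectiveSpectrum (homogeneousSubmodule σ k)) :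
    HomIdeal (fun _ : σ => (1 : ℕ)) x.asHomogeneousIdeal.toIdeal :=
  isHomogeneous_iff_homIdeal_one.1 x.asHomogeneousIdeal.isHomogeneous

variable [Finite σ]

theorem quotDim_eq_zero_of_forall_X_mem {p : Ideal (MvPolynomial σ k)} (hp : p ≠ ⊤)
    (hX : ∀ v, X v ∈ p) : quotDim p = 0 := by
  have := (quotDim_le_iff (d := 0) hp).2 (ringKrullDim_quotient_nonpos_of_forall_X_mem hX)
  omega

theorem exists_projectiveSpectrum_eq {p : Ideal (MvPolynomial σ k)} [hp : p.IsPrime]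
    (hpw : HomIdeal (fun _ : σ => (1 : ℕ)) p) (hX : 0 < quotDim p) :
    ∃ x : ProjectiveSpectrum (homogeneousSubmodule σ k), x.asHomogeneousIdeal.toIdeal = p := by
  refine ⟨⟨⟨p, isHomogeneous_iff_homIdeal_one.2 hpw⟩, hp, fun h => ?_⟩, rfl⟩
  rw [irrelevant_le_iff] at h
  have := quotDim_eq_zero_of_forall_X_mem hp.ne_top h
  omega

theorem one_le_quotDim_asHomogeneousIdeal
    (x : ProjectiveSpectrum (homogeneousSubmodule σ k)) :
    1 ≤ quotDim x.asHomogeneousIdeal.toIdeal := by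
  obtain ⟨v, hv⟩ := exists_X_notMem x
  obtain ⟨q, hq⟩ := Ideal.nonempty_minimalPrimes
    ((homIdeal_asHomogeneousIdeal x).sup_span_singleton_ne_top weight_one_eq_zero
      x.isPrime.ne_top (constantCoeff_X (R := k) v))
  have := quotDim_add_one_of_mem_minimalPrimes hv hq
  omega

/-- The only homogeneous prime that is not a point of Proj contains all variables and has a
zero-dimensional quotient, whereas every point has a cone of dimension at least one. -/
theorem projLocus_eq_empty_iff {J : Ideal (MvPolynomial σ k)}
    (hJ : HomIdeal (fun _ : σ => (1 : ℕ)) J) :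
    projLocus J = ∅ ↔ ringKrullDim (MvPolynomial σ k ⧸ J) ≤ 0 := by
  constructor
  · intro h
    rw [ringKrullDim_quotient_le_iff_minimalPrimes]
    intro p hp
    have hpp := hp.1.1
    by_contra hlt
    have h1 : ¬ quotDim p ≤ 0 := fun h => hlt ((quotDim_le_iff hpp.ne_top).1 h)
    obtain ⟨x, hx⟩ := exists_projectiveSpectrum_eq (HomIdeal.of_mem_minimalPrimes (primeTest_nat _)
      finiteDimensional_weightedHomogeneousSubmodule_one hJ hp) (by omega)
    have h2 : x ∈ projLocus J := by
      intro f hf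
      have h3 := hp.1.2 hf
      rw [← hx] at h3
      exact h3
    rw [h] at h2
    exact h2
  · intro h
    rw [Set.eq_empty_iff_forall_notMem]
    intro x hx
    have h1 := ringKrullDim_quotient_le_iff.1 h _ x.isPrime hx
    have h2 := (quotDim_le_iff (d := 0) x.isPrime.ne_top).2 h1
    have := one_le_quotDim_asHomogeneousIdeal x
    omega

theorem topologicalKrullDim_projLocus_le_iff {J : Ideal (MvPolynomial σ k)}
    (hJ : HomIdeal (fun _ : σ => (1 : ℕ)) J) (m : ℕ) :
    topologicalKrullDim (projLocus J) ≤ m ↔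
      ringKrullDim (MvPolynomial σ k ⧸ J) ≤ (m + 1 : ℕ) := by
  rw [topologicalKrullDim_le_iff_quotDim (n := 1)
    (fun x : projLocus J => x.1.asHomogeneousIdeal.toIdeal) (fun x => x.1.isPrime)]
  · rw [ringKrullDim_quotient_le_iff_minimalPrimes]
    constructor
    · intro h p hp
      have hpp := hp.1.1
      rw [← quotDim_le_iff hpp.ne_top]
      by_cases h0 : quotDim p = 0
      · omega
      obtain ⟨x, hx⟩ := exists_projectiveSpectrum_eq (HomIdeal.of_mem_minimalPrimes
        (primeTest_nat _) finiteDimensional_weightedHomogeneousSubmodule_one hJ hp)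
        (Nat.pos_of_ne_zero h0)
      rw [← hx]
      refine h ⟨x, fun f hf => ?_⟩
      have h3 := hp.1.2 hf
      rw [← hx] at h3
      exact h3
    · intro h x
      rw [quotDim_le_iff x.1.isPrime.ne_top]
      exact ringKrullDim_quotient_le_iff.1 (ringKrullDim_quotient_le_iff_minimalPrimes.2 h) _
        x.1.isPrime x.2
  · intro x y h
    apply Subtype.ext
    apply ProjectiveSpectrum.ext
    exact HomogeneousSubmodule.toSubmodule_injective _ _ h
  · intro Z
    rw [isClosed_induced_iff]
    constructor
    · rintro ⟨t, ht, rfl⟩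
      obtain ⟨s, rfl⟩ := (ProjectiveSpectrum.isClosed_iff_zeroLocus _ t).1 ht
      exact ⟨s, rfl⟩
    · rintro ⟨s, rfl⟩
      exact ⟨_, ProjectiveSpectrum.isClosed_zeroLocus _ s, rfl⟩
  · rintro Z ⟨z, hz⟩ hpr
    set p := ⨅ x : Z, x.1.1.asHomogeneousIdeal.toIdeal with hpdef
    have hpw : HomIdeal (fun _ : σ => (1 : ℕ)) p :=
      HomIdeal.iInf fun x => homIdeal_asHomogeneousIdeal x.1.1
    have hle : p ≤ z.1.asHomogeneousIdeal.toIdeal :=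
      iInf_le (fun x : Z => x.1.1.asHomogeneousIdeal.toIdeal) ⟨z, hz⟩
    obtain ⟨v, hv⟩ := exists_X_notMem z.1
    refine ⟨⟨⟨⟨p, isHomogeneous_iff_homIdeal_one.2 hpw⟩, hpr, fun h => ?_⟩, fun f hf => ?_⟩, rfl⟩
    · exact hv (hle (irrelevant_le_iff.1 h v))
    · have : f ∈ p := (Ideal.mem_iInf).2 fun x => x.1.2 hf
      exact this
  · exact fun x => one_le_quotDim_asHomogeneousIdeal x.1
  · intro x hx
    obtain ⟨v, hv⟩ := exists_X_notMem x.1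
    have hxw := homIdeal_asHomogeneousIdeal x.1
    obtain ⟨q, hq⟩ := Ideal.nonempty_minimalPrimes
      (hxw.sup_span_singleton_ne_top weight_one_eq_zero
        x.1.isPrime.ne_top (constantCoeff_X (R := k) v))
    have hqp := hq.1.1
    have h1 := quotDim_add_one_of_mem_minimalPrimes hv hq
    obtain ⟨y, hy⟩ := exists_projectiveSpectrum_eq (HomIdeal.of_mem_minimalPrimes
        (primeTest_nat _) finiteDimensional_weightedHomogeneousSubmodule_one
        (hxw.sup_span_singleton (isWeightedHomogeneous_X k _ v)) hq) (by omega)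
    have hxq : x.1.asHomogeneousIdeal.toIdeal ≤ y.asHomogeneousIdeal.toIdeal := by
      rw [hy]
      exact le_sup_left.trans hq.1.2
    refine ⟨⟨y, fun f hf => hxq (x.2 hf)⟩, lt_of_le_of_ne hxq fun h => hv ?_, ?_⟩
    · rw [h]
      change _ ∈ y.asHomogeneousIdeal.toIdeal
      rw [hy]
      exact hq.1.2 (Ideal.mem_sup_right (Ideal.mem_span_singleton_self _))
    · change quotDim y.asHomogeneousIdeal.toIdeal + 1 = _
      rw [hy]
      exact h1

theorem topologicalKrullDim_projLocus_add_one {J : Ideal (MvPolynomial σ k)}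
    (hJ : HomIdeal (fun _ : σ => (1 : ℕ)) J) (hne : (projLocus J).Nonempty) :
    topologicalKrullDim (projLocus J) + 1 = ringKrullDim (MvPolynomial σ k ⧸ J) := by
  have hJt : J ≠ ⊤ := by
    rintro rfl
    obtain ⟨x, hx⟩ := hne
    exact x.isPrime.ne_top (eq_top_iff.2 hx)
  have h := topologicalKrullDim_projLocus_le_iff hJ
  have h0 : ¬ ringKrullDim (MvPolynomial σ k ⧸ J) ≤ 0 := fun h' =>
    hne.ne_empty ((projLocus_eq_empty_iff hJ).2 h')
  rw [ringKrullDim_eq_quotDim hJt] at h h0 ⊢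
  obtain ⟨d, hd⟩ : ∃ d, quotDim J = d + 1 := by
    refine ⟨quotDim J - 1, ?_⟩
    have : ¬ quotDim J ≤ 0 := fun h' => h0 (by exact_mod_cast h')
    omega
  rw [hd] at h ⊢
  have h1 : topologicalKrullDim (projLocus J) = (d : ℕ) := by
    apply le_antisymm
    · exact (h d).2 le_rfl
    · by_contra! hlt
      cases d with
      -- The criterion bounds the dimension only by natural numbers, so dimension zero must be
      -- separated from `⊥` by nonemptiness.
      | zero =>
        have : Nonempty (TopologicalSpace.IrreducibleCloseds (projLocus J)) := by
          obtain ⟨x, hx⟩ := hne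
          exact ⟨⟨closure {⟨x, hx⟩}, isIrreducible_singleton.closure, isClosed_closure⟩⟩
        exact absurd Order.krullDim_nonneg (not_le.2 hlt)
      | succ d =>
        have h2 : topologicalKrullDim (projLocus J) ≤ (d : ℕ) := by
          revert hlt
          generalize topologicalKrullDim (projLocus J) = x
          induction x using WithBot.recBotCoe with
          | bot => simp
          | coe x =>
            induction x using ENat.recTopCoe with
            | top => exact fun h => absurd (WithBot.coe_lt_coe.1 h) not_top_lt
            | coe x =>
              intro h
              have h1 : x < d + 1 := by exact_mod_cast h
              exact_mod_cast Nat.lt_succ_iff.1 h1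
        have h3 := (h d).1 h2
        have : d + 1 + 1 ≤ d + 1 := by exact_mod_cast h3
        omega
  rw [h1]
  norm_cast

end Proj
end CorrScroll

namespace CorrScroll
open MvPolynomial Filter Topology

section BlockGrading

/-! ### Gradings by blocks of variables -/

variable {k : Type*} [Field k] {n : ℕ}

/-- The sum of the entries, as an additive map. -/
noncomputable def sumHom (n : ℕ) : (Fin n → ℕ) →+ ℕ where
  toFun t := ∑ i, t i
  map_zero' := by simp
  map_add' s t := by simp [Finset.sum_add_distrib]

@[simp] theorem sumHom_apply (t : Fin n → ℕ) : sumHom n t = ∑ i, t i := rfl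

/-- The degree of a variable in the `i`-th block is the `i`-th unit vector. -/
def blockDeg {κ : Fin n → Type*} : (Σ i, κ i) → (Fin n → ℕ) := fun v => Pi.single v.1 1

theorem multiDeg_eq_blockDeg (a : Fin n → ℕ) : multiDeg a = blockDeg := rfl

theorem sumHom_comp_blockDeg {κ : Fin n → Type*} :
    sumHom n ∘ (blockDeg : (Σ i, κ i) → (Fin n → ℕ)) = fun _ => 1 := by
  funext v
  simp [blockDeg]

theorem finiteDimensional_of_comp {σ M L : Type*} [AddCommMonoid M] [AddCommMonoid L]
    {w : σ → M} (φ : M →+ L)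
    (h : ∀ l, FiniteDimensional k (weightedHomogeneousSubmodule k (φ ∘ w) l)) (m : M) :
    FiniteDimensional k (weightedHomogeneousSubmodule k w m) := by
  have := h (φ m)
  refine Submodule.finiteDimensional_of_le
    (S₂ := weightedHomogeneousSubmodule k (φ ∘ w) (φ m)) fun f hf d hd => ?_
  rw [weight_comp, hf hd]

theorem finiteDimensional_blockDeg {κ : Fin n → Type*} [∀ i, Finite (κ i)] (m : Fin n → ℕ) :
    FiniteDimensional k
      (weightedHomogeneousSubmodule k (blockDeg : (Σ i, κ i) → (Fin n → ℕ)) m) := by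
  refine finiteDimensional_of_comp (sumHom n) ?_ m
  rw [sumHom_comp_blockDeg]
  exact finiteDimensional_weightedHomogeneousSubmodule_one

theorem HomIdeal.of_blockDeg {κ : Fin n → Type*} {J : Ideal (MvPolynomial (Σ i, κ i) k)}
    (hJ : HomIdeal blockDeg J) : HomIdeal (fun _ => (1 : ℕ)) J := by
  rw [← sumHom_comp_blockDeg]
  exact hJ.comp (sumHom n)

theorem hilbertFunction_one_eq_sum_blockDeg {κ : Fin n → Type*} [∀ i, Finite (κ i)]
    {J : Ideal (MvPolynomial (Σ i, κ i) k)} (hJ : HomIdeal blockDeg J) (s : ℕ) :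
    hilbertFunction (fun _ => (1 : ℕ)) J s =
      ∑ t ∈ Finset.piAntidiag Finset.univ s, hilbertFunction blockDeg J t := by
  rw [← sumHom_comp_blockDeg]
  exact hilbertFunction_comp finiteDimensional_blockDeg (sumHom n) (by simp) hJ

theorem isMultigraded_iff_homIdeal {a : Fin n → ℕ} {I : Ideal (CoxRing k a)} :
    IsMultigraded I ↔ HomIdeal (multiDeg a) I := isHomogeneous_iff_homIdeal

end BlockGrading

/-! ### Substitutions compatible with gradings -/

section Substitution

variable {k σ τ M L : Type*} [Field k] [AddCommMonoid M] [AddCommMonoid L]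

theorem IsWeightedHomogeneous.aeval_of_forall {w : σ → M} {w' : τ → L} (φ : M →+ L)
    {g : σ → MvPolynomial τ k} (hg : ∀ v, IsWeightedHomogeneous w' (g v) (φ (w v)))
    {f : MvPolynomial σ k} {m : M} (hf : IsWeightedHomogeneous w f m) :
    IsWeightedHomogeneous w' (aeval g f) (φ m) := by
  rw [aeval_def, eval₂_eq]
  refine IsWeightedHomogeneous.sum _ _ _ fun d hd => ?_
  have h1 : φ m = 0 + ∑ v ∈ d.support, d v • φ (w v) := by
    rw [← hf (mem_support_iff.1 hd), zero_add, Finsupp.weight_apply, Finsupp.sum, map_sum]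
    exact Finset.sum_congr rfl fun v _ => by rw [map_nsmul]
  rw [h1]
  exact (isWeightedHomogeneous_C _ _).mul (IsWeightedHomogeneous.prod _ _ _ fun v _ =>
    (hg v).pow _)

/-- Injectivity of `φ` keeps components of different degrees apart after the substitution. -/
theorem weightedHomogeneousComponent_aeval {w : σ → M} {w' : τ → L} {φ : M →+ L}
    (hφ : Function.Injective φ)
    {g : σ → MvPolynomial τ k} (hg : ∀ v, IsWeightedHomogeneous w' (g v) (φ (w v)))
    (f : MvPolynomial σ k) (m : M) :
    weightedHomogeneousComponent w' (φ m) (aeval g f) =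
      aeval g (weightedHomogeneousComponent w m f) := by
  classical
  conv_lhs => rw [← sum_image_weightedHomogeneousComponent w f, map_sum, map_sum]
  rw [Finset.sum_eq_single m]
  · exact weightedHomogeneousComponent_eq_self (IsWeightedHomogeneous.aeval_of_forall φ hg
      (weightedHomogeneousComponent_isWeightedHomogeneous _ _))
  · intro m' _ hne
    exact IsWeightedHomogeneous.weightedHomogeneousComponent_ne _
      (IsWeightedHomogeneous.aeval_of_forall φ hg
        (weightedHomogeneousComponent_isWeightedHomogeneous _ _)) fun h => hne (hφ h).symm
  · intro hm
    rw [weightedHomogeneousComponent_eq_zero_of_notMem w f m hm, map_zero, map_zero]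

end Substitution

section Scroll

/-! ### Correspondence scrolls -/

variable {k : Type*} [Field k] {n : ℕ} {a b : Fin n → ℕ}

theorem finite_setOf_sum_eq {ι : Type*} [Fintype ι] (c : ℕ) :
    Finite {α : ι → ℕ // ∑ j, α j = c} := by
  classical
  refine Set.Finite.subset (Finset.piAntidiag Finset.univ c).finite_toSet fun α hα =>
    Finset.mem_coe.2 (Finset.mem_piAntidiag.2 ⟨hα, by simp⟩)

instance (i : Fin n) : Finite {α : Fin (a i + 1) → ℕ // ∑ j, α j = b i} := finite_setOf_sum_eq _

variable (k a b) in
/-- The map `z_{i,α} ↦ x_i^α` to the Cox ring. -/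
noncomputable def scrollLift : MvPolynomial (ScrollVar a b) k →ₐ[k] CoxRing k a :=
  aeval fun v => ∏ j, (X ⟨v.1, j⟩ : CoxRing k a) ^ v.2.1 j

theorem scrollMap_apply (I : Ideal (CoxRing k a)) (f : MvPolynomial (ScrollVar a b) k) :
    scrollMap b I f = Ideal.Quotient.mk I (scrollLift k a b f) := by
  have : scrollMap b I = (Ideal.Quotient.mkₐ k I).comp (scrollLift k a b) := by
    apply MvPolynomial.algHom_ext
    intro v
    simp [scrollMap, scrollLift]
  rw [this]
  rfl

theorem mem_scrollIdeal {I : Ideal (CoxRing k a)} {f : MvPolynomial (ScrollVar a b) k} :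
    f ∈ scrollIdeal b I ↔ scrollLift k a b f ∈ I := by
  rw [scrollIdeal, RingHom.mem_ker, scrollMap_apply, Ideal.Quotient.eq_zero_iff_mem]

/-- Multiplication by `b` on multidegrees. -/
noncomputable def mulHom (b : Fin n → ℕ) : (Fin n → ℕ) →+ (Fin n → ℕ) := AddMonoidHom.mulLeft b

theorem mulHom_apply (t : Fin n → ℕ) : mulHom b t = fun i => b i * t i := rfl

theorem mulHom_injective (hb : ∀ i, 0 < b i) : Function.Injective (mulHom b) := by
  intro s t h
  funext i
  exact Nat.eq_of_mul_eq_mul_left (hb i) (congrFun h i)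

theorem isWeightedHomogeneous_prod_X_pow (v : ScrollVar a b) :
    IsWeightedHomogeneous (multiDeg a)
      (∏ j, (X ⟨v.1, j⟩ : CoxRing k a) ^ v.2.1 j) (mulHom b (blockDeg v)) := by
  have h : mulHom b (blockDeg v) =
      ∑ j : Fin (a v.1 + 1), v.2.1 j • multiDeg a ⟨v.1, j⟩ := by
    funext i
    simp only [multiDeg, mulHom_apply, blockDeg, Finset.sum_apply, Pi.smul_apply, smul_eq_mul]
    rw [← Finset.sum_mul, v.2.2]
    by_cases hi : i = v.1
    · subst hi; rfl
    · simp [hi]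
  rw [h]
  exact IsWeightedHomogeneous.prod _ _ _ fun j _ => (isWeightedHomogeneous_X k _ _).pow _

theorem homIdeal_scrollIdeal (hb : ∀ i, 0 < b i) {I : Ideal (CoxRing k a)}
    (hI : HomIdeal (multiDeg a) I) : HomIdeal blockDeg (scrollIdeal b I) := by
  intro f hf t
  rw [mem_scrollIdeal] at hf ⊢
  rw [scrollLift, ← weightedHomogeneousComponent_aeval (mulHom_injective hb)
    isWeightedHomogeneous_prod_X_pow]
  exact hI _ hf _

theorem exists_le_sum_eq {ι : Type*} [Fintype ι] (d : ι → ℕ) (c : ℕ) (hc : c ≤ ∑ j, d j) :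
    ∃ α : ι → ℕ, α ≤ d ∧ ∑ j, α j = c := by
  classical
  induction c with
  | zero => exact ⟨0, fun _ => Nat.zero_le _, by simp⟩
  | succ c ih =>
    obtain ⟨α, hα, hs⟩ := ih (by omega)
    have : ∃ j, α j < d j := by
      by_contra! h
      have := Finset.sum_le_sum fun j (_ : j ∈ Finset.univ) => h j
      omega
    obtain ⟨j, hj⟩ := this
    refine ⟨α + Pi.single j 1, fun i => ?_, ?_⟩
    · by_cases hi : i = j
      · subst hi; simpa using hj
      · simpa [hi] using hα i
    · simp [Finset.sum_add_distrib, hs]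

theorem weight_multiDeg_apply (d : (Σ i : Fin n, Fin (a i + 1)) →₀ ℕ) (i : Fin n) :
    Finsupp.weight (multiDeg a) d i = ∑ j, d ⟨i, j⟩ := by
  rw [Finsupp.weight_apply, Finsupp.sum_fintype _ _ (by simp), Finset.sum_apply,
    Fintype.sum_sigma, Finset.sum_eq_single i]
  · simp [multiDeg]
  · intro i' _ hne
    simp [multiDeg, Pi.single_eq_of_ne hne.symm]
  · simp

/-- Peel off a factor of degree `b_i` in a block with `t_i > 0`; this is the image of one variable
`z_{i,α}`, and the total `∑ t_i` decreases by one. -/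
theorem exists_scrollLift_eq_monomial (t : Fin n → ℕ)
    (d : (Σ i : Fin n, Fin (a i + 1)) →₀ ℕ) (hd : Finsupp.weight (multiDeg a) d = mulHom b t) :
    ∃ g : MvPolynomial (ScrollVar a b) k, IsWeightedHomogeneous blockDeg g t ∧
      scrollLift k a b g = monomial d 1 := by
  classical
  induction hs : ∑ i, t i generalizing t d with
  | zero =>
    have ht : t = 0 := by
      funext i
      exact (Finset.sum_eq_zero_iff.1 hs) i (Finset.mem_univ i)
    subst ht
    refine ⟨1, isWeightedHomogeneous_one _ _, ?_⟩
    have : d = 0 := by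
      ext ⟨i, j⟩
      have h := congrFun hd i
      rw [weight_multiDeg_apply, map_zero, Pi.zero_apply, Finset.sum_eq_zero_iff] at h
      exact h j (Finset.mem_univ j)
    rw [this, map_one]
    rfl
  | succ s ih =>
    obtain ⟨i, -, hi⟩ := Finset.exists_ne_zero_of_sum_ne_zero (hs.trans_ne s.succ_ne_zero)
    obtain ⟨t', rfl⟩ : ∃ t', t = t' + Pi.single i 1 := by
      refine ⟨t - Pi.single i 1, (tsub_add_cancel_of_le fun i' => ?_).symm⟩
      rw [Pi.single_apply]
      split_ifs with h
      · exact h ▸ Nat.one_le_iff_ne_zero.2 hi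
      · exact Nat.zero_le _
    have hdi := congrFun hd i
    rw [weight_multiDeg_apply, mulHom_apply] at hdi
    obtain ⟨α, hα, hαs⟩ := exists_le_sum_eq (fun j => d ⟨i, j⟩) (b i) (by
      rw [hdi]; simp [mul_add])
    let v : ScrollVar a b := ⟨i, ⟨α, hαs⟩⟩
    let e : (Σ i : Fin n, Fin (a i + 1)) →₀ ℕ := ∑ j, Finsupp.single ⟨i, j⟩ (α j)
    have he : (∏ j, (X ⟨i, j⟩ : CoxRing k a) ^ α j) = monomial e 1 := by
      simp only [e, monomial_sum_one, X_pow_eq_monomial]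
    have hei : ∀ j, e ⟨i, j⟩ = α j := by
      intro j
      simp only [e, Finsupp.finsetSum_apply]
      rw [Finset.sum_eq_single j]
      · simp
      · intro j' _ hne
        rw [Finsupp.single_apply, if_neg]
        intro h
        simp at h
        exact hne h
      · simp
    have hei' : ∀ i' j, i' ≠ i → e ⟨i', j⟩ = 0 := by
      intro i' j hne
      simp only [e, Finsupp.finsetSum_apply]
      refine Finset.sum_eq_zero fun j' _ => ?_
      rw [Finsupp.single_apply, if_neg]
      intro h
      exact hne (congrArg Sigma.fst h).symm
    have hed : e ≤ d := by
      rintro ⟨i', j⟩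
      by_cases h : i' = i
      · subst h
        rw [hei]
        exact hα j
      · rw [hei' _ _ h]
        exact Nat.zero_le _
    have hew : Finsupp.weight (multiDeg a) e = mulHom b (Pi.single i 1) := by
      funext i'
      rw [weight_multiDeg_apply]
      by_cases h : i' = i
      · subst h
        simp [hei, hαs, mulHom_apply]
      · simp [hei' _ _ h, mulHom_apply, h]
    obtain ⟨g, hg, hgd⟩ := ih t' (d - e) (by
      have h1 : Finsupp.weight (multiDeg a) (d - e) + Finsupp.weight (multiDeg a) e =
          mulHom b t' + mulHom b (Pi.single i 1) := by
        rw [← map_add, tsub_add_cancel_of_le hed, hd, map_add]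
      rw [hew] at h1
      exact add_right_cancel h1) (by
        simp [Finset.sum_add_distrib] at hs
        exact hs)
    refine ⟨g * X v, hg.mul (isWeightedHomogeneous_X k _ v), ?_⟩
    rw [map_mul, hgd]
    have : scrollLift k a b (X v) = monomial e 1 := by
      rw [← he]
      simp [scrollLift, v]
    rw [this, monomial_mul, tsub_add_cancel_of_le hed, one_mul]

theorem exists_scrollLift_eq {t : Fin n → ℕ} {f : CoxRing k a}
    (hf : IsWeightedHomogeneous (multiDeg a) f (mulHom b t)) :
    ∃ g : MvPolynomial (ScrollVar a b) k, IsWeightedHomogeneous blockDeg g t ∧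
      scrollLift k a b g = f := by
  classical
  have h : ∀ d : (Σ i : Fin n, Fin (a i + 1)) →₀ ℕ, ∃ g : MvPolynomial (ScrollVar a b) k,
      d ∈ f.support → IsWeightedHomogeneous blockDeg g t ∧ scrollLift k a b g = monomial d 1 := by
    intro d
    by_cases hd : d ∈ f.support
    · obtain ⟨g, hg⟩ := exists_scrollLift_eq_monomial (k := k) t d (hf (mem_support_iff.1 hd))
      exact ⟨g, fun _ => hg⟩
    · exact ⟨0, fun h => absurd h hd⟩
  choose g hg using h
  refine ⟨∑ d ∈ f.support, C (coeff d f) * g d, IsWeightedHomogeneous.sum _ _ _ fun d hd => ?_, ?_⟩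
  · have := (isWeightedHomogeneous_C (blockDeg : ScrollVar a b → _) (coeff d f)).mul (hg d hd).1
    rwa [zero_add] at this
  · conv_rhs => rw [f.as_sum]
    rw [map_sum]
    refine Finset.sum_congr rfl fun d hd => ?_
    rw [map_mul, (hg d hd).2, ← algebraMap_eq, AlgHom.commutes, algebraMap_eq, C_mul_monomial,
      mul_one]

/-- The embedding of `S/K` into `A/I` carries the piece of block degree `t` onto the whole piece of
multidegree `(b_i t_i)`. -/
theorem hilbertFunction_blockDeg_scrollIdeal (I : Ideal (CoxRing k a)) (t : Fin n → ℕ) :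
    hilbertFunction blockDeg (scrollIdeal b I) t =
      hilbertFunction (multiDeg a) I (fun i => b i * t i) := by
  let f : (MvPolynomial (ScrollVar a b) k ⧸ scrollIdeal b I) →ₐ[k] CoxRing k a ⧸ I :=
    Ideal.kerLiftAlg (scrollMap b I)
  have hf : Function.Injective f := Ideal.kerLiftAlg_injective _
  have hfm : ∀ g, f (Ideal.Quotient.mk _ g) = Ideal.Quotient.mk I (scrollLift k a b g) := by
    intro g
    rw [← scrollMap_apply]
    rfl
  rw [hilbertFunction, hilbertFunction, 
    (Submodule.equivMapOfInjective f.toLinearMap hf _).finrank_eq]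
  refine congrArg (fun V : Submodule k (CoxRing k a ⧸ I) => Module.finrank k V) ?_
  ext y
  constructor
  · rintro ⟨_, ⟨g, hg, rfl⟩, rfl⟩
    exact ⟨scrollLift k a b g, IsWeightedHomogeneous.aeval_of_forall (mulHom b)
      isWeightedHomogeneous_prod_X_pow hg, (hfm g).symm⟩
  · rintro ⟨x, hx, rfl⟩
    obtain ⟨g, hg, rfl⟩ := exists_scrollLift_eq (b := b) (t := t) hx
    exact ⟨_, ⟨g, hg, rfl⟩, hfm g⟩

theorem hilbertFunction_scrollIdeal (hb : ∀ i, 0 < b i) {I : Ideal (CoxRing k a)}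
    (hI : HomIdeal (multiDeg a) I) (s : ℕ) :
    hilbertFunction (fun _ => (1 : ℕ)) (scrollIdeal b I) s =
      ∑ t ∈ Finset.piAntidiag Finset.univ s,
        hilbertFunction (multiDeg a) I (fun i => b i * t i) := by
  rw [hilbertFunction_one_eq_sum_blockDeg (homIdeal_scrollIdeal hb hI)]
  exact Finset.sum_congr rfl fun t _ => hilbertFunction_blockDeg_scrollIdeal I t

/-- The ring `A/I` is integral over the embedded `S/K`, since it is generated by the `x_{i,j}`, and
`x_{i,j}^{b_i}` is the image of the variable whose exponent vector is concentrated at `j`. -/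
theorem ringKrullDim_scrollIdeal (hb : ∀ i, 0 < b i) (I : Ideal (CoxRing k a)) :
    ringKrullDim (CoxRing k a ⧸ I) =
      ringKrullDim (MvPolynomial (ScrollVar a b) k ⧸ scrollIdeal b I) := by
  let f : (MvPolynomial (ScrollVar a b) k ⧸ scrollIdeal b I) →ₐ[k] CoxRing k a ⧸ I :=
    Ideal.kerLiftAlg (scrollMap b I)
  have hf : Function.Injective f := Ideal.kerLiftAlg_injective _
  let := f.toRingHom.toAlgebra
  have : Algebra.IsIntegral (MvPolynomial (ScrollVar a b) k ⧸ scrollIdeal b I)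
      (CoxRing k a ⧸ I) := by
    refine ⟨fun x => ?_⟩
    obtain ⟨x, rfl⟩ := Ideal.Quotient.mk_surjective x
    induction x using MvPolynomial.induction_on with
    | C c =>
      have : Ideal.Quotient.mk I (C c) =
          algebraMap (MvPolynomial (ScrollVar a b) k ⧸ scrollIdeal b I) _
            (algebraMap k _ c) := (f.commutes c).symm
      rw [this]
      exact isIntegral_algebraMap
    | add p q hp hq => rw [map_add]; exact hp.add hq
    | mul_X p v hp =>
      rw [map_mul]
      refine hp.mul (IsIntegral.of_pow (hb v.1) ?_)
      have : Ideal.Quotient.mk I (X v : CoxRing k a) ^ b v.1 =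
          algebraMap (MvPolynomial (ScrollVar a b) k ⧸ scrollIdeal b I) _
            (Ideal.Quotient.mk _ (X ⟨v.1, ⟨Pi.single v.2 (b v.1), by simp⟩⟩)) := by
        change _ = scrollMap b I (X _)
        rw [scrollMap, aeval_X, ← map_pow]
        congr 1
        rw [Finset.prod_eq_single v.2]
        · simp
        · intro j _ hne
          simp [hne]
        · simp
      rw [this]
      exact isIntegral_algebraMap
  exact ringKrullDim_eq_of_isIntegral hf

end Scroll
end CorrScroll

namespace CorrScroll
open MvPolynomial Filter Topology

section DiagonalSums

/-! ### Sums over the multidegrees on the diagonals -/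

variable {n : ℕ}

/-- A squeeze tolerating a bounded shift of the argument, since `(s / (s + C))^m` tends to `1`. All
comparisons of leading coefficients below go through it. -/
theorem tendsto_div_pow_of_le {f g h : ℕ → ℕ} {C m : ℕ} {x : ℚ}
    (hf : Tendsto (fun s => (f s : ℚ) / (s : ℚ) ^ m) atTop (𝓝 x))
    (hh : Tendsto (fun s => (h s : ℚ) / (s : ℚ) ^ m) atTop (𝓝 x))
    (hfg : ∀ s, f s ≤ g (s + C)) (hgh : ∀ s, g s ≤ h s) :
    Tendsto (fun s => (g s : ℚ) / (s : ℚ) ^ m) atTop (𝓝 x) := by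
  rw [← tendsto_add_atTop_iff_nat C]
  have hone : Tendsto (fun s : ℕ => ((s : ℚ) / (s + C : ℕ)) ^ m) atTop (𝓝 1) := by
    have := (tendsto_natCast_div_add_atTop (𝕜 := ℚ) (C : ℚ)).pow m
    rw [one_pow] at this
    simpa using this
  have hf' := hf.mul hone
  rw [mul_one] at hf'
  refine tendsto_of_tendsto_of_tendsto_of_le_of_le' hf' ((tendsto_add_atTop_iff_nat C).2 hh) ?_ ?_
  · filter_upwards [eventually_gt_atTop 0] with s hs
    have hs' : (s : ℚ) ≠ 0 := by positivity
    have h1 : (f s : ℚ) / (s : ℚ) ^ m * ((s : ℚ) / (s + C : ℕ)) ^ m =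
        (f s : ℚ) / ((s + C : ℕ) : ℚ) ^ m := by
      rw [div_pow]
      field_simp
    rw [h1]
    gcongr
    exact hfg s
  · filter_upwards with s
    gcongr
    exact hgh _

/-- The sum of `H (b * t)` over all `t` with `|t| = s`. -/
noncomputable def diagSum (b : Fin n → ℕ) (H : (Fin n → ℕ) → ℕ) (s : ℕ) : ℕ :=
  ∑ t ∈ Finset.piAntidiag Finset.univ s, H (mulHom b t)

open Classical in
/-- The sum of `H (b * t)` over all `t ≥ c` with `|t| = s`. -/
noncomputable def diagSumFrom (b c : Fin n → ℕ) (H : (Fin n → ℕ) → ℕ) (s : ℕ) : ℕ :=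
  ∑ t ∈ Finset.piAntidiag Finset.univ s with c ≤ t, H (mulHom b t)

variable {b c : Fin n → ℕ} {H H' : (Fin n → ℕ) → ℕ}

theorem diagSumFrom_le (h : ∀ t, c ≤ t → H (mulHom b t) ≤ H' (mulHom b t)) (s : ℕ) :
    diagSumFrom b c H s ≤ diagSum b H' s := by
  classical
  refine (Finset.sum_le_sum fun t ht => h t (Finset.mem_filter.1 ht).2).trans
    (Finset.sum_le_sum_of_subset (Finset.filter_subset _ _))

theorem diagSumFrom_congr (h : ∀ t, c ≤ t → H (mulHom b t) = H' (mulHom b t)) (s : ℕ) :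
    diagSumFrom b c H s = diagSumFrom b c H' s := by
  classical
  exact Finset.sum_congr rfl fun t ht => h t (Finset.mem_filter.1 ht).2

/-- Translation by `c` embeds the diagonal `|t| = s` into the part `t ≥ c` of the diagonal `|t| = s
+ |c|`. -/
theorem diagSum_le_diagSumFrom_add (h : ∀ t, H' (mulHom b t) ≤ H (mulHom b (t + c))) (s : ℕ) :
    diagSum b H' s ≤ diagSumFrom b c H (s + ∑ i, c i) := by
  classical
  refine (Finset.sum_le_sum fun t _ => h t).trans ?_
  refine (Finset.sum_map (Finset.piAntidiag Finset.univ s) (addRightEmbedding c)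
    (fun t => H (mulHom b t))).ge.trans (Finset.sum_le_sum_of_subset fun t ht => ?_)
  obtain ⟨t', ht', rfl⟩ := Finset.mem_map.1 ht
  rw [Finset.mem_piAntidiag] at ht'
  refine Finset.mem_filter.2 ⟨?_, fun i => Nat.le_add_left _ _⟩
  simp [Finset.sum_add_distrib, ht'.1]

theorem diagSum_le_diagSumFrom_add_diagSum (h : ∀ t, ¬ c ≤ t → H (mulHom b t) ≤ H' (mulHom b t))
    (s : ℕ) : diagSum b H s ≤ diagSumFrom b c H s + diagSum b H' s := by
  classical
  rw [diagSum, ← Finset.sum_filter_add_sum_filter_not _ (fun t => c ≤ t)]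
  refine add_le_add (le_of_eq rfl) ?_
  exact (Finset.sum_le_sum fun t ht => h t (Finset.mem_filter.1 ht).2).trans
    (Finset.sum_le_sum_of_subset (Finset.filter_subset _ _))

theorem diagSumFrom_list_sum {ι : Type*} (L : List ι) (g : ι → (Fin n → ℕ) → ℕ) (s : ℕ) :
    diagSumFrom b c (fun t => (L.map fun x => g x t).sum) s =
      (L.map fun x => diagSumFrom b c (g x) s).sum := by
  induction L with
  | nil => simp [diagSumFrom]
  | cons x L ih =>
    simp only [List.map_cons, List.sum_cons]
    rw [← ih, diagSumFrom, diagSumFrom, diagSumFrom, ← Finset.sum_add_distrib]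

end DiagonalSums

section RelevantPrimes

/-! ### Relevant primes of the Cox ring -/

variable {k : Type*} [Field k] {n : ℕ} {a b : Fin n → ℕ}

theorem finiteDimensional_multiDeg (m : Fin n → ℕ) :
    FiniteDimensional k (weightedHomogeneousSubmodule k (multiDeg a) m) :=
  finiteDimensional_blockDeg m

theorem HomIdeal.multiDeg_of_mem_minimalPrimes {J q : Ideal (CoxRing k a)}
    (hJ : HomIdeal (multiDeg a) J) (hq : q ∈ J.minimalPrimes) : HomIdeal (multiDeg a) q :=
  HomIdeal.of_mem_minimalPrimes (primeTest_pi _) finiteDimensional_multiDeg hJ hq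

/-- None of the irrelevant ideals is contained in `p`. -/
def IsRelevant (p : Ideal (CoxRing k a)) : Prop := ∀ i, ¬ irrelevant k a i ≤ p

theorem irrelevant_le_iff_forall {i : Fin n} {p : Ideal (CoxRing k a)} :
    irrelevant k a i ≤ p ↔ ∀ j, (X ⟨i, j⟩ : CoxRing k a) ∈ p := by
  rw [irrelevant, Ideal.span_le, Set.range_subset_iff]
  rfl

theorem IsRelevant.exists_X_notMem {p : Ideal (CoxRing k a)} (hp : IsRelevant p) :
    ∃ j : (i : Fin n) → Fin (a i + 1), ∀ i, (X ⟨i, j i⟩ : CoxRing k a) ∉ p := by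
  have h : ∀ i, ∃ j, (X ⟨i, j⟩ : CoxRing k a) ∉ p := fun i => by
    have := hp i
    rw [irrelevant_le_iff_forall] at this
    push Not at this
    exact this
  choose j hj using h
  exact ⟨j, hj⟩

theorem IsRelevant.of_le {p q : Ideal (CoxRing k a)} (hq : IsRelevant q) (h : p ≤ q) :
    IsRelevant p := fun i hi => hq i (hi.trans h)

theorem isWeightedHomogeneous_prod_X_section (j : (i : Fin n) → Fin (a i + 1)) (e : Fin n → ℕ) :
    IsWeightedHomogeneous (multiDeg a) (∏ i, (X ⟨i, j i⟩ : CoxRing k a) ^ e i) e := by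
  have h : e = ∑ i, e i • multiDeg a ⟨i, j i⟩ := by
    funext i
    simp [multiDeg, Finset.sum_apply, Pi.single_apply]
  conv => arg 3; rw [h]
  exact IsWeightedHomogeneous.prod _ _ _ fun i _ => (isWeightedHomogeneous_X k _ _).pow _

theorem prod_X_section_notMem {p : Ideal (CoxRing k a)} [hp : p.IsPrime]
    {j : (i : Fin n) → Fin (a i + 1)} (hj : ∀ i, (X ⟨i, j i⟩ : CoxRing k a) ∉ p)
    (e : Fin n → ℕ) : (∏ i, (X ⟨i, j i⟩ : CoxRing k a) ^ e i) ∉ p := by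
  rw [Ideal.IsPrime.prod_mem_iff]
  rintro ⟨i, -, hi⟩
  exact hj i (hp.mem_of_pow_mem _ hi)

/-- A relevant prime omits a variable from every block, hence a monomial of every multidegree;
multiplication by the one of multidegree `e` is injective on `A/p`. -/
theorem hilbertFunction_le_add {p : Ideal (CoxRing k a)} [hp : p.IsPrime]
    (hpw : HomIdeal (multiDeg a) p) (hr : IsRelevant p) (t e : Fin n → ℕ) :
    hilbertFunction (multiDeg a) p t ≤ hilbertFunction (multiDeg a) p (t + e) := by
  obtain ⟨j, hj⟩ := hr.exists_X_notMem
  rw [hilbertFunction_add finiteDimensional_multiDeg hpw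
    (isWeightedHomogeneous_prod_X_section j e), colonElem_eq_self (prod_X_section_notMem hj e)]
  exact Nat.le_add_left _ _

theorem hilbertFunction_eq_zero_of_irrelevant_le {p : Ideal (CoxRing k a)} {i : Fin n}
    (hi : irrelevant k a i ≤ p) {t : Fin n → ℕ} (ht : 0 < t i) :
    hilbertFunction (multiDeg a) p t = 0 := by
  rw [hilbertFunction_eq_zero_iff finiteDimensional_multiDeg]
  intro f hf
  rw [f.as_sum]
  refine p.sum_mem fun d hd => ?_
  have h1 := congrFun (hf (mem_support_iff.1 hd)) i
  rw [weight_multiDeg_apply] at h1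
  obtain ⟨j, -, hj⟩ := Finset.exists_ne_zero_of_sum_ne_zero (h1.trans_ne ht.ne')
  refine p.mem_of_dvd ?_ (irrelevant_le_iff_forall.1 hi j)
  rw [X_dvd_monomial]
  exact Or.inr hj

/-- The diagonal sum is the Hilbert function of the scroll, which is standard graded, so the theory
of Hilbert polynomials in one variable is enough. -/
theorem exists_hilbertPoly_diagSum (hb : ∀ i, 0 < b i) {J : Ideal (CoxRing k a)}
    (hJ : HomIdeal (multiDeg a) J) : ∃ P : Polynomial ℚ,
      (∀ᶠ s : ℕ in atTop,
        (diagSum b (hilbertFunction (multiDeg a) J) s : ℚ) = P.eval (s : ℚ)) ∧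
      ∀ m : ℕ, ringKrullDim (CoxRing k a ⧸ J) ≤ m ↔ P.degree < m := by
  obtain ⟨P, hP, hdeg⟩ := exists_isHilbertPoly (homIdeal_scrollIdeal hb hJ).of_blockDeg
  refine ⟨P, ?_, ?_⟩
  · filter_upwards [hP] with s hs
    rw [← hs, hilbertFunction_scrollIdeal hb hJ]
    rfl
  · intro m
    rw [ringKrullDim_scrollIdeal hb, hdeg]

variable (b) in
open Classical in
/-- The coefficient of `s ^ m` in the Hilbert polynomial of the scroll of the subvariety `p`,
if the latter has dimension at most `m`. -/
noncomputable def leadCoeff (m : ℕ) (p : Ideal (CoxRing k a)) : ℚ :=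
  if quotDim p ≤ m + 1 then
    limUnder atTop fun s : ℕ => (diagSum b (hilbertFunction (multiDeg a) p) s : ℚ) / (s : ℚ) ^ m
  else 0

theorem tendsto_diagSum (hb : ∀ i, 0 < b i) {p : Ideal (CoxRing k a)} (hp : p ≠ ⊤)
    (hpw : HomIdeal (multiDeg a) p) {m : ℕ} (hm : quotDim p ≤ m + 1) :
    Tendsto (fun s : ℕ => (diagSum b (hilbertFunction (multiDeg a) p) s : ℚ) / (s : ℚ) ^ m)
      atTop (𝓝 (leadCoeff b m p)) := by
  obtain ⟨P, hP, hdeg⟩ := exists_hilbertPoly_diagSum hb hpw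
  rw [leadCoeff, if_pos hm]
  refine tendsto_nhds_limUnder ⟨P.coeff m, ?_⟩
  refine (tendsto_eval_div_pow ((hdeg _).1 ((quotDim_le_iff hp).1 hm))).congr' ?_
  filter_upwards [hP] with s hs
  rw [hs]

/-- In too small a dimension the Hilbert polynomial has degree below `m`; in too large a dimension
the default value in the definition applies. -/
theorem leadCoeff_eq_zero (hb : ∀ i, 0 < b i) {p : Ideal (CoxRing k a)} (hp : p ≠ ⊤)
    (hpw : HomIdeal (multiDeg a) p) {m : ℕ} (hm : quotDim p ≠ m + 1) :
    leadCoeff b m p = 0 := by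
  rcases lt_or_gt_of_ne hm with h | h
  · obtain ⟨P, hP, hdeg⟩ := exists_hilbertPoly_diagSum hb hpw
    refine tendsto_nhds_unique (tendsto_diagSum hb hp hpw h.le) ?_
    have h1 := (hdeg _).1 ((quotDim_le_iff hp).1 h.le)
    have h2 := (hdeg _).1 ((quotDim_le_iff hp).1 (Nat.lt_succ_iff.1 h))
    rw [← Polynomial.coeff_eq_zero_of_degree_lt h2]
    refine (tendsto_eval_div_pow h1).congr' ?_
    filter_upwards [hP] with s hs
    rw [hs]
  · rw [leadCoeff, if_neg (by omega)]

/-- By monotonicity of the Hilbert function along `A/p`, shifting by `u` and truncating at `c` move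
the diagonal sum only between its values at `s - |c|` and at `s`. -/
theorem tendsto_diagSumFrom_shiftFun (hb : ∀ i, 0 < b i) {p : Ideal (CoxRing k a)} [hp : p.IsPrime]
    (hpw : HomIdeal (multiDeg a) p) (hr : IsRelevant p) {m : ℕ} (hm : quotDim p ≤ m + 1)
    {c u : Fin n → ℕ} (hc : u ≤ mulHom b c) :
    Tendsto (fun s : ℕ => (diagSumFrom b c (shiftFun (hilbertFunction (multiDeg a) p) u) s : ℚ) /
      (s : ℚ) ^ m) atTop (𝓝 (leadCoeff b m p)) := by
  refine tendsto_div_pow_of_le (C := ∑ i, c i) (tendsto_diagSum hb hp.ne_top hpw hm)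
    (tendsto_diagSum hb hp.ne_top hpw hm) (fun s => diagSum_le_diagSumFrom_add (fun t => ?_) s)
    (fun s => diagSumFrom_le (fun t _ => ?_) s)
  · have : mulHom b (t + c) = mulHom b t + (mulHom b c - u) + u := by
      rw [add_assoc, tsub_add_cancel_of_le hc, map_add]
    rw [this, shiftFun_add]
    exact hilbertFunction_le_add hpw hr _ _
  · by_cases h : ∃ m', mulHom b t = m' + u
    · obtain ⟨t', ht'⟩ := h
      rw [ht', shiftFun_add]
      exact hilbertFunction_le_add hpw hr _ _
    · rw [shiftFun_eq_zero _ h]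
      exact Nat.zero_le _

theorem le_mulHom (hb : ∀ i, 0 < b i) (c : Fin n → ℕ) : c ≤ mulHom b c :=
  fun i => Nat.le_mul_of_pos_left _ (hb i)

theorem shiftFun_eq_zero_of_irrelevant_le {p : Ideal (CoxRing k a)} {i : Fin n}
    (hi : irrelevant k a i ≤ p) {u t : Fin n → ℕ} (ht : u i < t i) :
    shiftFun (hilbertFunction (multiDeg a) p) u t = 0 := by
  by_cases h : ∃ t', t = t' + u
  · obtain ⟨t', rfl⟩ := h
    rw [shiftFun_add]
    exact hilbertFunction_eq_zero_of_irrelevant_le hi (by simpa using ht)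
  · exact shiftFun_eq_zero _ h

-- Irrelevant factors vanish on the degrees `t ≥ c`, and relevant factors whose prime is not minimal
-- have too small a dimension to reach order `s^m`.
open Classical in
theorem tendsto_diagSumFrom_of_isPrimeFiltration (hb : ∀ i, 0 < b i)
    {J : Ideal (CoxRing k a)} {L : List (Ideal (CoxRing k a) × (Fin n → ℕ))}
    (hL : IsPrimeFiltration (multiDeg a) J L) {m : ℕ}
    (hm : ∀ q ∈ J.minimalPrimes, IsRelevant q → quotDim q ≤ m + 1) {c : Fin n → ℕ}
    (hc : ∀ x ∈ L, x.2 + 1 ≤ c) :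
    Tendsto (fun s : ℕ => (diagSumFrom b c (hilbertFunction (multiDeg a) J) s : ℚ) /
      (s : ℚ) ^ m) atTop (𝓝 (L.map fun x =>
        if x.1 ∈ J.minimalPrimes ∧ IsRelevant x.1 then leadCoeff b m x.1 else 0).sum) := by
  have h1 : ∀ s : ℕ, (diagSumFrom b c (hilbertFunction (multiDeg a) J) s : ℚ) / (s : ℚ) ^ m =
      (L.map fun x =>
        (diagSumFrom b c (shiftFun (hilbertFunction (multiDeg a) x.1) x.2) s : ℚ) /
          (s : ℚ) ^ m).sum := by
    intro s
    have h2 : diagSumFrom b c (hilbertFunction (multiDeg a) J) s = (L.map fun x =>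
        diagSumFrom b c (shiftFun (hilbertFunction (multiDeg a) x.1) x.2) s).sum := by
      rw [← diagSumFrom_list_sum]
      exact diagSumFrom_congr (fun t _ => hL.hilbertFunction_eq _) s
    rw [h2, Nat.cast_list_sum, List.map_map, div_eq_mul_inv, ← List.sum_map_mul_right]
    rfl
  refine Tendsto.congr (fun s => (h1 s).symm) ?_
  refine tendsto_list_sum L fun x hx => ?_
  have hxp := hL.isPrime x hx
  have hxw := hL.homIdeal x hx
  have hxc : x.2 + 1 ≤ mulHom b c := (hc x hx).trans (le_mulHom hb c)
  by_cases hr : IsRelevant x.1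
  · obtain ⟨q, hq, hqx⟩ := Ideal.exists_minimalPrimes_le (hL.le x hx)
    have hqp := hq.1.1
    have hqd := hm q hq (hr.of_le hqx)
    have hle : quotDim x.1 ≤ quotDim q := by
      rcases hqx.eq_or_lt with h | h
      · rw [h]
      · exact (quotDim_lt_of_lt h).le
    have h2 := tendsto_diagSumFrom_shiftFun hb hxw hr (hle.trans hqd)
      (le_self_add.trans hxc)
    convert h2 using 2
    split_ifs with h
    · rfl
    · symm
      apply leadCoeff_eq_zero hb hxp.ne_top hxw
      have hlt : q < x.1 := lt_of_le_of_ne hqx fun h' => h ⟨h' ▸ hq, hr⟩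
      have := quotDim_lt_of_lt hlt
      omega
  · rw [if_neg (fun h => hr h.2)]
    unfold IsRelevant at hr
    push Not at hr
    obtain ⟨i, hi⟩ := hr
    -- The summand `1` in `x.2 + 1 ≤ c` makes the `i`-th entry of the unshifted degree positive,
    -- where `A/x.1` is zero.
    have h3 : ∀ s, diagSumFrom b c (shiftFun (hilbertFunction (multiDeg a) x.1) x.2) s = 0 := by
      refine fun s => Finset.sum_eq_zero fun t ht => shiftFun_eq_zero_of_irrelevant_le hi ?_
      have h4 : c i ≤ t i := (Finset.mem_filter.1 ht).2 i
      have h5 := hc x hx i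
      have h6 : t i ≤ mulHom b t i := le_mulHom hb t i
      simp only [Pi.add_apply, Pi.one_apply] at h5
      omega
    simp [h3]

end RelevantPrimes
end CorrScroll

namespace CorrScroll
open MvPolynomial Filter Topology

section CycleDegree

/-! ### The degree of cycles -/

variable {k : Type*} [Field k] {n : ℕ} {a b : Fin n → ℕ}

theorem MultiProj.isPrime (p : MultiProj k a) : p.1.asIdeal.IsPrime := p.1.2

theorem MultiProj.homIdeal (p : MultiProj k a) : HomIdeal (multiDeg a) p.1.asIdeal :=
  isMultigraded_iff_homIdeal.1 p.2.1

theorem MultiProj.isRelevant (p : MultiProj k a) : IsRelevant p.1.asIdeal := p.2.2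

theorem exists_multiProj_eq {p : Ideal (CoxRing k a)} (hp : p.IsPrime)
    (hpw : HomIdeal (multiDeg a) p) (hr : IsRelevant p) :
    ∃ x : MultiProj k a, x.1.asIdeal = p :=
  ⟨⟨⟨p, hp⟩, isMultigraded_iff_homIdeal.2 hpw, hr⟩, rfl⟩

theorem MultiProj.asIdeal_injective :
    Function.Injective fun p : MultiProj k a => p.1.asIdeal :=
  fun _ _ h => Subtype.ext (PrimeSpectrum.ext h)

theorem fundamentalCycle_apply (J : Ideal (CoxRing k a)) (p : MultiProj k a) :
    fundamentalCycle J p = (componentMultiplicity J p : ℤ) := rfl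

variable (k a b) in
/-- The linear extension of `leadCoeff` to cycles. -/
noncomputable def cycleDegree (m : ℕ) : Cycles k a →+ ℚ :=
  Finsupp.liftAddHom fun p => (AddMonoidHom.mulRight (leadCoeff b m p.1.asIdeal)).comp
    (Int.castAddHom ℚ)

theorem cycleDegree_apply (m : ℕ) (c : Cycles k a) :
    cycleDegree k a b m c = ∑ p ∈ c.support, (c p : ℚ) * leadCoeff b m p.1.asIdeal := rfl

theorem cycleDegree_fundamentalCycle_eq_zero {m : ℕ} {J : Ideal (CoxRing k a)}
    (h : ∀ p : MultiProj k a, p.1.asIdeal ∈ J.minimalPrimes → leadCoeff b m p.1.asIdeal = 0) :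
    cycleDegree k a b m (fundamentalCycle J) = 0 := by
  rw [cycleDegree_apply]
  refine Finset.sum_eq_zero fun p hp => ?_
  by_cases hpJ : p.1.asIdeal ∈ J.minimalPrimes
  · rw [h p hpJ, mul_zero]
  · rw [fundamentalCycle_apply, componentMultiplicity, if_neg hpJ]
    simp

-- A relevant minimal prime occurs in the filtration as often as its multiplicity in the fundamental
-- cycle, so grouping equal primes gives the claim.
open Classical in
theorem cycleDegree_fundamentalCycle {m : ℕ} {J : Ideal (CoxRing k a)}
    {L : List (Ideal (CoxRing k a) × (Fin n → ℕ))}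
    (hL : IsPrimeFiltration (multiDeg a) J L) :
    cycleDegree k a b m (fundamentalCycle J) = (L.map fun x =>
      if x.1 ∈ J.minimalPrimes ∧ IsRelevant x.1 then leadCoeff b m x.1 else 0).sum := by
  have h1 : (L.map fun x =>
      if x.1 ∈ J.minimalPrimes ∧ IsRelevant x.1 then leadCoeff b m x.1 else 0) =
      (L.map Prod.fst).map fun q =>
        if q ∈ J.minimalPrimes ∧ IsRelevant q then leadCoeff b m q else 0 := by
    rw [List.map_map]
    rfl
  have hcount : ∀ p : MultiProj k a, p.1.asIdeal ∈ J.minimalPrimes →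
      fundamentalCycle J p = ((L.map Prod.fst).count p.1.asIdeal : ℤ) := by
    intro p hp
    have hpp := p.isPrime
    have h2 : componentMultiplicity J p = (localLength p.1.asIdeal J).toNat := by
      rw [componentMultiplicity, if_pos hp]
      rfl
    rw [fundamentalCycle_apply, h2, hL.localLength_eq_count hp, ENat.toNat_natCast, List.count,
      List.countP_map]
    congr 2
  rw [h1, Finset.sum_list_map_count, cycleDegree_apply]
  have hmin : ∀ p : MultiProj k a, p ∈ (fundamentalCycle J).support →
      p.1.asIdeal ∈ J.minimalPrimes := by
    intro p hp
    by_contra h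
    rw [Finsupp.mem_support_iff, fundamentalCycle_apply, componentMultiplicity, if_neg h] at hp
    exact hp rfl
  refine Finset.sum_bij_ne_zero (fun p _ _ => p.1.asIdeal) ?_ ?_ ?_ ?_
  · intro p hp _
    obtain ⟨x, hx, hxp⟩ := hL.exists_mem_of_mem_minimalPrimes (hmin p hp)
    rw [List.mem_toFinset, ← hxp]
    exact List.mem_map_of_mem hx
  · intro p _ _ q _ _ h
    exact MultiProj.asIdeal_injective h
  · intro q hq hne
    have hq' : q ∈ J.minimalPrimes ∧ IsRelevant q := by
      by_contra h
      rw [if_neg h, smul_zero] at hne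
      exact hne rfl
    obtain ⟨x, hx, rfl⟩ := List.mem_map.1 (List.mem_toFinset.1 hq)
    obtain ⟨p, hp⟩ := exists_multiProj_eq (hL.isPrime x hx) (hL.homIdeal x hx) hq'.2
    have h3 : fundamentalCycle J p ≠ 0 := by
      rw [hcount p (hp ▸ hq'.1), hp]
      intro h0
      have h0' : (L.map Prod.fst).count x.1 = 0 := by exact_mod_cast h0
      rw [h0', zero_smul] at hne
      exact hne rfl
    refine ⟨p, Finsupp.mem_support_iff.2 h3, ?_, hp⟩
    intro h0
    rw [if_pos hq'] at hne
    rw [hp] at h0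
    rcases mul_eq_zero.1 h0 with h | h
    · exact h3 (by exact_mod_cast h)
    · rw [h, smul_zero] at hne
      exact hne rfl
  · intro p hp _
    rw [if_pos ⟨hmin p hp, p.isRelevant⟩, hcount p (hmin p hp), nsmul_eq_mul]
    norm_cast

/-- Every `c` beyond a bound is allowed, so that two ideals can be compared with a common
truncation. -/
theorem exists_forall_tendsto_diagSumFrom (hb : ∀ i, 0 < b i) {J : Ideal (CoxRing k a)}
    (hJ : HomIdeal (multiDeg a) J) {m : ℕ}
    (hm : ∀ q ∈ J.minimalPrimes, IsRelevant q → quotDim q ≤ m + 1) :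
    ∃ c₀ : Fin n → ℕ, ∀ c, c₀ ≤ c →
      Tendsto (fun s : ℕ => (diagSumFrom b c (hilbertFunction (multiDeg a) J) s : ℚ) /
        (s : ℚ) ^ m) atTop (𝓝 (cycleDegree k a b m (fundamentalCycle J))) := by
  classical
  obtain ⟨L, hL⟩ := exists_isPrimeFiltration (primeTest_pi _) finiteDimensional_multiDeg hJ
  refine ⟨(L.map Prod.snd).sum + 1, fun c hc => ?_⟩
  rw [cycleDegree_fundamentalCycle hL]
  refine tendsto_diagSumFrom_of_isPrimeFiltration hb hL hm fun x hx => le_trans ?_ hc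
  gcongr
  exact List.le_sum_of_mem (List.mem_map_of_mem hx)

/-- With `g` and `h` of the same multidegree `e`, both `W + (g)` and `W + (h)` have Hilbert function
`H_W` minus its shift by `e`, so their truncated diagonal sums have the same limit. -/
theorem rationallyTrivial_le_ker_cycleDegree (hb : ∀ i, 0 < b i) (m : ℕ) :
    rationallyTrivial k a ≤ (cycleDegree k a b m).ker := by
  rw [rationallyTrivial, AddSubgroup.closure_le]
  rintro _ ⟨W, e, g, h, hg, hh, hgW, hhW, rfl⟩
  have hWp := W.isPrime
  rw [SetLike.mem_coe, AddMonoidHom.mem_ker, map_sub, sub_eq_zero]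
  have hdim : ∀ f : CoxRing k a, f ∉ W.1.asIdeal → ∀ q ∈ (W.1.asIdeal ⊔ Ideal.span {f}).minimalPrimes,
      quotDim q + 1 = quotDim W.1.asIdeal := fun f hf q hq =>
    quotDim_add_one_of_mem_minimalPrimes hf hq
  -- Every component of either section has quotient dimension one less than that of `W`. Only `m +
  -- 2` gives sections that `leadCoeff b m` sees; otherwise both cycles map to zero.
  by_cases hW : quotDim W.1.asIdeal = m + 2
  · obtain ⟨c₁, h₁⟩ := exists_forall_tendsto_diagSumFrom (m := m) hb
      (W.homIdeal.sup_span_singleton hg) fun q hq _ => by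
        have := hdim g hgW q hq
        omega
    obtain ⟨c₂, h₂⟩ := exists_forall_tendsto_diagSumFrom (m := m) hb
      (W.homIdeal.sup_span_singleton hh) fun q hq _ => by
        have := hdim h hhW q hq
        omega
    have heq : hilbertFunction (multiDeg a) (W.1.asIdeal ⊔ Ideal.span {g}) =
        hilbertFunction (multiDeg a) (W.1.asIdeal ⊔ Ideal.span {h}) := by
      funext t
      have e₁ := hilbertFunction_eq_add_shiftFun finiteDimensional_multiDeg W.homIdeal hg t
      have e₂ := hilbertFunction_eq_add_shiftFun finiteDimensional_multiDeg W.homIdeal hh t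
      rw [colonElem_eq_self hgW] at e₁
      rw [colonElem_eq_self hhW] at e₂
      omega
    have t₁ := h₁ (c₁ ⊔ c₂) le_sup_left
    have t₂ := h₂ (c₁ ⊔ c₂) le_sup_right
    rw [heq] at t₁
    exact tendsto_nhds_unique t₁ t₂
  · rw [cycleDegree_fundamentalCycle_eq_zero, cycleDegree_fundamentalCycle_eq_zero]
    · intro p hp
      refine leadCoeff_eq_zero hb p.isPrime.ne_top p.homIdeal ?_
      have := hdim h hhW _ hp
      omega
    · intro p hp
      refine leadCoeff_eq_zero hb p.isPrime.ne_top p.homIdeal ?_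
      have := hdim g hgW _ hp
      omega

theorem cycleDegree_eq_of_chowClass_eq (hb : ∀ i, 0 < b i) (m : ℕ) {ι : Type*} [Fintype ι]
    {I : Ideal (CoxRing k a)} {J : ι → Ideal (CoxRing k a)} {r : ι → ℤ}
    (h : chowClass I = ∑ α, r α • chowClass (J α)) :
    cycleDegree k a b m (fundamentalCycle I) =
      ∑ α, (r α : ℚ) * cycleDegree k a b m (fundamentalCycle (J α)) := by
  let F : Chow k a →+ ℚ := QuotientAddGroup.lift _ (cycleDegree k a b m)
    (rationallyTrivial_le_ker_cycleDegree hb m)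
  have hF : ∀ K, F (chowClass K) = cycleDegree k a b m (fundamentalCycle K) := fun K => rfl
  rw [← hF, h, map_sum]
  refine Finset.sum_congr rfl fun α _ => ?_
  rw [map_zsmul, hF, zsmul_eq_mul]

/-! ### Saturated ideals -/

theorem NoIrrelevantComponent.isRelevant {I q : Ideal (CoxRing k a)}
    (hI : NoIrrelevantComponent I) (hq : q ∈ I.minimalPrimes) : IsRelevant q := by
  refine hI q ?_
  refine Module.associatedPrimes.minimalPrimes_annihilator_subset_associatedPrimes _ _ ?_
  rwa [Ideal.annihilator_quotient]

variable (k a) in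
/-- The ideal generated by the forms of multidegree at least `c`. -/
noncomputable def truncIdeal (c : Fin n → ℕ) : Ideal (CoxRing k a) :=
  Ideal.span {f | ∃ e, c ≤ e ∧ IsWeightedHomogeneous (multiDeg a) f e}

theorem homIdeal_truncIdeal (c : Fin n → ℕ) : HomIdeal (multiDeg a) (truncIdeal k a c) :=
  HomIdeal.span_of_isWeightedHomogeneous fun _ ⟨e, _, he⟩ => ⟨e, he⟩

theorem not_isRelevant_of_truncIdeal_le {c : Fin n → ℕ} {p : Ideal (CoxRing k a)} [p.IsPrime]
    (h : truncIdeal k a c ≤ p) : ¬ IsRelevant p := by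
  intro hr
  obtain ⟨j, hj⟩ := hr.exists_X_notMem
  exact prod_X_section_notMem hj c (h (Ideal.subset_span
    ⟨c, le_rfl, isWeightedHomogeneous_prod_X_section j c⟩))

/-- The added ideal has no components outside the degrees `≥ c`. It therefore isolates the degrees
that the truncated sums leave out. -/
theorem hilbertFunction_sup_truncIdeal {I : Ideal (CoxRing k a)} (hI : HomIdeal (multiDeg a) I)
    {c t : Fin n → ℕ} (ht : ¬ c ≤ t) :
    hilbertFunction (multiDeg a) (I ⊔ truncIdeal k a c) t = hilbertFunction (multiDeg a) I t := by
  refine hilbertFunction_eq_of_degreePart_eq finiteDimensional_multiDeg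
    (le_antisymm ?_ (degreePart_mono le_sup_left t))
  rintro x ⟨hx, hxt⟩
  refine ⟨?_, hxt⟩
  obtain ⟨y, hy, z, hz, rfl⟩ := Submodule.mem_sup.1 hx
  have hz0 : ∀ g, weightedHomogeneousComponent (multiDeg a) t (z * g) = 0 := by
    refine Submodule.span_induction
      (p := fun z _ => ∀ g, weightedHomogeneousComponent (multiDeg a) t (z * g) = 0)
      ?_ ?_ ?_ ?_ hz
    · rintro z ⟨e, hce, he⟩
      refine weightedHomogeneousComponent_mul_eq_zero he ?_
      rintro ⟨m', rfl⟩
      exact ht (hce.trans le_add_self)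
    · simp
    · intro x y _ _ hx hy g
      rw [add_mul, map_add, hx, hy, add_zero]
    · intro r x _ hx g
      rw [smul_eq_mul, mul_comm r, mul_assoc]
      exact hx _
  specialize hz0 1
  rw [mul_one] at hz0
  rw [← weightedHomogeneousComponent_eq_self hxt, map_add, hz0, add_zero]
  exact hI y hy t

/-- On the degrees missed by the truncation, `I` agrees with `I` plus all forms of multidegree at
least `b c`. The zero locus of the latter contains no component of `Spec A/I`, so its dimension is
at most `m` and its diagonal sum is of lower order than `s^m`. -/
theorem tendsto_diagSum_of_noIrrelevantComponent (hb : ∀ i, 0 < b i) {I : Ideal (CoxRing k a)}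
    (hI : HomIdeal (multiDeg a) I) (hI' : NoIrrelevantComponent I) {m : ℕ}
    (hm : ringKrullDim (CoxRing k a ⧸ I) ≤ (m + 1 : ℕ)) :
    Tendsto (fun s : ℕ => (diagSum b (hilbertFunction (multiDeg a) I) s : ℚ) / (s : ℚ) ^ m) atTop
      (𝓝 (cycleDegree k a b m (fundamentalCycle I))) := by
  obtain ⟨c, hc⟩ := exists_forall_tendsto_diagSumFrom (m := m) hb hI fun q hq _ => by
    rw [quotDim_le_iff hq.1.1.ne_top]
    exact ringKrullDim_quotient_le_iff_minimalPrimes.1 hm q hq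
  have hc := hc c le_rfl
  have hJ : HomIdeal (multiDeg a) (I ⊔ truncIdeal k a (mulHom b c)) :=
    hI.sup (homIdeal_truncIdeal _)
  have hJm : ringKrullDim (CoxRing k a ⧸ (I ⊔ truncIdeal k a (mulHom b c))) ≤ m := by
    rw [ringKrullDim_quotient_le_iff]
    intro p hp hle
    obtain ⟨q, hq, hqp⟩ := Ideal.exists_minimalPrimes_le (le_sup_left.trans hle)
    have hqp' := hq.1.1
    -- The prime `p` is irrelevant because it contains all large degrees, while the minimal prime
    -- `q` of `I` is relevant.
    have hlt : q < p := lt_of_le_of_ne hqp fun h =>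
      not_isRelevant_of_truncIdeal_le (le_sup_right.trans hle) (h ▸ hI'.isRelevant hq)
    have h1 := quotDim_lt_of_lt hlt
    have h2 := (quotDim_le_iff hq.1.1.ne_top).2
      (ringKrullDim_quotient_le_iff_minimalPrimes.1 hm q hq)
    rw [← quotDim_le_iff hp.ne_top]
    omega
  obtain ⟨P, hP, hdeg⟩ := exists_hilbertPoly_diagSum hb hJ
  have hPm := (hdeg m).1 hJm
  have hzero : Tendsto (fun s : ℕ =>
      (diagSum b (hilbertFunction (multiDeg a) (I ⊔ truncIdeal k a (mulHom b c))) s : ℚ) /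
        (s : ℚ) ^ m) atTop (𝓝 0) := by
    rw [← Polynomial.coeff_eq_zero_of_degree_lt hPm]
    refine (tendsto_eval_div_pow (hPm.trans ?_)).congr' ?_
    · exact_mod_cast m.lt_succ_self
    · filter_upwards [hP] with s hs
      rw [hs]
  have hsum := hc.add hzero
  rw [add_zero] at hsum
  refine tendsto_of_tendsto_of_tendsto_of_le_of_le hc hsum (fun s => ?_) fun s => ?_
  · have : diagSumFrom b c (hilbertFunction (multiDeg a) I) s ≤
        diagSum b (hilbertFunction (multiDeg a) I) s := diagSumFrom_le (fun _ _ => le_rfl) s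
    simp only
    gcongr
  · have : diagSum b (hilbertFunction (multiDeg a) I) s ≤
        diagSumFrom b c (hilbertFunction (multiDeg a) I) s +
        diagSum b (hilbertFunction (multiDeg a) (I ⊔ truncIdeal k a (mulHom b c))) s := by
      refine diagSum_le_diagSumFrom_add_diagSum (fun t ht => ?_) s
      rw [hilbertFunction_sup_truncIdeal hI]
      intro h
      exact ht fun i => Nat.le_of_mul_le_mul_left (h i) (hb i)
    simp only
    rw [← add_div]
    gcongr
    exact_mod_cast this

end CycleDegree
end CorrScroll

namespace CorrScroll
open MvPolynomial Filter Topology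

section CoordinateIdeals

/-! ### Ideals generated by variables -/

variable {k σ M : Type*} [Field k]

variable (k) in
/-- The ideal generated by the variables outside of `s`. -/
noncomputable def coordIdeal (s : Finset σ) : Ideal (MvPolynomial σ k) :=
  Ideal.span (X '' {v | v ∉ s})

-- Setting the variables outside `s` to zero is a retraction with this kernel, from which primality
-- and the membership of variables can be read.
open Classical in
theorem coordIdeal_eq_ker (s : Finset σ) : coordIdeal k s =
    RingHom.ker (aeval fun v => if v ∈ s then X v else 0 :
      MvPolynomial σ k →ₐ[k] MvPolynomial σ k) := by
  set φ : MvPolynomial σ k →ₐ[k] MvPolynomial σ k := aeval fun v => if v ∈ s then X v else 0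
    with hφ
  apply le_antisymm
  · rw [coordIdeal, Ideal.span_le]
    rintro _ ⟨v, hv, rfl⟩
    rw [SetLike.mem_coe, RingHom.mem_ker, hφ, aeval_X, if_neg hv]
  · intro f hf
    have h : (Ideal.Quotient.mkₐ k (coordIdeal k s)).comp φ =
        Ideal.Quotient.mkₐ k (coordIdeal k s) := by
      apply MvPolynomial.algHom_ext
      intro v
      rw [AlgHom.comp_apply, hφ, aeval_X]
      split_ifs with h
      · rfl
      · rw [map_zero]
        exact (Ideal.Quotient.eq_zero_iff_mem.2
          (Ideal.subset_span (Set.mem_image_of_mem X h))).symm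
    have h1 := DFunLike.congr_fun h f
    rw [AlgHom.comp_apply, (RingHom.mem_ker).1 hf, map_zero] at h1
    exact Ideal.Quotient.eq_zero_iff_mem.1 h1.symm

instance coordIdeal_isPrime (s : Finset σ) : (coordIdeal k s).IsPrime := by
  classical
  rw [coordIdeal_eq_ker]
  exact RingHom.ker_isPrime _

theorem X_mem_coordIdeal {s : Finset σ} {v : σ} :
    (X v : MvPolynomial σ k) ∈ coordIdeal k s ↔ v ∉ s := by
  classical
  rw [coordIdeal_eq_ker, RingHom.mem_ker, aeval_X]
  split_ifs with h <;> simp [h]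

theorem coordIdeal_insert_sup [DecidableEq σ] {s : Finset σ} {v : σ} (hv : v ∉ s) :
    coordIdeal k (insert v s) ⊔ Ideal.span {X v} = coordIdeal k s := by
  rw [coordIdeal, coordIdeal, ← Ideal.span_union, ← Set.image_singleton, ← Set.image_union]
  congr 2
  ext u
  simp only [Finset.mem_insert, Set.mem_union, Set.mem_ofPred_eq, Set.mem_singleton_iff]
  by_cases h : u = v
  · simp [h, hv]
  · simp [h]

variable [AddCommMonoid M] {w : σ → M}

theorem homIdeal_coordIdeal [IsCancelAdd M] (s : Finset σ) : HomIdeal w (coordIdeal k s) :=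
  HomIdeal.span_of_isWeightedHomogeneous fun _ ⟨v, _, hv⟩ =>
    ⟨w v, hv ▸ isWeightedHomogeneous_X k w v⟩

variable (hfin : ∀ m, FiniteDimensional k (weightedHomogeneousSubmodule k w m))

include hfin

theorem hilbertFunction_coordIdeal_insert [IsCancelAdd M] [DecidableEq σ] {s : Finset σ} {v : σ}
    (hv : v ∉ s) (m : M) :
    hilbertFunction w (coordIdeal k (insert v s)) m = hilbertFunction w (coordIdeal k s) m +
      shiftFun (hilbertFunction w (coordIdeal k (insert v s))) (w v) m := by
  have h := hilbertFunction_eq_add_shiftFun hfin (homIdeal_coordIdeal (k := k) (insert v s))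
    (isWeightedHomogeneous_X k w v) m
  rwa [coordIdeal_insert_sup hv, colonElem_eq_self
    (fun h => X_mem_coordIdeal.1 h (Finset.mem_insert_self v s))] at h

omit hfin in
theorem hilbertFunction_zero_eq_one (hw : ∀ d : σ →₀ ℕ, Finsupp.weight w d = 0 → d = 0)
    {J : Ideal (MvPolynomial σ k)} (hJ : J ≠ ⊤) : hilbertFunction w J 0 = 1 := by
  classical
  have h1 : Ideal.Quotient.mk J 1 ≠ 0 := by
    rw [Ne, Ideal.Quotient.eq_zero_iff_mem]
    exact fun h => hJ ((Ideal.eq_top_iff_one J).2 h)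
  have h2 : (weightedHomogeneousSubmodule k w 0).map (Ideal.Quotient.mkₐ k J).toLinearMap =
      Submodule.span k {Ideal.Quotient.mk J 1} := by
    apply le_antisymm
    · rintro _ ⟨f, hf, rfl⟩
      have : f = C (coeff 0 f) := by
        ext d
        rw [coeff_C]
        split_ifs with h
        · rw [h]
        · by_contra hd
          exact h (hw d (hf hd)).symm
      rw [Submodule.mem_span_singleton]
      refine ⟨coeff 0 f, ?_⟩
      conv_rhs => rw [this]
      exact congrArg (Ideal.Quotient.mk J)
        (by rw [smul_eq_C_mul, mul_one] : coeff 0 f • (1 : MvPolynomial σ k) = C (coeff 0 f))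
    · rw [Submodule.span_singleton_le_iff_mem]
      exact ⟨1, isWeightedHomogeneous_one k w, rfl⟩
  rw [hilbertFunction, h2, finrank_span_singleton h1]

theorem hilbertFunction_coordIdeal_empty_of_ne_zero {m : M} (hm : m ≠ 0) :
    hilbertFunction w (coordIdeal k (∅ : Finset σ)) m = 0 := by
  rw [hilbertFunction_eq_zero_iff hfin]
  intro f hf
  refine mem_of_forall_X_mem (fun v => X_mem_coordIdeal.2 (Finset.notMem_empty v)) ?_
  by_contra h
  have := hf h
  rw [map_zero] at this
  exact hm this.symm

omit hfin

/-- The exact sequence for one more variable is Pascal's rule for multiset numbers. -/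
theorem hilbertFunction_one_coordIdeal [Finite σ] (s : Finset σ) (t : ℕ) :
    hilbertFunction (fun _ => (1 : ℕ)) (coordIdeal k s) t = Nat.multichoose s.card t := by
  classical
  have hfin := finiteDimensional_weightedHomogeneousSubmodule_one (k := k) (σ := σ)
  induction s using Finset.induction_on generalizing t with
  | empty =>
    cases t with
    | zero => simp [hilbertFunction_zero_eq_one weight_one_eq_zero
        (coordIdeal_isPrime (k := k) (∅ : Finset σ)).ne_top]
    | succ t => simp [hilbertFunction_coordIdeal_empty_of_ne_zero hfin]
  | insert v s hv ih =>
    rw [Finset.card_insert_of_notMem hv]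
    induction t with
    | zero => simp [hilbertFunction_zero_eq_one weight_one_eq_zero
        (coordIdeal_isPrime (k := k) (insert v s)).ne_top]
    | succ t iht =>
      rw [hilbertFunction_coordIdeal_insert hfin hv, ih, Nat.multichoose_succ_succ, ← iht,
        shiftFun_add]

variable {n : ℕ} {a b : Fin n → ℕ}

theorem weight_multiDeg_eq_zero (d : (Σ i : Fin n, Fin (a i + 1)) →₀ ℕ)
    (h : Finsupp.weight (multiDeg a) d = 0) : d = 0 := by
  ext ⟨i, j⟩
  have h1 := congrFun h i
  rw [weight_multiDeg_apply, Pi.zero_apply, Finset.sum_eq_zero_iff] at h1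
  exact h1 j (Finset.mem_univ j)

/-- Adding the variable `v` changes only the factor of its own block, where Pascal's rule applies.
-/
theorem hilbertFunction_multiDeg_coordIdeal (s : Finset (Σ i : Fin n, Fin (a i + 1)))
    (t : Fin n → ℕ) :
    hilbertFunction (multiDeg a) (coordIdeal k s) t =
      ∏ i, Nat.multichoose (s.filter fun v => v.1 = i).card (t i) := by
  have hfin := finiteDimensional_multiDeg (k := k) (a := a)
  have hz : ∀ s : Finset (Σ i : Fin n, Fin (a i + 1)),
      hilbertFunction (multiDeg a) (coordIdeal k s) 0 = 1 := fun s =>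
    hilbertFunction_zero_eq_one weight_multiDeg_eq_zero (coordIdeal_isPrime s).ne_top
  induction s using Finset.induction_on generalizing t with
  | empty =>
    by_cases ht : t = 0
    · subst ht
      simp [hz]
    · rw [hilbertFunction_coordIdeal_empty_of_ne_zero hfin ht]
      obtain ⟨i, hi⟩ := Function.ne_iff.1 ht
      symm
      apply Finset.prod_eq_zero (Finset.mem_univ i)
      obtain ⟨c, hc⟩ := Nat.exists_eq_succ_of_ne_zero hi
      simp [hc]
  | insert v s hv ih =>
    have hN : ((insert v s).filter fun u => u.1 = v.1).card =
        (s.filter fun u => u.1 = v.1).card + 1 := by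
      rw [Finset.filter_insert, if_pos rfl, Finset.card_insert_of_notMem (by simp [hv])]
    have hN' : ∀ i, i ≠ v.1 → ((insert v s).filter fun u => u.1 = i) =
        s.filter fun u => u.1 = i := by
      intro i hi
      rw [Finset.filter_insert, if_neg (Ne.symm hi)]
    -- The recursion lowers the degree in the block of `v`, so a second induction runs over that
    -- entry.
    induction hτ : t v.1 generalizing t with
    | zero =>
      rw [hilbertFunction_coordIdeal_insert hfin hv, ih, shiftFun_eq_zero, add_zero]
      · refine Finset.prod_congr rfl fun i _ => ?_
        by_cases hi : i = v.1
        · subst hi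
          rw [hτ, Nat.multichoose_zero_right, Nat.multichoose_zero_right]
        · rw [hN' i hi]
      · rintro ⟨t', rfl⟩
        simp [multiDeg] at hτ
    | succ τ ihτ =>
      obtain ⟨t', rfl⟩ : ∃ t', t = t' + multiDeg a v := by
        refine ⟨t - multiDeg a v, (tsub_add_cancel_of_le fun i => ?_).symm⟩
        rw [multiDeg, Pi.single_apply]
        split_ifs with h
        · have h1 : 1 ≤ t v.1 := by omega
          rw [h]
          exact h1
        · exact Nat.zero_le _
      have hτ' : t' v.1 = τ := by simpa [multiDeg] using hτ
      have hne : ∀ i, i ≠ v.1 → (t' + multiDeg a v) i = t' i := by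
        intro i hi
        simp [multiDeg, hi]
      rw [hilbertFunction_coordIdeal_insert hfin hv, ih, shiftFun_add, ihτ t' hτ',
        ← Finset.mul_prod_erase _ _ (Finset.mem_univ v.1),
        ← Finset.mul_prod_erase _ _ (Finset.mem_univ v.1),
        ← Finset.mul_prod_erase _ _ (Finset.mem_univ v.1), hN, hτ, hτ',
        Nat.multichoose_succ_succ, add_mul]
      congr 2
      · refine Finset.prod_congr rfl fun i hi => ?_
        rw [hN' i (Finset.ne_of_mem_erase hi)]
      · refine Finset.prod_congr rfl fun i hi => ?_
        rw [hne i (Finset.ne_of_mem_erase hi)]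

end CoordinateIdeals

/-! ### Asymptotics of multiset numbers -/

section Multichoose

theorem factorial_mul_multichoose (α t : ℕ) :
    α.factorial * Nat.multichoose (α + 1) t = ∏ j ∈ Finset.range α, (t + 1 + j) := by
  rw [← Nat.ascFactorial_eq_prod_range, Nat.ascFactorial_eq_factorial_mul_choose,
    Nat.multichoose_eq, Nat.add_right_comm, Nat.add_sub_cancel, add_comm α t,
    Nat.choose_symm_add]

/-- Factor by factor, `b t + 1 + j ≤ b (t + 1 + j)`. With the shifted bound in the other direction
this replaces an expansion of `binom(b t + α, α)` by a squeeze. -/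
theorem multichoose_mul_le {b : ℕ} (hb : 0 < b) (α t : ℕ) :
    Nat.multichoose (α + 1) (b * t) ≤ b ^ α * Nat.multichoose (α + 1) t := by
  refine Nat.le_of_mul_le_mul_left ?_ α.factorial_pos
  rw [mul_left_comm, factorial_mul_multichoose, factorial_mul_multichoose]
  conv_rhs => rw [← Finset.card_range α, ← Finset.prod_const, Finset.card_range,
    ← Finset.prod_mul_distrib]
  refine Finset.prod_le_prod' fun j _ => ?_
  nlinarith

/-- Factor by factor, `b (t + 1 + j) ≤ b (t + α) + 1 + j` for `j < α`; this is where the shift by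
`α` comes from. -/
theorem le_multichoose_mul_add {b : ℕ} (α t : ℕ) :
    b ^ α * Nat.multichoose (α + 1) t ≤ Nat.multichoose (α + 1) (b * (t + α)) := by
  refine Nat.le_of_mul_le_mul_left ?_ α.factorial_pos
  rw [mul_left_comm, factorial_mul_multichoose, factorial_mul_multichoose]
  conv_lhs => rw [← Finset.card_range α, ← Finset.prod_const, Finset.card_range,
    ← Finset.prod_mul_distrib]
  refine Finset.prod_le_prod' fun j hj => ?_
  have h1 : j + 1 ≤ α := Finset.mem_range.1 hj
  have h2 : b * (j + 1) ≤ b * α := Nat.mul_le_mul_left b h1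
  nlinarith

theorem tendsto_multichoose_div_pow (m : ℕ) :
    Tendsto (fun s : ℕ => (Nat.multichoose (m + 1) s : ℚ) / (s : ℚ) ^ m) atTop
      (𝓝 (1 / (m.factorial : ℚ))) := by
  have h1 : Tendsto (fun s : ℕ => (m.factorial : ℚ)⁻¹ *
      ∏ j ∈ Finset.range m, (1 + ((1 + j : ℕ) : ℚ) / s)) atTop
      (𝓝 ((m.factorial : ℚ)⁻¹ * ∏ j ∈ Finset.range m, (1 + 0))) := by
    refine (tendsto_finsetProd _ fun j _ => ?_).const_mul _
    exact (tendsto_const_div_atTop_nhds_zero_nat ((1 + j : ℕ) : ℚ)).const_add 1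
  simp only [add_zero, Finset.prod_const_one, mul_one] at h1
  rw [one_div]
  refine h1.congr' ?_
  filter_upwards [eventually_gt_atTop 0] with s hs
  have hs' : (s : ℚ) ≠ 0 := by positivity
  have h2 : ((m.factorial * Nat.multichoose (m + 1) s : ℕ) : ℚ) =
      ((∏ j ∈ Finset.range m, (s + 1 + j) : ℕ) : ℚ) := by rw [factorial_mul_multichoose]
  have h3 : ∏ j ∈ Finset.range m, (1 + ((1 + j : ℕ) : ℚ) / s) =
      ((∏ j ∈ Finset.range m, (s + 1 + j) : ℕ) : ℚ) / (s : ℚ) ^ m := by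
    rw [Nat.cast_prod]
    conv_rhs => rw [← Finset.card_range m, ← Finset.prod_const, Finset.card_range,
      ← Finset.prod_div_distrib]
    refine Finset.prod_congr rfl fun j _ => ?_
    push_cast
    field_simp
    ring
  rw [h3, ← h2]
  push_cast
  have : (m.factorial : ℚ) ≠ 0 := by positivity
  field_simp

end Multichoose

section LinearSubspaces

/-! ### Products of linear subspaces -/

variable {k : Type*} [Field k] {n : ℕ} {a b : Fin n → ℕ}

/-- The variables `x_{i,j}` with `j ≤ α_i`. -/
def keptVars (α : (i : Fin n) → Fin (a i + 1)) : Finset (Σ i : Fin n, Fin (a i + 1)) :=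
  Finset.univ.filter fun v => v.2 ≤ α v.1

theorem coordIdeal_keptVars (α : (i : Fin n) → Fin (a i + 1)) :
    Ideal.span {f : CoxRing k a | ∃ (i : Fin n) (j : Fin (a i + 1)), α i < j ∧ f = X ⟨i, j⟩} =
      coordIdeal k (keptVars α) := by
  rw [coordIdeal]
  congr 1
  ext f
  constructor
  · rintro ⟨i, j, hij, rfl⟩
    exact ⟨⟨i, j⟩, by simpa [keptVars] using hij, rfl⟩
  · rintro ⟨⟨i, j⟩, hij, rfl⟩
    exact ⟨i, j, by simpa [keptVars] using hij, rfl⟩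

theorem card_filter_keptVars (α : (i : Fin n) → Fin (a i + 1)) (i : Fin n) :
    ((keptVars α).filter fun v => v.1 = i).card = α i + 1 := by
  have : ((keptVars α).filter fun v => v.1 = i) =
      (Finset.Iic (α i)).map (Function.Embedding.sigmaMk (β := fun i => Fin (a i + 1)) i) := by
    ext ⟨i', j⟩
    simp only [keptVars, Finset.mem_filter, Finset.mem_univ, true_and, Finset.mem_map,
      Finset.mem_Iic, Function.Embedding.sigmaMk_apply]
    constructor
    · rintro ⟨h, rfl⟩
      exact ⟨j, h, rfl⟩
    · rintro ⟨j', h, h'⟩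
      cases h'
      exact ⟨h, rfl⟩
  rw [this, Finset.card_map, Fin.card_Iic]

theorem card_keptVars (α : (i : Fin n) → Fin (a i + 1)) :
    (keptVars α).card = ∑ i, (α i : ℕ) + n := by
  rw [Finset.card_eq_sum_card_fiberwise (f := Sigma.fst) (t := Finset.univ)
    fun _ _ => Finset.mem_coe.2 (Finset.mem_univ _)]
  simp [card_filter_keptVars, Finset.sum_add_distrib]

theorem isRelevant_coordIdeal_keptVars (α : (i : Fin n) → Fin (a i + 1)) :
    IsRelevant (coordIdeal k (keptVars α)) := by
  intro i hi
  have := irrelevant_le_iff_forall.1 hi 0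
  rw [X_mem_coordIdeal] at this
  simp [keptVars] at this

theorem hilbertFunction_coordIdeal_keptVars (α : (i : Fin n) → Fin (a i + 1)) (t : Fin n → ℕ) :
    hilbertFunction (multiDeg a) (coordIdeal k (keptVars α)) t =
      ∏ i, Nat.multichoose (α i + 1) (t i) := by
  rw [hilbertFunction_multiDeg_coordIdeal]
  simp only [card_filter_keptVars]

/-- The summand `∏ binom(b_i t_i + α_i, α_i)` is squeezed, up to a shift of `t` by `α`, between
copies of `∏ b_i^{α_i} binom(t_i + α_i, α_i)`, whose diagonal sums are known exactly. -/
theorem tendsto_diagSum_coordIdeal (hb : ∀ i, 0 < b i) (α : (i : Fin n) → Fin (a i + 1)) {m : ℕ}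
    (hm : ∑ i, (α i : ℕ) + n = m + 1) :
    Tendsto (fun s : ℕ =>
      (diagSum b (hilbertFunction (multiDeg a) (coordIdeal k (keptVars α))) s : ℚ) / (s : ℚ) ^ m)
      atTop (𝓝 ((∏ i, b i ^ (α i : ℕ) : ℕ) / (m.factorial : ℚ))) := by
  have hH := hilbertFunction_coordIdeal_keptVars (k := k) α
  -- A Vandermonde identity, read off by computing the Hilbert function of a polynomial ring in `m +
  -- 1` variables with its blocks and without them.
  have hs : ∀ s, ∑ t ∈ Finset.piAntidiag Finset.univ s,
      ∏ i, (b i ^ (α i : ℕ) * Nat.multichoose (α i + 1) (t i)) =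
      (∏ i, b i ^ (α i : ℕ)) * Nat.multichoose (m + 1) s := by
    intro s
    rw [← hm, ← card_keptVars, ← hilbertFunction_one_coordIdeal (k := k),
      hilbertFunction_one_eq_sum_blockDeg (homIdeal_coordIdeal _), Finset.mul_sum]
    refine Finset.sum_congr rfl fun t _ => ?_
    rw [Finset.prod_mul_distrib, ← multiDeg_eq_blockDeg, hH]
  have hlim : Tendsto (fun s : ℕ =>
      (((∏ i, b i ^ (α i : ℕ)) * Nat.multichoose (m + 1) s : ℕ) : ℚ) / (s : ℚ) ^ m)
      atTop (𝓝 ((∏ i, b i ^ (α i : ℕ) : ℕ) / (m.factorial : ℚ))) := by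
    have := (tendsto_multichoose_div_pow m).const_mul ((∏ i, b i ^ (α i : ℕ) : ℕ) : ℚ)
    rw [mul_one_div] at this
    refine this.congr fun s => ?_
    rw [Nat.cast_mul, mul_div_assoc]
  refine tendsto_div_pow_of_le (C := ∑ i, (α i : ℕ)) hlim hlim (fun s => ?_) fun s => ?_
  · rw [← hs]
    -- As `diagSum` evaluates at `b * t`, the comparison function divides by `b_i` to recover `t_i`.
    refine (diagSum_le_diagSumFrom_add (c := fun i => (α i : ℕ)) (b := b)
      (H' := fun t => ∏ i, (b i ^ (α i : ℕ) * Nat.multichoose (α i + 1) (t i / b i)))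
      (H := hilbertFunction (multiDeg a) (coordIdeal k (keptVars α))) (fun t => ?_) s).trans'
      (le_of_eq ?_) |>.trans (diagSumFrom_le (fun _ _ => le_rfl) _)
    · rw [hH]
      refine Finset.prod_le_prod' fun i _ => ?_
      rw [mulHom_apply, mulHom_apply, Nat.mul_div_cancel_left _ (hb i)]
      exact le_multichoose_mul_add _ _
    · refine Finset.sum_congr rfl fun t _ => Finset.prod_congr rfl fun i _ => ?_
      rw [mulHom_apply, Nat.mul_div_cancel_left _ (hb i)]
  · rw [← hs]
    refine Finset.sum_le_sum fun t _ => ?_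
    rw [hH]
    exact Finset.prod_le_prod' fun i _ => multichoose_mul_le (hb i) _ _

/-- The limit of the diagonal sum over `s^m` is finite and nonzero, so the Hilbert polynomial has
degree exactly `m`; this gives the dimension. -/
theorem quotDim_coordIdeal (hn : 0 < n) (hb : ∀ i, 0 < b i) (α : (i : Fin n) → Fin (a i + 1)) :
    quotDim (coordIdeal k (keptVars α)) = ∑ i, (α i : ℕ) + n := by
  obtain ⟨m, hm⟩ : ∃ m, ∑ i, (α i : ℕ) + n = m + 1 := ⟨∑ i, (α i : ℕ) + n - 1, by omega⟩
  have hp := coordIdeal_isPrime (k := k) (keptVars α)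
  obtain ⟨P, hP, hdeg⟩ := exists_hilbertPoly_diagSum (b := b) hb
    (homIdeal_coordIdeal (k := k) (w := multiDeg a) (keptVars α))
  have hlim := tendsto_diagSum_coordIdeal (k := k) hb α hm
  have hlim' : Tendsto (fun s : ℕ => P.eval (s : ℚ) / (s : ℚ) ^ m) atTop
      (𝓝 ((∏ i, b i ^ (α i : ℕ) : ℕ) / (m.factorial : ℚ))) := by
    refine hlim.congr' ?_
    filter_upwards [hP] with s hs
    rw [hs]
  set B : ℚ := (∏ i, b i ^ (α i : ℕ) : ℕ) / (m.factorial : ℚ) with hB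
  have hB0 : B ≠ 0 := by
    have : 0 < ∏ i, b i ^ (α i : ℕ) := Finset.prod_pos fun i _ => pow_pos (hb i) _
    positivity
  have h1 : P.degree < (m + 1 : ℕ) := by
    refine degree_lt_of_eventually_le_pow (C := B + 1) ?_ ?_
    · filter_upwards [hP] with s hs
      rw [← hs]
      positivity
    · filter_upwards [hlim'.eventually_le_const (lt_add_one B), eventually_gt_atTop 0]
        with s hs hs0
      rwa [div_le_iff₀ (by positivity)] at hs
  have h2 : P.coeff m = B := tendsto_nhds_unique (tendsto_eval_div_pow h1) hlim'
  have h3 := (quotDim_le_iff hp.ne_top).2 ((hdeg (m + 1)).2 h1)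
  have h4 : ¬ quotDim (coordIdeal k (keptVars α)) ≤ m := by
    rw [quotDim_le_iff hp.ne_top, hdeg]
    intro h
    exact hB0 (h2 ▸ Polynomial.coeff_eq_zero_of_degree_lt h)
  omega

theorem cycleDegree_coordIdeal (hn : 0 < n) (hb : ∀ i, 0 < b i)
    (α : (i : Fin n) → Fin (a i + 1)) (m : ℕ) :
    cycleDegree k a b m (fundamentalCycle (coordIdeal k (keptVars α))) =
      if ∑ i, (α i : ℕ) + n = m + 1 then
        ((∏ i, b i ^ (α i : ℕ) : ℕ) : ℚ) / (m.factorial : ℚ) else 0 := by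
  classical
  have hp := coordIdeal_isPrime (k := k) (keptVars α)
  have hw := homIdeal_coordIdeal (k := k) (w := multiDeg a) (keptVars α)
  have hL : IsPrimeFiltration (multiDeg a) (coordIdeal k (keptVars α))
      [(coordIdeal k (keptVars α), 0)] :=
    ⟨by simpa, by simpa, by simp, fun t => by simp [shiftFun_zero], fun p _ => by simp⟩
  have hdim := quotDim_coordIdeal (k := k) hn hb α
  rw [cycleDegree_fundamentalCycle hL, List.map_singleton, List.sum_singleton, if_pos
    ⟨by simp [Ideal.minimalPrimes_eq_subsingleton_self], isRelevant_coordIdeal_keptVars α⟩]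
  split_ifs with hm
  · exact tendsto_nhds_unique (tendsto_diagSum hb hp.ne_top hw (by omega))
      (tendsto_diagSum_coordIdeal hb α hm)
  · exact leadCoeff_eq_zero hb hp.ne_top hw (by omega)

end LinearSubspaces
end CorrScroll

namespace CorrScroll
open MvPolynomial Filter Topology

section MultiProjDimension

/-! ### The dimension of closed subschemes of a product of projective spaces -/

variable {k : Type*} [Field k] {n : ℕ} {a : Fin n → ℕ}

theorem hilbertFunction_coordIdeal_zero (t : Fin n → ℕ) :
    hilbertFunction (multiDeg a) (coordIdeal k (keptVars (0 : (i : Fin n) → Fin (a i + 1)))) t =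
      1 := by
  rw [hilbertFunction_coordIdeal_keptVars]
  simp

theorem quotDim_coordIdeal_zero (hn : 0 < n) :
    quotDim (coordIdeal k (keptVars (0 : (i : Fin n) → Fin (a i + 1)))) = n := by
  rw [quotDim_coordIdeal (b := 1) hn (fun _ => zero_lt_one)]
  simp

/-- With `b = 1` the diagonal sums have Hilbert polynomials whose degrees determine the dimensions,
and a bound between the sums bounds the degrees. -/
theorem quotDim_le_of_hilbertFunction_le {p q : Ideal (CoxRing k a)} [hp : p.IsPrime]
    [hq : q.IsPrime] (hpw : HomIdeal (multiDeg a) p) (hqw : HomIdeal (multiDeg a) q) {C : ℕ}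
    (h : ∀ t, hilbertFunction (multiDeg a) p t ≤ C * hilbertFunction (multiDeg a) q t) :
    quotDim p ≤ quotDim q := by
  obtain ⟨P, hP, hPd⟩ := exists_hilbertPoly_diagSum (b := 1) (fun _ => zero_lt_one) hpw
  obtain ⟨Q, hQ, hQd⟩ := exists_hilbertPoly_diagSum (b := 1) (fun _ => zero_lt_one) hqw
  have hPQ : P.degree ≤ (Polynomial.C (C : ℚ) * Q).degree := by
    refine degree_le_of_eventually_le ?_ ?_
    · filter_upwards [hP] with s hs
      rw [← hs]
      positivity
    · filter_upwards [hP, hQ] with s hs hs'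
      rw [Polynomial.eval_mul, Polynomial.eval_C, ← hs, ← hs']
      have : diagSum 1 (hilbertFunction (multiDeg a) p) s ≤
          C * diagSum 1 (hilbertFunction (multiDeg a) q) s := by
        rw [diagSum, diagSum, Finset.mul_sum]
        exact Finset.sum_le_sum fun t _ => h _
      exact_mod_cast this
  rw [quotDim_le_iff hp.ne_top, hPd]
  refine (hPQ.trans ?_).trans_lt ((hQd _).1 ((quotDim_le_iff hq.ne_top).1 le_rfl))
  rw [← Polynomial.smul_eq_C_mul]
  exact Polynomial.degree_smul_le _ _

/-- The Hilbert function is at least `1` in every multidegree, like that of the coordinate point,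
whose cone has dimension `n`. -/
theorem le_quotDim_of_isRelevant (hn : 0 < n) {p : Ideal (CoxRing k a)} [hp : p.IsPrime]
    (hpw : HomIdeal (multiDeg a) p) (hr : IsRelevant p) : n ≤ quotDim p := by
  refine (quotDim_coordIdeal_zero (k := k) (a := a) hn).ge.trans ?_
  refine quotDim_le_of_hilbertFunction_le (C := 1) (homIdeal_coordIdeal _) hpw fun t => ?_
  rw [hilbertFunction_coordIdeal_zero, one_mul]
  refine (hilbertFunction_zero_eq_one (w := multiDeg a) weight_multiDeg_eq_zero
    hp.ne_top).ge.trans ?_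
  simpa using hilbertFunction_le_add hpw hr 0 t

theorem exists_hilbertFunction_eq_zero {J : Ideal (CoxRing k a)} (hJ : HomIdeal (multiDeg a) J)
    (hirr : ∀ q ∈ J.minimalPrimes, ¬ IsRelevant q) :
    ∃ c : Fin n → ℕ, ∀ t, c ≤ t → hilbertFunction (multiDeg a) J t = 0 := by
  obtain ⟨L, hL⟩ := exists_isPrimeFiltration (primeTest_pi _) finiteDimensional_multiDeg hJ
  refine ⟨(L.map Prod.snd).sum + 1, fun t ht => ?_⟩
  rw [hL.hilbertFunction_eq]
  refine List.sum_eq_zero fun y hy => ?_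
  obtain ⟨x, hx, rfl⟩ := List.mem_map.1 hy
  have hxp := hL.isPrime x hx
  obtain ⟨q, hq, hqx⟩ := Ideal.exists_minimalPrimes_le (hL.le x hx)
  have hxr : ¬ IsRelevant x.1 := fun h => hirr q hq (h.of_le hqx)
  unfold IsRelevant at hxr
  push Not at hxr
  obtain ⟨i, hi⟩ := hxr
  refine shiftFun_eq_zero_of_irrelevant_le hi ?_
  have h1 : x.2 ≤ (L.map Prod.snd).sum := List.le_sum_of_mem (List.mem_map_of_mem hx)
  exact Nat.lt_of_lt_of_le (Nat.lt_succ_of_le (h1 i)) (ht i)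

/-- Otherwise every section of `p` by an omitted variable `x_{i,j_i}` is supported on irrelevant
primes, so its Hilbert function vanishes in large degrees. Then the Hilbert function of `p` is
constant far out, hence bounded, and the cone has dimension at most `n`. -/
theorem exists_isRelevant_quotDim_add_one (hn : 0 < n) {p : Ideal (CoxRing k a)} [hp : p.IsPrime]
    (hpw : HomIdeal (multiDeg a) p) (hr : IsRelevant p) (hdim : n < quotDim p) :
    ∃ q : Ideal (CoxRing k a), q.IsPrime ∧ HomIdeal (multiDeg a) q ∧ IsRelevant q ∧ p < q ∧
      quotDim q + 1 = quotDim p := by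
  by_contra! hcon
  obtain ⟨j, hj⟩ := hr.exists_X_notMem
  have hX : ∀ i, IsWeightedHomogeneous (multiDeg a) (X ⟨i, j i⟩ : CoxRing k a) (Pi.single i 1) :=
    fun i => isWeightedHomogeneous_X k _ _
  have h1 : ∀ i, ∃ c : Fin n → ℕ, ∀ t, c ≤ t →
      hilbertFunction (multiDeg a) (p ⊔ Ideal.span {X ⟨i, j i⟩}) t = 0 := by
    intro i
    refine exists_hilbertFunction_eq_zero (hpw.sup_span_singleton (hX i)) fun q hq hqr => ?_
    refine hcon q hq.1.1 ((hpw.sup_span_singleton (hX i)).multiDeg_of_mem_minimalPrimes hq) hqr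
      (lt_of_le_of_ne (le_sup_left.trans hq.1.2) fun h => hj i ?_)
      (quotDim_add_one_of_mem_minimalPrimes (hj i) hq)
    rw [h]
    exact hq.1.2 (Ideal.mem_sup_right (Ideal.mem_span_singleton_self _))
  choose c hc using h1
  set c₀ := ∑ i, c i with hc₀
  have hcc : ∀ i, c i ≤ c₀ := fun i =>
    Finset.single_le_sum (f := c) (fun _ _ => zero_le) (Finset.mem_univ i)
  have hstep : ∀ t i, c₀ ≤ t → hilbertFunction (multiDeg a) p (t + Pi.single i 1) =
      hilbertFunction (multiDeg a) p t := by
    intro t i ht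
    rw [hilbertFunction_add finiteDimensional_multiDeg hpw (hX i), colonElem_eq_self (hj i),
      hc i _ ((hcc i).trans (ht.trans le_self_add)), zero_add]
  have hconst : ∀ (s : ℕ) (t : Fin n → ℕ), ∑ i, t i = s →
      hilbertFunction (multiDeg a) p (t + c₀) = hilbertFunction (multiDeg a) p c₀ := by
    intro s
    induction s with
    | zero =>
      intro t ht
      have : t = 0 := funext fun i => (Finset.sum_eq_zero_iff.1 ht) i (Finset.mem_univ i)
      rw [this, zero_add]
    | succ s ih =>
      intro t ht
      obtain ⟨i, -, hi⟩ := Finset.exists_ne_zero_of_sum_ne_zero (ht.trans_ne s.succ_ne_zero)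
      obtain ⟨t', rfl⟩ : ∃ t', t = t' + Pi.single i 1 := by
        refine ⟨t - Pi.single i 1, (tsub_add_cancel_of_le fun i' => ?_).symm⟩
        rw [Pi.single_apply]
        split_ifs with h
        · exact h ▸ Nat.one_le_iff_ne_zero.2 hi
        · exact Nat.zero_le _
      rw [add_right_comm, hstep _ _ le_add_self]
      refine ih t' ?_
      simpa [Finset.sum_add_distrib] using ht
  -- By monotonicity the eventual constant bounds the Hilbert function everywhere; compare with the
  -- coordinate point.
  have hle : quotDim p ≤ n := by
    refine le_trans ?_ (quotDim_coordIdeal_zero (k := k) (a := a) hn).le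
    refine quotDim_le_of_hilbertFunction_le (C := hilbertFunction (multiDeg a) p c₀) hpw
      (homIdeal_coordIdeal _) fun t => ?_
    rw [hilbertFunction_coordIdeal_zero, mul_one, ← hconst _ t rfl]
    exact hilbertFunction_le_add hpw hr t c₀
  omega

theorem topologicalKrullDim_multiProjLocus_le_iff (hn : 0 < n) (I : Ideal (CoxRing k a)) (m : ℕ) :
    topologicalKrullDim (multiProjLocus I) ≤ m ↔
      ∀ x : multiProjLocus I, quotDim x.1.1.asIdeal ≤ m + n := by
  refine topologicalKrullDim_le_iff_quotDim (fun x : multiProjLocus I => x.1.1.asIdeal)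
    (fun x => x.1.isPrime) ?_ ?_ ?_ ?_ ?_ m
  · exact fun x y h => Subtype.ext (MultiProj.asIdeal_injective h)
  · intro Z
    rw [isClosed_induced_iff]
    constructor
    · rintro ⟨t, ht, rfl⟩
      obtain ⟨t', ht', rfl⟩ := isClosed_induced_iff.1 ht
      obtain ⟨s, rfl⟩ := (PrimeSpectrum.isClosed_iff_zeroLocus t').1 ht'
      exact ⟨s, rfl⟩
    · rintro ⟨s, rfl⟩
      exact ⟨{x | s ⊆ x.1.asIdeal},
        isClosed_induced_iff.2 ⟨_, PrimeSpectrum.isClosed_zeroLocus s, rfl⟩, rfl⟩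
  · rintro Z ⟨z, hz⟩ hpr
    have hle : (⨅ x : Z, x.1.1.1.asIdeal) ≤ z.1.1.asIdeal :=
      iInf_le (fun x : Z => x.1.1.1.asIdeal) ⟨z, hz⟩
    obtain ⟨y, hy⟩ := exists_multiProj_eq hpr (HomIdeal.iInf fun x : Z => x.1.1.homIdeal)
      (z.1.isRelevant.of_le hle)
    refine ⟨⟨y, ?_⟩, hy⟩
    change I ≤ y.1.asIdeal
    rw [hy]
    exact le_iInf fun x : Z => x.1.2
  · intro x
    have := x.1.isPrime
    exact le_quotDim_of_isRelevant hn x.1.homIdeal x.1.isRelevant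
  · intro x hx
    have := x.1.isPrime
    obtain ⟨q, hq, hqw, hqr, hlt, hqd⟩ :=
      exists_isRelevant_quotDim_add_one hn x.1.homIdeal x.1.isRelevant hx
    obtain ⟨y, rfl⟩ := exists_multiProj_eq hq hqw hqr
    exact ⟨⟨y, le_trans x.2 hlt.le⟩, hlt, hqd⟩

/-- All minimal primes of `I` are relevant, so they are points of the subscheme, and the largest
cone over a point has the dimension of `A/I`. Each of the `n` factors adds one to the dimension of
the cone. -/
theorem ringKrullDim_eq_of_topologicalKrullDim_multiProjLocus (hn : 0 < n)
    {I : Ideal (CoxRing k a)} (hI : HomIdeal (multiDeg a) I) (hI' : NoIrrelevantComponent I)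
    {d : ℕ} (hd : topologicalKrullDim (multiProjLocus I) = (d : WithBot ℕ∞)) :
    ringKrullDim (CoxRing k a ⧸ I) = (d + n : ℕ) := by
  have key : ∀ m : ℕ, d ≤ m ↔ ∀ x : multiProjLocus I, quotDim x.1.1.asIdeal ≤ m + n := by
    intro m
    rw [← topologicalKrullDim_multiProjLocus_le_iff hn, hd]
    norm_cast
  have hupper : ringKrullDim (CoxRing k a ⧸ I) ≤ (d + n : ℕ) := by
    rw [ringKrullDim_quotient_le_iff_minimalPrimes]
    intro q hq
    obtain ⟨y, rfl⟩ := exists_multiProj_eq hq.1.1 (hI.multiDeg_of_mem_minimalPrimes hq)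
      (hI'.isRelevant hq)
    rw [← quotDim_le_iff hq.1.1.ne_top]
    exact (key d).1 le_rfl ⟨y, hq.1.2⟩
  have hx : ∃ x : multiProjLocus I, d + n ≤ quotDim x.1.1.asIdeal := by
    by_contra! hcon
    -- For `d = 0` the locus would be empty and have dimension `⊥`; otherwise the criterion would
    -- hold with `d - 1`.
    cases d with
    | zero =>
      have : IsEmpty (multiProjLocus I) := ⟨fun x => by
        have := x.1.isPrime
        have h1 := le_quotDim_of_isRelevant hn x.1.homIdeal x.1.isRelevant
        have h2 := hcon x
        omega⟩
      have hbot : topologicalKrullDim (multiProjLocus I) = ⊥ := by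
        have : IsEmpty (TopologicalSpace.IrreducibleCloseds (multiProjLocus I)) :=
          ⟨fun Z => this.elim Z.isIrreducible.nonempty.some⟩
        exact Order.krullDim_eq_bot
      rw [hbot] at hd
      exact absurd hd (by simp)
    | succ d =>
      have := (key d).2 fun x => by
        have := hcon x
        omega
      omega
  obtain ⟨x, hx⟩ := hx
  refine le_antisymm hupper (le_trans ?_ (ringKrullDim_quotient_le_of_le x.2))
  rw [ringKrullDim_eq_quotDim x.1.isPrime.ne_top]
  exact_mod_cast hx

end MultiProjDimension

/-! ### The degree formula -/

section Degree

variable {k : Type*} [Field k] {n : ℕ} {a b : Fin n → ℕ}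

theorem eq_natCast_of_add_one_eq {x : WithBot ℕ∞} {m : ℕ} (h : x + 1 = (m + 1 : ℕ)) : x = m := by
  induction x using WithBot.recBotCoe with
  | bot =>
    rw [WithBot.bot_add] at h
    exact absurd h (WithBot.bot_ne_natCast _)
  | coe x =>
    induction x using ENat.recTopCoe with
    | top => exact absurd h (by exact_mod_cast WithTop.top_ne_natCast (m + 1))
    | coe x =>
      have h1 : x + 1 = m + 1 := by exact_mod_cast h
      exact_mod_cast Nat.succ_injective h1

theorem topologicalKrullDim_projLocus_scrollIdeal (hb : ∀ i, 0 < b i) {I : Ideal (CoxRing k a)}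
    (hI : HomIdeal (multiDeg a) I) (hne : (projLocus (scrollIdeal b I)).Nonempty) :
    topologicalKrullDim (projLocus (scrollIdeal b I)) + 1 = ringKrullDim (CoxRing k a ⧸ I) := by
  rw [topologicalKrullDim_projLocus_add_one (homIdeal_scrollIdeal hb hI).of_blockDeg hne,
    ringKrullDim_scrollIdeal hb]

theorem projLocus_scrollIdeal_eq_empty_iff (hb : ∀ i, 0 < b i) {I : Ideal (CoxRing k a)}
    (hI : HomIdeal (multiDeg a) I) :
    projLocus (scrollIdeal b I) = ∅ ↔ ringKrullDim (CoxRing k a ⧸ I) ≤ 0 := by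
  rw [projLocus_eq_empty_iff (homIdeal_scrollIdeal hb hI).of_blockDeg, ringKrullDim_scrollIdeal hb]

/-- A product of linear subspaces with `|α| ≠ d` has the wrong dimension for `m` and contributes
zero, so only the terms with `|α| = d` remain. -/
theorem cycleDegree_eq_sum_of_chowClass_eq (hn : 0 < n) (hb : ∀ i, 0 < b i)
    {I : Ideal (CoxRing k a)} {r : ((i : Fin n) → Fin (a i + 1)) → ℤ}
    (hr : chowClass I = ∑ α, r α • zetaPow k a α) {d m : ℕ} (hm : d + n = m + 1) :
    cycleDegree k a b m (fundamentalCycle I) =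
      (∑ α : (i : Fin n) → Fin (a i + 1) with ∑ i, (α i : ℕ) = d,
        r α * ∏ i, (b i : ℤ) ^ (α i : ℕ) : ℤ) / (m.factorial : ℚ) := by
  have hz : ∀ α, zetaPow k a α = chowClass (coordIdeal k (keptVars α)) := fun α => by
    rw [zetaPow, coordIdeal_keptVars]
  simp only [hz] at hr
  rw [cycleDegree_eq_of_chowClass_eq hb m hr, Int.cast_sum, Finset.sum_div, Finset.sum_filter]
  refine Finset.sum_congr rfl fun α _ => ?_
  rw [cycleDegree_coordIdeal hn hb]
  by_cases h : ∑ i, (α i : ℕ) = d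
  · rw [if_pos (by omega), if_pos h]
    push_cast
    rw [mul_div_assoc]
  · rw [if_neg (by omega), if_neg h, mul_zero]

/-- The Hilbert polynomial has degree `m` because `A/I` has dimension `m + 1`. Its coefficient at
`m` is the limit of the diagonal sums, which is `cycleDegree` of the fundamental cycle and so
depends only on the Chow class. -/
theorem hasDegree_scrollIdeal (hn : 0 < n) (hb : ∀ i, 0 < b i) {I : Ideal (CoxRing k a)}
    (hI : HomIdeal (multiDeg a) I) (hI' : NoIrrelevantComponent I) {d : ℕ}
    {r : ((i : Fin n) → Fin (a i + 1)) → ℤ}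
    (hd : topologicalKrullDim (multiProjLocus I) = (d : WithBot ℕ∞))
    (hr : chowClass I = ∑ α, r α • zetaPow k a α) :
    HasDegree (scrollIdeal b I)
      (∑ α : (i : Fin n) → Fin (a i + 1) with ∑ i, (α i : ℕ) = d,
        r α * ∏ i, (b i : ℤ) ^ (α i : ℕ)) := by
  obtain ⟨m, hm⟩ : ∃ m, d + n = m + 1 := ⟨d + n - 1, by omega⟩
  have hdim := ringKrullDim_eq_of_topologicalKrullDim_multiProjLocus hn hI hI' hd
  rw [hm] at hdim
  obtain ⟨P, hP, hdeg⟩ := exists_hilbertPoly_diagSum hb hI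
  have h1 : P.degree < (m + 1 : ℕ) := (hdeg _).1 hdim.le
  have h2 : ¬ P.degree < m := by
    rw [← hdeg, hdim]
    intro h
    have : m + 1 ≤ m := by exact_mod_cast h
    omega
  have h3 : P.degree = m := le_antisymm (by
    rw [Polynomial.degree_lt_iff_coeff_zero] at h1
    rw [Polynomial.degree_le_iff_coeff_zero]
    intro N hN
    exact h1 N (by exact_mod_cast hN)) (not_lt.1 h2)
  have hcoeff : P.coeff m = cycleDegree k a b m (fundamentalCycle I) := by
    refine tendsto_nhds_unique (tendsto_eval_div_pow h1)
      ((tendsto_diagSum_of_noIrrelevantComponent hb hI hI' hdim.le).congr' ?_)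
    filter_upwards [hP] with s hs
    rw [hs]
  have hnat := Polynomial.natDegree_eq_of_degree_eq_some h3
  refine ⟨m, P, ?_, ?_, hnat, ?_⟩
  · apply eq_natCast_of_add_one_eq
    rw [← hdim]
    refine topologicalKrullDim_projLocus_scrollIdeal hb hI ?_
    rw [Set.nonempty_iff_ne_empty, Ne, projLocus_scrollIdeal_eq_empty_iff hb hI, hdim]
    intro h
    have : m + 1 ≤ 0 := by exact_mod_cast h
    omega
  · filter_upwards [hP] with s hs
    rw [← hs, hilbertFunction_scrollIdeal hb hI]
    rfl
  · rw [Polynomial.leadingCoeff, hnat, hcoeff, cycleDegree_eq_sum_of_chowClass_eq hn hb hr hm]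
    have : (m.factorial : ℚ) ≠ 0 := by positivity
    field_simp

end Degree
end CorrScroll

theorem theorem2p2 {k : Type*} [Field k] {n : ℕ} (hn : 0 < n) (a b : Fin n → ℕ)
    (ha : ∀ i, 0 < a i) (hb : ∀ i, 0 < b i)
    (I : Ideal (CorrScroll.CoxRing k a)) (hI : CorrScroll.IsMultigraded I) :
    -- dimension
    ((CorrScroll.projLocus (CorrScroll.scrollIdeal b I) = ∅ ↔
        ringKrullDim (CorrScroll.CoxRing k a ⧸ I) ≤ 0) ∧
      ((CorrScroll.projLocus (CorrScroll.scrollIdeal b I)).Nonempty →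
        topologicalKrullDim (CorrScroll.projLocus (CorrScroll.scrollIdeal b I)) + 1 =
          ringKrullDim (CorrScroll.CoxRing k a ⧸ I))) ∧
    -- Hilbert function
    (∀ s : ℕ,
      CorrScroll.hilbertFunction (fun _ : CorrScroll.ScrollVar a b => (1 : ℕ))
          (CorrScroll.scrollIdeal b I) s =
        ∑ t ∈ Finset.piAntidiag (Finset.univ : Finset (Fin n)) s,
          CorrScroll.hilbertFunction (CorrScroll.multiDeg a) I (fun i => b i * t i)) ∧
    -- degree
    (CorrScroll.NoIrrelevantComponent I →
      ∀ (d : ℕ) (r : ((i : Fin n) → Fin (a i + 1)) → ℤ),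
        topologicalKrullDim (CorrScroll.multiProjLocus I) = (d : WithBot ℕ∞) →
        CorrScroll.chowClass I = ∑ α, r α • CorrScroll.zetaPow k a α →
        CorrScroll.HasDegree (CorrScroll.scrollIdeal b I)
          (∑ α : (i : Fin n) → Fin (a i + 1) with ∑ i, (α i : ℕ) = d,
            r α * ∏ i, (b i : ℤ) ^ (α i : ℕ))) := by
  have hI' := CorrScroll.isMultigraded_iff_homIdeal.1 hI
  exact ⟨⟨CorrScroll.projLocus_scrollIdeal_eq_empty_iff hb hI',
    CorrScroll.topologicalKrullDim_projLocus_scrollIdeal hb hI'⟩,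
    CorrScroll.hilbertFunction_scrollIdeal hb hI',
    fun hsat _ _ hd hr => CorrScroll.hasDegree_scrollIdeal hn hb hI' hsat hd hr⟩
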